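/- Let $\mathcal X$ and $\mathcal V$ be finite-dimensional Euclidean spaces and let $\alpha\in(1/3,1/2]$. An $\alpha$-Hölder rough path on $\mathbb R$ is a pair $\mathbf W=(W,\mathbb W)$ of maps $W:\mathbb R\to\mathcal V$ with $W_0=0$ and $\mathbb W:\mathbb R^2\to\mathcal V\otimes\mathcal V$ such that, on every compact interval, $W$ is $\alpha$-Hölder and $|\mathbb W_{s,t}|\le C|t-s|^{2\alpha}$, and such that $\mathbb W_{s,t}-\mathbb W_{s,u}-\mathbb W_{u,t}=W_{s,u}\otimes W_{u,t}$ for all $s,u,t$, where $W_{s,t}=W_t-W_s$. Its shift by $\tau\in\mathbb R$ is $\Theta_\tau\mathbf W=\big(W_{\cdot+\tau}-W_\tau,\ \mathbb W_{\cdot+\tau,\cdot+\tau}\big)$. Let $A:\mathcal X\to\mathcal X$ be linear, $S(t)=e^{tA}$, let $F:\mathcal X\to\mathcal X$ be Lipschitz continuous, and let $G:\mathcal X\to\mathcal L(\mathcal V,\mathcal X)$ be of class $C^3_b$ (three times continuously differentiable, with $G$ and its derivatives up to order $3$ bounded). A (global mild) solution of the rough differential equation $dU=[AU+F(U)]\,dt+G(U)\,d\mathbf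 W$, $U_0=\xi\in\mathcal X$, is a path $U:[0,\infty)\to\mathcal X$ such that, on $[0,T]$ for every $T>0$, $(U,G(U))$ is a controlled rough path (i.e. $U$ and $G(U)$ are $\alpha$-Hölder and $U_t-U_s-G(U_s)W_{s,t}$ is $2\alpha$-Hölder), and $$U_t=S(t)\xi+\int_0^tS(t-r)F(U_r)\,dr+\int_0^tS(t-r)G(U_r)\,d\mathbf W_r\qquad\text{for all }t\ge0.$$ Here $\int_a^bY_r\,d\mathbf W_r=\lim_{|\mathcal P|\to0}\sum_{[u,v]\in\mathcal P}(Y_uW_{u,v}+Y'_u\mathbb W_{u,v})$ over partitions $\mathcal P$ of $[a,b]$, and for $Y_r=S(t-r)G(U_r)$ one takes $Y'_r=S(t-r)DG(U_r)G(U_r)$. Let $(\Omega,\mathcal F,\mathbb P,(\theta_t)_{t\in\mathbb R})$ be a metric dynamical system: $(\Omega,\mathcal F,\mathbb P)$ is a probability space, $(t,\omega)\mapsto\theta_t\omega$ is measurable, each $\theta_t$ preserves $\mathbb P$, $\theta_0=\mathrm{Id}$ and $\theta_{t+s}=\theta_t\circ\theta_s$. Let $\mathbf W=(W,\mathbb W)$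 be a rough path cocycle over it: a family $(\mathbf W(\omega))_{\omega\in\Omega}$ of $\alpha$-Hölder rough paths, measurable in $\omega$ (i.e. $\omega\mapsto W_t(\omega)$ and $\omega\mapsto\mathbb W_{s,t}(\omega)$ are measurable for all $s,t$), with $W_{s,s+t}(\omega)=W_{0,t}(\theta_s\omega)$ and $\mathbb W_{s,s+t}(\omega)=\mathbb W_{0,t}(\theta_s\omega)$ for all $\omega\in\Omega$, $s\in\mathbb R$, $t\ge0$. Then the equation has, for every $\alpha$-Hölder rough path $\mathbf X$ and every $\xi\in\mathcal X$, a unique solution $t\mapsto\varphi(t,\mathbf X,\xi)$ on $[0,\infty)$. The solution operator satisfies $$\varphi(t+\tau,\mathbf X,\xi)=\varphi\big(t,\Theta_\tau\mathbf X,\varphi(\tau,\mathbf X,\xi)\big)\qquad\text{for all }t,\tau\ge0,$$ one has $\mathbf W(\theta_\tau\omega)=\Theta_\tau\mathbf W(\omega)$ for all $\tau\in\mathbb R$ and $\omega\in\Omega$, and $(t,\omega,\xi)\mapsto\varphi(t,\mathbf W(\omega),\xi)$ is a measurable random dynamical system over $(\Omega,\mathcal F,\mathbb P,(\theta_t)_{t\in\mathbb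 R})$. That is, it is $\mathcal B([0,\infty))\otimes\mathcal F\otimes\mathcal B(\mathcal X)$-measurable, $\varphi(0,\mathbf W(\omega),\cdot)=\mathrm{Id}_{\mathcal X}$, $\varphi(t+\tau,\mathbf W(\omega),\xi)=\varphi(t,\mathbf W(\theta_\tau\omega),\varphi(\tau,\mathbf W(\omega),\xi))$ for all $t,\tau\ge0$, $\omega\in\Omega$ and $\xi\in\mathcal X$, and $\xi\mapsto\varphi(t,\mathbf W(\omega),\xi)$ is continuous for all $t\ge0$ and $\omega\in\Omega$. -/

import Mathlib

open MeasureTheory Set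
open scoped NNReal TensorProduct

noncomputable section

/-! ### Rough paths on the real line -/

section RoughPaths

/-- `R : ℝ → ℝ → E` is a two-parameter `β`-Hölder function on `s`. -/
def IsTwoParamHolderOn {E : Type*} [NormedAddCommGroup E] (β : ℝ) (R : ℝ → ℝ → E)
    (s : Set ℝ) : Prop :=
  ∃ C : ℝ, ∀ u ∈ s, ∀ v ∈ s, ‖R u v‖ ≤ C * |v - u| ^ β

/-- `f : ℝ → E` is `α`-Hölder on `s`. -/
def IsHolderOn {E : Type*} [NormedAddCommGroup E] (α : ℝ≥0) (f : ℝ → E) (s : Set ℝ) : Prop :=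
  ∃ C : ℝ≥0, HolderOnWith C α f s

/-- An `α`-Hölder rough path `(W, 𝕎)` on `ℝ` with values in `V`, started at `0`: on every compact
interval `W` is `α`-Hölder and `𝕎` is `2α`-Hölder, and Chen's relation holds. -/
structure RoughPath (α : ℝ≥0) (V : Type*) [NormedAddCommGroup V] [InnerProductSpace ℝ V] where
  /-- the path `W` -/
  path : ℝ → V
  /-- the second order process `𝕎` -/
  area : ℝ → ℝ → V ⊗[ℝ] V
  path_zero : path 0 = 0
  holder_path : ∀ a b : ℝ, IsHolderOn α path (Icc a b)
  holder_area : ∀ a b : ℝ, IsTwoParamHolderOn (2 * (α : ℝ)) area (Icc a b)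
  chen : ∀ s u t : ℝ,
    area s t - area s u - area u t = (path u - path s) ⊗ₜ[ℝ] (path t - path u)

variable {α : ℝ≥0} {V : Type*} [NormedAddCommGroup V] [InnerProductSpace ℝ V]
variable {E : Type*} [NormedAddCommGroup E] [NormedSpace ℝ E]

theorem add_mem_Icc_add {a b τ x : ℝ} (hx : x ∈ Icc a b) : x + τ ∈ Icc (a + τ) (b + τ) :=
  ⟨by linarith [hx.1], by linarith [hx.2]⟩

/-- The time shift `Θ_τ 𝐖 = (W_{· + τ} - W_τ, 𝕎_{· + τ, · + τ})`. -/
def RoughPath.shift (τ : ℝ) (W : RoughPath α V) : RoughPath α V where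
  path t := W.path (t + τ) - W.path τ
  area s t := W.area (s + τ) (t + τ)
  path_zero := by simp
  holder_path a b := by
    obtain ⟨C, hC⟩ := W.holder_path (a + τ) (b + τ)
    refine ⟨C, fun x hx y hy => ?_⟩
    have h := hC (x + τ) (add_mem_Icc_add hx) (y + τ) (add_mem_Icc_add hy)
    simpa [edist_dist, dist_eq_norm] using h
  holder_area a b := by
    obtain ⟨C, hC⟩ := W.holder_area (a + τ) (b + τ)
    refine ⟨C, fun x hx y hy => ?_⟩
    have h := hC (x + τ) (add_mem_Icc_add hx) (y + τ) (add_mem_Icc_add hy)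
    simpa using h
  chen s u t := by
    simpa using W.chen (s + τ) (u + τ) (t + τ)

/-! ### Controlled rough paths and the rough integral -/

/-- The identification `L(V, L(V, E)) ≃ L(V ⊗ V, E)`: `B` acts on tensors by
`v ⊗ w ↦ B v w`. -/
def tensorApply (B : V →L[ℝ] V →L[ℝ] E) : V ⊗[ℝ] V →ₗ[ℝ] E :=
  TensorProduct.lift B.toLinearMap₁₂

theorem tensorApply_tmul (B : V →L[ℝ] V →L[ℝ] E) (v w : V) :
    tensorApply B (v ⊗ₜ[ℝ] w) = B v w := by
  simp [tensorApply]

/-- `(Y, Y')` is controlled by `W` on `s`: `Y` and `Y'` are `α`-Hölder and the remainder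
`R_{u,v} = Y_v - Y_u - Y'_u (W_v - W_u)` is `2α`-Hölder. -/
structure IsControlledOn (α : ℝ≥0) (W : ℝ → V) (Y : ℝ → E) (Y' : ℝ → V →L[ℝ] E)
    (s : Set ℝ) : Prop where
  holder : IsHolderOn α Y s
  holder_deriv : IsHolderOn α Y' s
  holder_remainder :
    IsTwoParamHolderOn (2 * (α : ℝ)) (fun u v => Y v - Y u - Y' u (W v - W u)) s

/-- `p 0 ≤ p 1 ≤ … ≤ p n` is a partition of `[a, b]` into intervals of length less than `δ`. -/
structure IsPartition (a b δ : ℝ) (n : ℕ) (p : ℕ → ℝ) : Prop where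
  left : p 0 = a
  right : p n = b
  mono : ∀ i < n, p i ≤ p (i + 1)
  mesh : ∀ i < n, p (i + 1) - p i < δ

/-- `I = ∫_a^b Y d𝐖`, that is, `I` is the limit of the compensated Riemann sums
`∑ (Y_u W_{u,v} + Y'_u 𝕎_{u,v})` over partitions of `[a, b]` as the mesh tends to zero. -/
def HasRoughIntegral (W : RoughPath α V) (Y : ℝ → V →L[ℝ] E) (Y' : ℝ → V →L[ℝ] V →L[ℝ] E)
    (a b : ℝ) (I : E) : Prop :=
  ∀ ε > 0, ∃ δ > 0, ∀ (n : ℕ) (p : ℕ → ℝ), IsPartition a b δ n p →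
    ‖(∑ i ∈ Finset.range n,
        (Y (p i) (W.path (p (i + 1)) - W.path (p i))
          + tensorApply (Y' (p i)) (W.area (p i) (p (i + 1))))) - I‖ < ε

end RoughPaths

/-! ### The rough differential equation -/

section Equation

variable {α : ℝ≥0} {V : Type*} [NormedAddCommGroup V] [InnerProductSpace ℝ V]
variable {E : Type*} [NormedAddCommGroup E] [InnerProductSpace ℝ E]

/-- `G` is of class `C^m_b`: `m` times continuously differentiable, with `G` and its derivatives
up to order `m` bounded. -/
def IsCb {F : Type*} [NormedAddCommGroup F] [NormedSpace ℝ F] (m : ℕ) (G : E → F) : Prop :=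
  ContDiff ℝ m G ∧ ∀ k ≤ m, ∃ C : ℝ, ∀ x, ‖iteratedFDeriv ℝ k G x‖ ≤ C

/-- The group `S(t) = e^{tA}`. -/
def semigroup (A : E →L[ℝ] E) (t : ℝ) : E →L[ℝ] E := NormedSpace.exp (t • A)

/-- The Gubinelli derivative `DG(Y) Y'` of `G(Y)`. -/
def compDeriv (G : E → V →L[ℝ] E) (Y : ℝ → E) (Y' : ℝ → V →L[ℝ] E) (r : ℝ) :
    V →L[ℝ] V →L[ℝ] E :=
  (fderiv ℝ G (Y r)).comp (Y' r)

/-- The operator `B ↦ S B` acting on the values of `B : V → L(V, E)`. -/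
def postcomp (S : E →L[ℝ] E) (B : V →L[ℝ] V →L[ℝ] E) : V →L[ℝ] V →L[ℝ] E :=
  (ContinuousLinearMap.compL ℝ V E E S).comp B

/-- `U` (through its values on `[0, ∞)`) is a global mild solution of
`dU = (A U + F(U)) dt + G(U) d𝐖`, `U_0 = ξ`: for every horizon `(U, G(U))` is a controlled rough
path, and `U_t = S(t)ξ + ∫_0^t S(t-r) F(U_r) dr + ∫_0^t S(t-r) G(U_r) d𝐖_r` for all `t ≥ 0`.
The integrand of the rough integral has Gubinelli derivative `S(t-r) DG(U_r) G(U_r)`. -/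
structure IsMildSolution (A : E →L[ℝ] E) (F : E → E) (G : E → V →L[ℝ] E)
    (W : RoughPath α V) (ξ : E) (U : ℝ → E) : Prop where
  controlled : ∀ T : ℝ, 0 < T →
    IsControlledOn α W.path U (fun r => G (U r)) (Icc 0 T)
  mild : ∀ t : ℝ, 0 ≤ t → ∃ I : E,
    HasRoughIntegral W (fun r => (semigroup A (t - r)).comp (G (U r)))
      (fun r => postcomp (semigroup A (t - r)) (compDeriv G U (fun q => G (U q)) r)) 0 t I ∧
    U t = semigroup A t ξ + (∫ r in (0 : ℝ)..t, semigroup A (t - r) (F (U r))) + I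

end Equation

/-! ### Random dynamical systems -/

section RDS

variable {Ω : Type*} [MeasurableSpace Ω]

/-- `(Ω, 𝓕, P, θ)` is a metric dynamical system. -/
structure IsMetricDynamicalSystem (P : Measure Ω) (θ : ℝ → Ω → Ω) : Prop where
  prob : IsProbabilityMeasure P
  measurable : Measurable (fun p : ℝ × Ω => θ p.1 p.2)
  measurePreserving : ∀ t, MeasurePreserving (θ t) P P
  zero : θ 0 = id
  add : ∀ t s, θ (t + s) = θ t ∘ θ s

/-- `φ` is a (measurable, continuous) random dynamical system on `X` over the metric dynamical
system `(Ω, 𝓕, P, θ)`. -/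
structure IsRandomDynamicalSystem {X : Type*} [TopologicalSpace X] [MeasurableSpace X]
    (P : Measure Ω) (θ : ℝ → Ω → Ω) (φ : ℝ≥0 → Ω → X → X) : Prop where
  base : IsMetricDynamicalSystem P θ
  measurable : Measurable (fun p : ℝ≥0 × Ω × X => φ p.1 p.2.1 p.2.2)
  zero : ∀ ω, φ 0 ω = id
  cocycle : ∀ (t τ : ℝ≥0) (ω : Ω) (x : X), φ (t + τ) ω x = φ t (θ τ ω) (φ τ ω x)
  continuous : ∀ (t : ℝ≥0) (ω : Ω), Continuous (φ t ω)

/-- `𝐖` is a (measurable) rough path cocycle over `θ`: `𝐖_{s,s+t}(ω) = 𝐖_{0,t}(θ_s ω)`. The space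
`V ⊗ V` carries its Borel `σ`-algebra. -/
structure IsRoughPathCocycle {α : ℝ≥0} {V : Type*} [NormedAddCommGroup V]
    [InnerProductSpace ℝ V] [MeasurableSpace V] (θ : ℝ → Ω → Ω) (W : Ω → RoughPath α V) :
    Prop where
  measurable_path : ∀ t : ℝ, Measurable (fun ω => (W ω).path t)
  measurable_area : ∀ s t : ℝ, Measurable[_, borel (V ⊗[ℝ] V)] (fun ω => (W ω).area s t)
  path_cocycle : ∀ (ω : Ω) (s t : ℝ), 0 ≤ t →
    (W ω).path (s + t) - (W ω).path s = (W (θ s ω)).path t - (W (θ s ω)).path 0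
  area_cocycle : ∀ (ω : Ω) (s t : ℝ), 0 ≤ t →
    (W ω).area s (s + t) = (W (θ s ω)).area 0 t

end RDS

end

/-! In finite dimensions the mild equation is equivalent to Davie's local expansion. With `B = A +
F`, a path `U` is a solution exactly when `U_t - U_s` equals `B(U_s)(t-s) + G(U_s)W_{s,t} +
DG(U_s)G(U_s)𝕎_{s,t}` up to `O(|t-s|^{3α})`. Everything rests on `3α > 1`: halving an interval
multiplies a third-order error, summed over the two halves, by `2^{1-3α} < 1`. Chen's relation and
Taylor's formula make the expansion additive up to third order, so sewing applies both to
approximations and to differences of solutions.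

Existence: the discrete scheme with dyadic steps obeys bounds independent of the step
(`discrete_sewing`, `davie_local_error`, `davieScheme_bound`), and these pass to limits. Uniqueness:
on short intervals the distance between two solutions with the same initial value, measured by the
supremum together with the third-order remainder, contracts (`davie_contraction`, `IsDavieOn.eq`).
Uniqueness then upgrades compactness to convergence: along every ultrafilter the scheme converges to
a Davie solution from `ξ`, and all these limits agree (`tendsto_davieApprox`). The same argument
gives continuity in `ξ`, and uniqueness for the shifted equation gives the flow property.

Equivalence: `S(h) = 1 + hA + O(h²)` makes the local mild error and the Davie error differ by
third-order terms (`norm_mildDefect_sub_le`). In one direction these errors sum to zero as the mesh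
vanishes (`isMildSolution_of_isDavieOn`); in the other, sewing bounds the rough convolution by its
germ (`IsMildSolution.isDavieOn`).

The random part is then formal. The cocycle relation for nonnegative durations extends to all times
by Chen's relation (`IsRoughPathCocycle.map_eq_shift`), and the solution is a pointwise limit of
measurable schemes. -/

noncomputable section

/-! ### Functions of class `C^m_b` -/

section Coefficients

variable {E : Type*} [NormedAddCommGroup E] [InnerProductSpace ℝ E]
variable {F F₁ F₂ : Type*} [NormedAddCommGroup F] [NormedSpace ℝ F]
  [NormedAddCommGroup F₁] [NormedSpace ℝ F₁] [NormedAddCommGroup F₂] [NormedSpace ℝ F₂]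

theorem IsCb.norm_le {m : ℕ} {f : E → F} (hf : IsCb m f) : ∃ C : ℝ, ∀ x, ‖f x‖ ≤ C := by
  obtain ⟨C, hC⟩ := hf.2 0 (Nat.zero_le _)
  exact ⟨C, fun x => by simpa using hC x⟩

theorem IsCb.of_le {m n : ℕ} {f : E → F} (hf : IsCb n f) (h : m ≤ n) : IsCb m f :=
  ⟨hf.1.of_le (by exact_mod_cast h), fun k hk => hf.2 k (hk.trans h)⟩

theorem IsCb.fderiv {m : ℕ} {f : E → F} (hf : IsCb (m + 1) f) : IsCb m (fderiv ℝ f) := by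
  refine ⟨hf.1.fderiv_right (by push_cast; exact le_rfl), fun k hk => ?_⟩
  obtain ⟨C, hC⟩ := hf.2 (k + 1) (by omega)
  exact ⟨C, fun x => by simpa [norm_iteratedFDeriv_fderiv] using hC x⟩

theorem IsCb.bilinear {m : ℕ} {f : E → F₁} {g : E → F₂} (β : F₁ →L[ℝ] F₂ →L[ℝ] F)
    (hf : IsCb m f) (hg : IsCb m g) : IsCb m (fun x => β (f x) (g x)) := by
  refine ⟨β.isBoundedBilinearMap.contDiff.comp₂ hf.1 hg.1, fun k hk => ?_⟩
  choose! a ha using hf.2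
  choose! b hb using hg.2
  refine ⟨‖β‖ * ∑ i ∈ Finset.range (k + 1), (k.choose i : ℝ) * a i * b (k - i), fun x => ?_⟩
  refine (β.norm_iteratedFDeriv_le_of_bilinear hf.1 hg.1 x (by exact_mod_cast hk)).trans ?_
  refine mul_le_mul_of_nonneg_left (Finset.sum_le_sum fun i hi => ?_) (norm_nonneg β)
  have hi' : i ≤ k := Nat.lt_succ_iff.mp (Finset.mem_range.mp hi)
  have h1 := ha i (hi'.trans hk) x
  have h2 := hb (k - i) ((Nat.sub_le _ _).trans hk) x
  have h3 : 0 ≤ a i := (norm_nonneg _).trans h1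
  gcongr

theorem IsCb.clm_apply {m : ℕ} {f : E → F₁} (T : F₁ →L[ℝ] F) (hf : IsCb m f) :
    IsCb m (fun x => T (f x)) := by
  refine ⟨T.contDiff.comp hf.1, fun k hk => ?_⟩
  obtain ⟨C, hC⟩ := hf.2 k hk
  refine ⟨‖T‖ * C, fun x => ?_⟩
  exact (T.norm_iteratedFDeriv_comp_left hf.1.contDiffAt (by exact_mod_cast hk)).trans
    (mul_le_mul_of_nonneg_left (hC x) (norm_nonneg _))

theorem IsCb.lipschitz {m : ℕ} {f : E → F} (hf : IsCb (m + 1) f) :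
    ∃ C : ℝ, ∀ x y, ‖f y - f x‖ ≤ C * ‖y - x‖ := by
  obtain ⟨C, hC⟩ := hf.fderiv.norm_le
  refine ⟨C, fun x y => ?_⟩
  exact convex_univ.norm_image_sub_le_of_norm_fderiv_le
    (fun z _ => (hf.1.differentiable (by simp)) z) (fun z _ => hC z) (mem_univ _) (mem_univ _)

theorem hasDerivAt_comp_segment {f : E → F} (hf : Differentiable ℝ f) (x v : E) (θ : ℝ) :
    HasDerivAt (fun θ : ℝ => f (x + θ • v)) (fderiv ℝ f (x + θ • v) v) θ := by
  have h1 : HasDerivAt (fun θ : ℝ => x + θ • v) v θ := by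
    simpa using ((hasDerivAt_id θ).smul_const v).const_add x
  exact (hf _).hasFDerivAt.comp_hasDerivAt θ h1

theorem norm_segment_sub_le (x y x' y' : E) {θ : ℝ} (hθ : θ ∈ Ico (0 : ℝ) 1) :
    ‖(x + θ • (y - x)) - (x' + θ • (y' - x'))‖ ≤ ‖x - x'‖ + ‖y - y'‖ := by
  have : (x + θ • (y - x)) - (x' + θ • (y' - x')) = (1 - θ) • (x - x') + θ • (y - y') := by
    module
  rw [this]
  refine (norm_add_le _ _).trans ?_
  rw [norm_smul, norm_smul, Real.norm_of_nonneg hθ.1, Real.norm_of_nonneg (by linarith [hθ.2])]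
  have h1 := norm_nonneg (x - x')
  have h2 := norm_nonneg (y - y')
  nlinarith [hθ.1, hθ.2]

/-- The four-point estimate for functions with bounded and Lipschitz derivative. -/
theorem norm_four_point_le {f : E → F} (hf : Differentiable ℝ f) {K : ℝ}
    (h1 : ∀ x, ‖fderiv ℝ f x‖ ≤ K) (h2 : ∀ x y, ‖fderiv ℝ f y - fderiv ℝ f x‖ ≤ K * ‖y - x‖)
    (x y x' y' : E) :
    ‖(f y - f x) - (f y' - f x')‖
      ≤ K * (‖(y - x) - (y' - x')‖ + (‖x - x'‖ + ‖y - y'‖) * ‖y' - x'‖) := by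
  have hK : 0 ≤ K := (norm_nonneg _).trans (h1 x)
  -- Both segments are traversed with the same parameter `θ`, so the mean value inequality applies
  -- to the difference of `f` along them.
  have key := norm_image_sub_le_of_norm_deriv_le_segment_01'
    (f := fun θ : ℝ => f (x + θ • (y - x)) - f (x' + θ • (y' - x')))
    (C := K * (‖(y - x) - (y' - x')‖ + (‖x - x'‖ + ‖y - y'‖) * ‖y' - x'‖))
    (fun θ _ => ((hasDerivAt_comp_segment hf x (y - x) θ).sub
      (hasDerivAt_comp_segment hf x' (y' - x') θ)).hasDerivWithinAt) ?_
  · simp only [one_smul, zero_smul, add_zero, add_sub_cancel] at key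
    rwa [show (f y - f x) - (f y' - f x') = (f y - f y') - (f x - f x') by abel]
  · intro θ hθ
    set p := x + θ • (y - x) with hp
    set p' := x' + θ • (y' - x') with hp'
    have hpp : ‖p - p'‖ ≤ ‖x - x'‖ + ‖y - y'‖ := norm_segment_sub_le x y x' y' hθ
    have : fderiv ℝ f p (y - x) - fderiv ℝ f p' (y' - x')
        = fderiv ℝ f p ((y - x) - (y' - x')) + (fderiv ℝ f p - fderiv ℝ f p') (y' - x') := by
      simp only [map_sub, sub_apply]; abel
    rw [this]
    calc _ ≤ K * ‖(y - x) - (y' - x')‖ + (K * (‖x - x'‖ + ‖y - y'‖)) * ‖y' - x'‖ := by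
          refine norm_add_le_of_le ((ContinuousLinearMap.le_opNorm _ _).trans ?_)
            ((ContinuousLinearMap.le_opNorm _ _).trans ?_)
          · gcongr; exact h1 p
          · gcongr; exact (h2 p' p).trans (by gcongr)
      _ = _ := by ring

/-- The first order Taylor remainder of `G` at `x`. -/
def taylorRemainder (G : E → F) (x y : E) : F := G y - G x - fderiv ℝ G x (y - x)

/-- Along the segments the `θ`-derivative of a Taylor remainder is an increment of `Df` applied to
`y - x`, so the four-point estimate for `Df` suffices. This is where a third derivative of `f`
enters. The factor 2 absorbs `‖p - p'‖ ≤ ‖x - x'‖ + ‖y - y'‖`. -/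
theorem norm_taylorRemainder_sub_le {f : E → F} (hf : Differentiable ℝ f) {K : ℝ} (hK : 0 ≤ K)
    (h2 : ∀ x y, ‖fderiv ℝ f y - fderiv ℝ f x‖ ≤ K * ‖y - x‖)
    (h3 : ∀ x y x' y', ‖(fderiv ℝ f y - fderiv ℝ f x) - (fderiv ℝ f y' - fderiv ℝ f x')‖
      ≤ K * (‖(y - x) - (y' - x')‖ + (‖x - x'‖ + ‖y - y'‖) * ‖y' - x'‖))
    (x y x' y' : E) :
    ‖taylorRemainder f x y - taylorRemainder f x' y'‖
      ≤ K * (‖(y - x) - (y' - x')‖ + 2 * (‖x - x'‖ + ‖y - y'‖) * ‖y' - x'‖) * ‖y - x‖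
        + K * ‖y' - x'‖ * ‖(y - x) - (y' - x')‖ := by
  set R := K * (‖(y - x) - (y' - x')‖ + 2 * (‖x - x'‖ + ‖y - y'‖) * ‖y' - x'‖) * ‖y - x‖
        + K * ‖y' - x'‖ * ‖(y - x) - (y' - x')‖ with hR
  have hlin (a v : E) (θ : ℝ) :
      HasDerivAt (fun θ : ℝ => θ • fderiv ℝ f a v) (fderiv ℝ f a v) θ := by
    simpa using (hasDerivAt_id θ).smul_const (fderiv ℝ f a v)
  have key := norm_image_sub_le_of_norm_deriv_le_segment_01'
    (f := fun θ : ℝ => (f (x + θ • (y - x)) - θ • fderiv ℝ f x (y - x))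
      - (f (x' + θ • (y' - x')) - θ • fderiv ℝ f x' (y' - x')))
    (C := R)
    (fun θ _ => (((hasDerivAt_comp_segment hf x (y - x) θ).sub (hlin x (y - x) θ)).sub
      ((hasDerivAt_comp_segment hf x' (y' - x') θ).sub (hlin x' (y' - x') θ))).hasDerivWithinAt) ?_
  · simp only [one_smul, zero_smul, add_zero, add_sub_cancel, sub_zero] at key
    rw [taylorRemainder, taylorRemainder]
    convert key using 2
    abel
  · intro θ hθ
    set p := x + θ • (y - x) with hp
    set p' := x' + θ • (y' - x') with hp'
    have hpp : ‖p - p'‖ ≤ ‖x - x'‖ + ‖y - y'‖ := norm_segment_sub_le x y x' y' hθ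
    have e1 : p - x = θ • (y - x) := by simp [hp]
    have e2 : p' - x' = θ • (y' - x') := by simp [hp']
    have hθn (v : E) : ‖θ • v‖ ≤ ‖v‖ := by
      rw [norm_smul, Real.norm_of_nonneg hθ.1]
      exact mul_le_of_le_one_left (norm_nonneg _) hθ.2.le
    have h4 : ‖(fderiv ℝ f p - fderiv ℝ f x) - (fderiv ℝ f p' - fderiv ℝ f x')‖
        ≤ K * (‖(y - x) - (y' - x')‖ + 2 * (‖x - x'‖ + ‖y - y'‖) * ‖y' - x'‖) := by
      refine (h3 x p x' p').trans ?_
      rw [e1, e2, ← smul_sub]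
      gcongr
      · exact hθn _
      · linarith [norm_nonneg (y - y')]
      · exact hθn _
    have h5 : ‖fderiv ℝ f p' - fderiv ℝ f x'‖ ≤ K * ‖y' - x'‖ := by
      refine (h2 x' p').trans ?_
      rw [e2]; gcongr; exact hθn _
    have : fderiv ℝ f p (y - x) - fderiv ℝ f x (y - x)
          - (fderiv ℝ f p' (y' - x') - fderiv ℝ f x' (y' - x'))
        = ((fderiv ℝ f p - fderiv ℝ f x) - (fderiv ℝ f p' - fderiv ℝ f x')) (y - x)
          + (fderiv ℝ f p' - fderiv ℝ f x') ((y - x) - (y' - x')) := by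
      simp only [map_sub, sub_apply]; abel
    rw [this]
    refine norm_add_le_of_le ((ContinuousLinearMap.le_opNorm _ _).trans ?_)
      ((ContinuousLinearMap.le_opNorm _ _).trans ?_)
    · gcongr
    · gcongr

theorem IsCb.four_point {f : E → F} (hf : IsCb 2 f) : ∃ K : ℝ, 0 ≤ K ∧ ∀ x y x' y' : E,
    ‖(f y - f x) - (f y' - f x')‖
      ≤ K * (‖(y - x) - (y' - x')‖ + (‖x - x'‖ + ‖y - y'‖) * ‖y' - x'‖) := by
  obtain ⟨C₁, h1⟩ := IsCb.fderiv (m := 1) hf |>.norm_le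
  obtain ⟨C₂, h2⟩ := IsCb.lipschitz (m := 0) (IsCb.fderiv (m := 1) hf)
  refine ⟨max C₁ C₂, ((norm_nonneg _).trans (h1 0)).trans (le_max_left _ _), ?_⟩
  exact norm_four_point_le (hf.1.differentiable (by simp)) (fun x => (h1 x).trans (le_max_left _ _))
    fun x y => (h2 x y).trans (mul_le_mul_of_nonneg_right (le_max_right _ _) (norm_nonneg _))

theorem IsCb.taylorRemainder_four_point {f : E → F} (hf : IsCb 3 f) : ∃ K : ℝ, 0 ≤ K ∧
    ∀ x y x' y' : E, ‖taylorRemainder f x y - taylorRemainder f x' y'‖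
      ≤ K * (‖(y - x) - (y' - x')‖ + 2 * (‖x - x'‖ + ‖y - y'‖) * ‖y' - x'‖) * ‖y - x‖
        + K * ‖y' - x'‖ * ‖(y - x) - (y' - x')‖ := by
  have hd : IsCb 2 (_root_.fderiv ℝ f) := IsCb.fderiv (m := 2) hf
  obtain ⟨C₁, hC₁, h1⟩ := hd.four_point
  obtain ⟨C₂, h2⟩ := IsCb.lipschitz (m := 1) hd
  refine ⟨max C₁ C₂, hC₁.trans (le_max_left _ _), ?_⟩
  refine norm_taylorRemainder_sub_le (hf.1.differentiable (by simp))
    (hC₁.trans (le_max_left _ _))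
    (fun x y => (h2 x y).trans (mul_le_mul_of_nonneg_right (le_max_right _ _) (norm_nonneg _)))
    fun x y x' y' => (h1 x y x' y').trans (mul_le_mul_of_nonneg_right (le_max_left _ _) ?_)
  positivity

end Coefficients

/-! ### Bounds for the coefficients of the equation -/

section Bounds

variable {α : ℝ≥0} {V : Type*} [NormedAddCommGroup V] [InnerProductSpace ℝ V]
  [FiniteDimensional ℝ V]
variable {E : Type*} [NormedAddCommGroup E] [InnerProductSpace ℝ E]

/-- The coefficient `DG(x) G(x)` of the second order process. -/
def areaCoeff (G : E → V →L[ℝ] E) (x : E) : V ⊗[ℝ] V →L[ℝ] E :=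
  LinearMap.toContinuousLinearMap (tensorApply ((fderiv ℝ G x).comp (G x)))

theorem areaCoeff_apply (G : E → V →L[ℝ] E) (x : E) (τ : V ⊗[ℝ] V) :
    areaCoeff G x τ = tensorApply ((fderiv ℝ G x).comp (G x)) τ := rfl

theorem areaCoeff_tmul (G : E → V →L[ℝ] E) (x : E) (v w : V) :
    areaCoeff G x (v ⊗ₜ[ℝ] w) = fderiv ℝ G x (G x v) w := by
  simp [areaCoeff_apply, tensorApply_tmul]

/-- `K` bounds the drift `B`, the vector fields `G`, and the regularity of `DG G` and of the Taylor
remainder of `G`. -/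
structure CoeffBounds (B : E → E) (G : E → V →L[ℝ] E) (K : ℝ) : Prop where
  one_le : 1 ≤ K
  drift : ∀ x, ‖B x‖ ≤ K * (1 + ‖x‖)
  drift_sub : ∀ x y, ‖B y - B x‖ ≤ K * ‖y - x‖
  norm : ∀ x, ‖G x‖ ≤ K
  norm_sub : ∀ x y, ‖G y - G x‖ ≤ K * ‖y - x‖
  deriv : ∀ x, ‖fderiv ℝ G x‖ ≤ K
  deriv_sub : ∀ x y, ‖fderiv ℝ G y - fderiv ℝ G x‖ ≤ K * ‖y - x‖
  area : ∀ x, ‖areaCoeff G x‖ ≤ K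
  area_sub : ∀ x y, ‖areaCoeff G y - areaCoeff G x‖ ≤ K * ‖y - x‖
  area_four_point : ∀ x y x' y', ‖(areaCoeff G y - areaCoeff G x)
      - (areaCoeff G y' - areaCoeff G x')‖
      ≤ K * (‖(y - x) - (y' - x')‖ + (‖x - x'‖ + ‖y - y'‖) * ‖y' - x'‖)
  taylor_four_point : ∀ x y x' y' : E, ‖taylorRemainder G x y - taylorRemainder G x' y'‖
      ≤ K * (‖(y - x) - (y' - x')‖ + 2 * (‖x - x'‖ + ‖y - y'‖) * ‖y' - x'‖) * ‖y - x‖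
        + K * ‖y' - x'‖ * ‖(y - x) - (y' - x')‖

theorem CoeffBounds.mono {B : E → E} {G : E → V →L[ℝ] E} {K K' : ℝ} (h : CoeffBounds B G K)
    (hK : K ≤ K') : CoeffBounds B G K' where
  one_le := h.one_le.trans hK
  drift x := (h.drift x).trans (by gcongr)
  drift_sub x y := (h.drift_sub x y).trans (by gcongr)
  norm x := (h.norm x).trans hK
  norm_sub x y := (h.norm_sub x y).trans (by gcongr)
  deriv x := (h.deriv x).trans hK
  deriv_sub x y := (h.deriv_sub x y).trans (by gcongr)
  area x := (h.area x).trans hK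
  area_sub x y := (h.area_sub x y).trans (by gcongr)
  area_four_point x y x' y' := (h.area_four_point x y x' y').trans (by gcongr)
  taylor_four_point x y x' y' := (h.taylor_four_point x y x' y').trans (by gcongr)

theorem CoeffBounds.taylor {B : E → E} {G : E → V →L[ℝ] E} {K : ℝ} (h : CoeffBounds B G K)
    (x y : E) : ‖taylorRemainder G x y‖ ≤ K * ‖y - x‖ ^ 2 := by
  -- With `x' = y' = x` the second remainder vanishes and only the quadratic term survives.
  have := h.taylor_four_point x y x x
  simp only [taylorRemainder, sub_self, map_zero, sub_zero, norm_zero, mul_zero, add_zero,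
    zero_mul] at this
  rw [taylorRemainder, pow_two, ← mul_assoc]
  exact this

/-- The coefficient is a fixed linear map, continuous by finite dimensionality, applied to the
bilinear composition of `DG` and `G`; one derivative is spent on `DG`. -/
theorem IsCb.areaCoeff [FiniteDimensional ℝ E] {m : ℕ} {G : E → V →L[ℝ] E}
    (hG : IsCb (m + 1) G) : IsCb m (areaCoeff G) := by
  let T₀ : (V →L[ℝ] V →L[ℝ] E) →ₗ[ℝ] (V ⊗[ℝ] V →L[ℝ] E) :=
    { toFun := fun B => LinearMap.toContinuousLinearMap (tensorApply B)
      map_add' := fun B B' => by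
        ext τ
        induction τ using TensorProduct.induction_on with
        | zero => simp
        | tmul v w => simp [tensorApply_tmul]
        | add x y hx hy => simp only [map_add, hx, hy]
      map_smul' := fun c B => by
        ext τ
        induction τ using TensorProduct.induction_on with
        | zero => simp
        | tmul v w => simp [tensorApply_tmul]
        | add x y hx hy => simp only [map_add, hx, hy] }
  have hT₀ : Continuous T₀ := T₀.continuous_of_finiteDimensional
  let T : (V →L[ℝ] V →L[ℝ] E) →L[ℝ] (V ⊗[ℝ] V →L[ℝ] E) := ⟨T₀, hT₀⟩
  exact IsCb.clm_apply (F := V ⊗[ℝ] V →L[ℝ] E) (F₁ := V →L[ℝ] V →L[ℝ] E) T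
    (IsCb.bilinear (F₁ := E →L[ℝ] V →L[ℝ] E) (F₂ := V →L[ℝ] E) (F := V →L[ℝ] V →L[ℝ] E)
      (ContinuousLinearMap.compL ℝ V E (V →L[ℝ] E)) hG.fderiv
      (hG.of_le (Nat.le_succ m)))

theorem exists_coeffBounds [FiniteDimensional ℝ E] {B : E → E} {G : E → V →L[ℝ] E} {L : ℝ≥0}
    (hB : LipschitzWith L B) (hG : IsCb 3 G) : ∃ K, CoeffBounds B G K := by
  have hH : IsCb 2 (areaCoeff G) := IsCb.areaCoeff (m := 2) hG
  obtain ⟨c₁, h1⟩ := hG.norm_le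
  obtain ⟨c₂, h2⟩ := IsCb.lipschitz (m := 2) hG
  obtain ⟨c₃, h3⟩ := (IsCb.fderiv (m := 2) hG).norm_le
  obtain ⟨c₄, h4⟩ := IsCb.lipschitz (m := 1) (IsCb.fderiv (m := 2) hG)
  obtain ⟨c₅, h5⟩ := hH.norm_le
  obtain ⟨c₆, h6⟩ := IsCb.lipschitz (m := 1) hH
  obtain ⟨c₇, -, h7⟩ := hH.four_point
  obtain ⟨c₈, -, h8⟩ := hG.taylorRemainder_four_point
  obtain ⟨K, hK⟩ : ∃ K : ℝ, ∀ c ∈ ({1, ‖B 0‖, (L : ℝ), c₁, c₂, c₃, c₄, c₅, c₆, c₇, c₈} : Set ℝ),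
      c ≤ K := (Set.toFinite _).bddAbove
  simp only [mem_insert_iff, mem_singleton_iff, forall_eq_or_imp, forall_eq] at hK
  obtain ⟨k, kB, kL, k1, k2, k3, k4, k5, k6, k7, k8⟩ := hK
  have hBL (x y : E) : ‖B y - B x‖ ≤ K * ‖y - x‖ := by
    have := hB.dist_le_mul y x
    rw [dist_eq_norm, dist_eq_norm] at this
    exact this.trans (by gcongr)
  refine ⟨K, k, fun x => ?_, hBL, fun x => (h1 x).trans k1, fun x y => (h2 x y).trans (by gcongr),
    fun x => (h3 x).trans k3, fun x y => (h4 x y).trans (by gcongr), fun x => (h5 x).trans k5,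
    fun x y => (h6 x y).trans (by gcongr), fun x y x' y' => (h7 x y x' y').trans (by gcongr),
    fun x y x' y' => (h8 x y x' y').trans (by gcongr)⟩
  have := hBL 0 x
  rw [sub_zero] at this
  calc ‖B x‖ ≤ ‖B 0‖ + ‖B x - B 0‖ := norm_le_norm_add_norm_sub' _ _
    _ ≤ K * (1 + ‖x‖) := by linarith

end Bounds

/-! ### Powers of the length of a time interval -/

section Powers

/-- Writing `e = h^α`, a factor of time counts as `e²`. All later estimates are sorted by powers of
`e`, with drift terms treated as second order. -/
theorem le_rpow_sq {α h : ℝ} (hα : α ≤ 1 / 2) (h0 : 0 ≤ h) (h1 : h ≤ 1) : h ≤ (h ^ α) ^ 2 := by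
  rw [← Real.rpow_natCast, ← Real.rpow_mul h0]
  rcases h0.eq_or_lt with rfl | hpos
  · exact Real.rpow_nonneg le_rfl _
  · calc h = h ^ (1 : ℝ) := (Real.rpow_one h).symm
      _ ≤ _ := Real.rpow_le_rpow_of_exponent_ge hpos h1 (by push_cast; linarith)

/-- The contraction factor `2^{1 - 3α}` of the sewing argument. -/
def sewingFactor (α : ℝ) : ℝ := 2 * ((1 / 2 : ℝ) ^ α) ^ 3

theorem sewingFactor_pos (α : ℝ) : 0 < sewingFactor α := by
  unfold sewingFactor; positivity

theorem sewingFactor_lt_one {α : ℝ} (hα : 1 / 3 < α) : sewingFactor α < 1 := by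
  have : ((1 / 2 : ℝ) ^ α) ^ 3 < 1 / 2 := by
    rw [← Real.rpow_natCast, ← Real.rpow_mul (by norm_num)]
    calc (1 / 2 : ℝ) ^ (α * (3 : ℕ)) < (1 / 2 : ℝ) ^ (1 : ℝ) :=
          Real.rpow_lt_rpow_of_exponent_gt (by norm_num) (by norm_num) (by push_cast; linarith)
      _ = 1 / 2 := Real.rpow_one _
  unfold sewingFactor; linarith

/-- The control `h ↦ h^{3α}` gains the sewing factor when an interval is replaced by two pieces of
at most half its length. -/
theorem two_mul_rpow_cube_le {α x y : ℝ} (hα : 0 ≤ α) (hx : 0 ≤ x) (hxy : 2 * x ≤ y) :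
    2 * (x ^ α) ^ 3 ≤ sewingFactor α * (y ^ α) ^ 3 := by
  have h1 : x ^ α ≤ (1 / 2 : ℝ) ^ α * y ^ α := by
    rw [← Real.mul_rpow (by norm_num) (by linarith)]
    exact Real.rpow_le_rpow hx (by linarith) hα
  calc 2 * (x ^ α) ^ 3 ≤ 2 * ((1 / 2 : ℝ) ^ α * y ^ α) ^ 3 := by
        gcongr
    _ = _ := by unfold sewingFactor; ring

theorem exists_pow_half_rpow_le {α : ℝ} (hα : 0 < α) {M : ℝ} (hM : 0 < M) :
    ∃ m : ℕ, M * ((1 / 2 : ℝ) ^ m) ^ α ≤ 1 := by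
  obtain ⟨m, hm⟩ := exists_pow_lt_of_lt_one (inv_pos.mpr hM)
    (Real.rpow_lt_one (x := 1 / 2) (by norm_num) (by norm_num) hα)
  refine ⟨m, ?_⟩
  rw [← Real.rpow_natCast, ← Real.rpow_mul (by norm_num), mul_comm (m : ℝ), Real.rpow_mul
    (by norm_num), Real.rpow_natCast]
  calc M * ((1 / 2 : ℝ) ^ α) ^ m ≤ M * M⁻¹ := by gcongr
    _ = 1 := mul_inv_cancel₀ hM.ne'

/-- A discrete sewing lemma: a two-parameter sequence that vanishes on neighbours and is almost
subadditive is bounded by the control of its defect. -/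
theorem discrete_sewing {a : ℕ → ℕ → ℝ} {ω : ℕ → ℝ} {r C M : ℝ} {L : ℕ} (hC : 0 ≤ C) (hM : 0 ≤ M)
    (hω0 : ∀ n, 0 ≤ ω n) (hω : Monotone ω) (hr : ∀ m n, 2 * m ≤ n → 2 * ω m ≤ r * ω n)
    (hMr : r * M + 2 * C ≤ M) (h0 : ∀ k, a k k ≤ 0) (h1 : ∀ k, k < L → a k (k + 1) ≤ 0)
    (hstep : ∀ k m l, k ≤ m → m ≤ l → l ≤ L → a k m ≤ M * ω (m - k) →
      a k l ≤ a k m + a m l + C * ω (l - k)) :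
    ∀ k l, k ≤ l → l ≤ L → a k l ≤ M * ω (l - k) := by
  suffices ∀ n k, k + n ≤ L → a k (k + n) ≤ M * ω n by
    intro k l hkl hl
    have := this (l - k) k (by omega)
    rwa [Nat.add_sub_cancel' hkl] at this
  intro n
  induction n using Nat.strong_induction_on with
  | _ n ih =>
    intro k hk
    rcases Nat.lt_or_ge n 2 with hn | hn
    · have : a k (k + n) ≤ 0 := by
        interval_cases n
        · exact h0 k
        · exact h1 k (by omega)
      exact this.trans (mul_nonneg hM (hω0 n))
    · have hkm := ih (n / 2) (by omega) k (by omega)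
      have hml := ih (n - n / 2 - 1) (by omega) (k + n / 2 + 1) (by omega)
      have e : k + n / 2 + 1 + (n - n / 2 - 1) = k + n := by omega
      rw [e] at hml
      have hm1 := h1 (k + n / 2) (by omega)
      have s1 := hstep k (k + n / 2) (k + n) (by omega) (by omega) hk
        (by rwa [Nat.add_sub_cancel_left])
      have s2 := hstep (k + n / 2) (k + n / 2 + 1) (k + n) (by omega) (by omega) hk
        (hm1.trans (mul_nonneg hM (hω0 _)))
      rw [Nat.add_sub_cancel_left] at s1
      have m2 : C * ω (k + n - (k + n / 2)) ≤ C * ω n :=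
        mul_le_mul_of_nonneg_left (hω (by omega)) hC
      have r1 := hr (n / 2) n (by omega)
      have r2 := hr (n - n / 2 - 1) n (by omega)
      have r3 : M * ω (n / 2) + M * ω (n - n / 2 - 1) ≤ r * M * ω n := by nlinarith
      have r4 : (r * M + 2 * C) * ω n ≤ M * ω n := mul_le_mul_of_nonneg_right hMr (hω0 n)
      linarith

end Powers

/-! ### Rough path estimates and the algebra of the Davie increments. -/

section Increments

open Filter Topology

variable {α : ℝ≥0} {V : Type*} [NormedAddCommGroup V] [InnerProductSpace ℝ V]
variable {E : Type*} [NormedAddCommGroup E] [InnerProductSpace ℝ E]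

/-! ### Bounds for rough paths -/

/-- `K` bounds the Hölder norms of the rough path `X` on `[0, T]`. -/
structure PathBounds (X : RoughPath α V) (T K : ℝ) : Prop where
  path : ∀ s t, 0 ≤ s → s ≤ t → t ≤ T → ‖X.path t - X.path s‖ ≤ K * (t - s) ^ (α : ℝ)
  area : ∀ s t, 0 ≤ s → s ≤ t → t ≤ T → ‖X.area s t‖ ≤ K * ((t - s) ^ (α : ℝ)) ^ 2

theorem PathBounds.mono {X : RoughPath α V} {T K K' : ℝ} (h : PathBounds X T K) (hK : K ≤ K') :
    PathBounds X T K' where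
  path s t h0 hst hT := (h.path s t h0 hst hT).trans
    (mul_le_mul_of_nonneg_right hK (Real.rpow_nonneg (by linarith) _))
  area s t h0 hst hT := (h.area s t h0 hst hT).trans (by gcongr)

theorem exists_pathBounds (X : RoughPath α V) (T : ℝ) : ∃ K, PathBounds X T K := by
  obtain ⟨C₁, h1⟩ := X.holder_path 0 T
  obtain ⟨C₂, h2⟩ := X.holder_area 0 T
  refine ⟨max C₁ C₂, fun s t h0 hst hT => ?_, fun s t h0 hst hT => ?_⟩
  · have h := h1.dist_le (x := t) (y := s) ⟨by linarith, hT⟩ ⟨h0, by linarith⟩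
    rw [dist_eq_norm, Real.dist_eq, abs_of_nonneg (by linarith)] at h
    exact h.trans (mul_le_mul_of_nonneg_right (le_max_left _ _)
      (Real.rpow_nonneg (by linarith) _))
  · have h := h2 s ⟨h0, by linarith⟩ t ⟨by linarith, hT⟩
    rw [abs_of_nonneg (by linarith), mul_comm 2, Real.rpow_mul (by linarith), Real.rpow_two] at h
    exact h.trans (mul_le_mul_of_nonneg_right (le_max_right _ _) (by positivity))

theorem RoughPath.area_self (X : RoughPath α V) (s : ℝ) : X.area s s = 0 := by
  simpa using X.chen s s s

theorem RoughPath.continuous_path (hα : 0 < α) (X : RoughPath α V) : Continuous X.path := by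
  refine continuous_iff_continuousAt.mpr fun t => ?_
  obtain ⟨C, hC⟩ := X.holder_path (t - 1) (t + 1)
  exact (hC.continuousOn hα).continuousAt (Icc_mem_nhds (by linarith) (by linarith))

/-- Chen's relation at the intermediate times `s` and `t` writes the area at a nearby pair as the
area at `(s, t)`, plus two near-diagonal areas, plus tensor products with a small path increment as
a factor. The former vanish by the Hölder bound, the latter by continuity of the path. -/
theorem RoughPath.continuous_area (hα : 0 < α) (X : RoughPath α V) :
    Continuous (fun p : ℝ × ℝ => X.area p.1 p.2) := by
  have hα' : (0 : ℝ) < α := hα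
  have hpath := X.continuous_path hα
  have hdiag (s : ℝ) {l : Filter (ℝ × ℝ)} {f g : ℝ × ℝ → ℝ} (hf : Tendsto f l (𝓝 s))
      (hg : Tendsto g l (𝓝 s)) : Tendsto (fun p => X.area (f p) (g p)) l (𝓝 0) := by
    obtain ⟨C, hC⟩ := X.holder_area (s - 1) (s + 1)
    have hmem : Icc (s - 1) (s + 1) ∈ 𝓝 s := Icc_mem_nhds (by linarith) (by linarith)
    refine squeeze_zero_norm' (a := fun p => C * |g p - f p| ^ (2 * (α : ℝ))) ?_ ?_
    · filter_upwards [hf hmem, hg hmem] with p h1 h2 using hC _ h1 _ h2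
    · have h1 := ((hg.sub hf).abs.rpow_const (p := 2 * (α : ℝ))
        (Or.inr (by positivity))).const_mul C
      simpa [Real.zero_rpow (show 2 * (α : ℝ) ≠ 0 by positivity)] using h1
  refine continuous_iff_continuousAt.mpr fun ⟨s, t⟩ => ?_
  have h1 : Tendsto (fun p : ℝ × ℝ => p.1) (𝓝 (s, t)) (𝓝 s) := continuous_fst.tendsto _
  have h2 : Tendsto (fun p : ℝ × ℝ => p.2) (𝓝 (s, t)) (𝓝 t) := continuous_snd.tendsto _
  have hW1 : Tendsto (fun p : ℝ × ℝ => X.path s - X.path p.1) (𝓝 (s, t)) (𝓝 0) := by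
    simpa using ((hpath.tendsto s).comp h1).const_sub (X.path s)
  have hW2 : Tendsto (fun p : ℝ × ℝ => X.path p.2 - X.path t) (𝓝 (s, t)) (𝓝 0) := by
    simpa using ((hpath.tendsto t).comp h2).sub_const (X.path t)
  have hW3 : Tendsto (fun p : ℝ × ℝ => X.path t - X.path p.1) (𝓝 (s, t))
      (𝓝 (X.path t - X.path s)) := ((hpath.tendsto s).comp h1).const_sub (X.path t)
  have hA : Tendsto (fun p : ℝ × ℝ => (X.path s - X.path p.1) ⊗ₜ[ℝ] (X.path t - X.path s))
      (𝓝 (s, t)) (𝓝 0) := by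
    rw [tendsto_zero_iff_norm_tendsto_zero]
    simpa using hW1.norm.mul_const ‖X.path t - X.path s‖
  have hB : Tendsto (fun p : ℝ × ℝ => (X.path t - X.path p.1) ⊗ₜ[ℝ] (X.path p.2 - X.path t))
      (𝓝 (s, t)) (𝓝 0) := by
    rw [tendsto_zero_iff_norm_tendsto_zero]
    simpa using hW3.norm.mul hW2.norm
  have hsum := ((((hdiag s h1 tendsto_const_nhds).add_const (X.area s t)).add hA).add
    (hdiag t tendsto_const_nhds h2)).add hB
  simp only [zero_add, add_zero] at hsum
  refine hsum.congr fun p => ?_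
  have e1 := X.chen p.1 s t
  have e2 := X.chen p.1 t p.2
  rw [← e1, ← e2]; abel

/-- `K` bounds the local Hölder norm of `U` and that of the remainder
`U_t - U_s - G(U_s) W_{s,t}` on `[a, b]`. -/
structure HolderBounds (G : E → V →L[ℝ] E) (X : RoughPath α V) (a b δ K : ℝ) (U : ℝ → E) :
    Prop where
  holder : ∀ s t, a ≤ s → s ≤ t → t ≤ b → t - s ≤ δ → ‖U t - U s‖ ≤ K * (t - s) ^ (α : ℝ)
  remainder : ∀ s t, a ≤ s → s ≤ t → t ≤ b → t - s ≤ δ →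
    ‖U t - U s - G (U s) (X.path t - X.path s)‖ ≤ K * ((t - s) ^ (α : ℝ)) ^ 2

theorem HolderBounds.mono {G : E → V →L[ℝ] E} {X : RoughPath α V} {a b δ K a' b' δ' K' : ℝ} {U : ℝ → E}
    (h : HolderBounds G X a b δ K U) (ha : a ≤ a') (hb : b' ≤ b) (hδ : b' - a' ≤ δ) (hK : K ≤ K') :
    HolderBounds G X a' b' δ' K' U where
  holder s t hs hst ht _ := (h.holder s t (by linarith) hst (by linarith) (by linarith)).trans
    (mul_le_mul_of_nonneg_right hK (Real.rpow_nonneg (by linarith) _))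
  remainder s t hs hst ht _ :=
    (h.remainder s t (by linarith) hst (by linarith) (by linarith)).trans (by gcongr)

/-! ### The increments of the Davie scheme -/

variable [FiniteDimensional ℝ V]

/-- The increment `B(x)(t - s) + G(x) W_{s,t} + DG(x)G(x) 𝕎_{s,t}` of the Davie scheme. -/
def davieIncrement (B : E → E) (G : E → V →L[ℝ] E) (X : RoughPath α V) (s t : ℝ) (x : E) : E :=
  (t - s) • B x + G x (X.path t - X.path s) + areaCoeff G x (X.area s t)

theorem davieIncrement_self (B : E → E) (G : E → V →L[ℝ] E) (X : RoughPath α V) (s : ℝ) (x : E) :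
    davieIncrement B G X s s x = 0 := by
  simp [davieIncrement, X.area_self]

theorem areaCoeff_chen (G : E → V →L[ℝ] E) (X : RoughPath α V) (s u t : ℝ) (x : E) :
    areaCoeff G x (X.area s t) = areaCoeff G x (X.area s u) + areaCoeff G x (X.area u t)
      + fderiv ℝ G x (G x (X.path u - X.path s)) (X.path t - X.path u) := by
  rw [← areaCoeff_tmul, ← X.chen s u t, map_sub, map_sub]; abel

/-- The cross term of Chen's relation supplies exactly the first-order term `DG(x)G(x)W_{s,u}` in
the expansion of `G(y)`. This cancellation is why the second-order process is included: the defect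
becomes of order `3α`. -/
theorem davieIncrement_add (B : E → E) (G : E → V →L[ℝ] E) (X : RoughPath α V) (s u t : ℝ)
    (x y : E) :
    davieIncrement B G X s u x + davieIncrement B G X u t y - davieIncrement B G X s t x
      = (t - u) • (B y - B x)
        + (G y - G x - fderiv ℝ G x (G x (X.path u - X.path s))) (X.path t - X.path u)
        + (areaCoeff G y - areaCoeff G x) (X.area u t) := by
  rw [davieIncrement, davieIncrement, davieIncrement, areaCoeff_chen G X s u t x]
  simp only [map_sub, sub_apply]
  module

variable {B : E → E} {G : E → V →L[ℝ] E} {X : RoughPath α V} {T K : ℝ}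

theorem norm_davieIncrement_le (hα : (α : ℝ) ≤ 1 / 2) (hc : CoeffBounds B G K)
    (hX : PathBounds X T K) {s t : ℝ} (hs : 0 ≤ s) (hst : s ≤ t) (ht : t ≤ T) (h1 : t - s ≤ 1)
    (x : E) : ‖davieIncrement B G X s t x‖ ≤ 3 * K ^ 2 * (1 + ‖x‖) * (t - s) ^ (α : ℝ) := by
  have hK := hc.one_le
  have he0 : 0 ≤ (t - s) ^ (α : ℝ) := Real.rpow_nonneg (by linarith) _
  have he1 : (t - s) ^ (α : ℝ) ≤ 1 := Real.rpow_le_one (by linarith) h1 α.2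
  have he2 := le_rpow_sq hα (by linarith) h1
  have hP := hX.path s t hs hst ht
  have hA := hX.area s t hs hst ht
  set e := (t - s) ^ (α : ℝ)
  have he3 : e ^ 2 ≤ e := by nlinarith
  have hN : 1 ≤ 1 + ‖x‖ := by linarith [norm_nonneg x]
  have hKK : K ≤ K ^ 2 := by nlinarith
  calc ‖davieIncrement B G X s t x‖
      ≤ ‖(t - s) • B x‖ + ‖G x (X.path t - X.path s)‖ + ‖areaCoeff G x (X.area s t)‖ :=
        norm_add₃_le
    _ ≤ e * (K ^ 2 * (1 + ‖x‖)) + K * (K * e) + K * (K * e) := by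
        refine add_le_add_three ?_ ?_ ?_
        · rw [norm_smul, Real.norm_of_nonneg (by linarith)]
          exact mul_le_mul (he2.trans he3) ((hc.drift x).trans (by gcongr)) (norm_nonneg _) he0
        · exact (ContinuousLinearMap.le_opNorm _ _).trans (by gcongr; exact hc.norm x)
        · refine (ContinuousLinearMap.le_opNorm _ _).trans ?_
          gcongr
          · exact hc.area x
          · exact hA.trans (by gcongr)
    _ = 3 * K ^ 2 * e + K ^ 2 * ‖x‖ * e := by ring
    _ ≤ 3 * K ^ 2 * (1 + ‖x‖) * e := by
        have : 0 ≤ K ^ 2 * ‖x‖ * e := by positivity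
        nlinarith

/-- A second-order approximation at the intermediate point already forces a third-order defect. The
bound is linear in `N`, as the a priori growth estimate of the scheme requires. -/
theorem norm_davieIncrement_defect_le (hα : (α : ℝ) ≤ 1 / 2) (hc : CoeffBounds B G K)
    (hX : PathBounds X T K) {s u t : ℝ} (hs : 0 ≤ s) (hsu : s ≤ u) (hut : u ≤ t) (ht : t ≤ T)
    (h1 : t - s ≤ 1) {x y : E} {N : ℝ} (hN : 1 + ‖x‖ ≤ N)
    (hxy : ‖y - x - davieIncrement B G X s u x‖ ≤ N * ((u - s) ^ (α : ℝ)) ^ 2) :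
    ‖davieIncrement B G X s u x + davieIncrement B G X u t y - davieIncrement B G X s t x‖
      ≤ 12 * K ^ 6 * N * ((t - s) ^ (α : ℝ)) ^ 3 := by
  have hK := hc.one_le
  have he0 : 0 ≤ (t - s) ^ (α : ℝ) := Real.rpow_nonneg (by linarith) _
  have he1 : (t - s) ^ (α : ℝ) ≤ 1 := Real.rpow_le_one (by linarith) h1 α.2
  have he2 := le_rpow_sq hα (by linarith) h1
  have hesu : (u - s) ^ (α : ℝ) ≤ (t - s) ^ (α : ℝ) :=
    Real.rpow_le_rpow (by linarith) (by linarith) α.2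
  have heut : (t - u) ^ (α : ℝ) ≤ (t - s) ^ (α : ℝ) :=
    Real.rpow_le_rpow (by linarith) (by linarith) α.2
  have hP1 := hX.path s u hs hsu (by linarith)
  have hA1 := hX.area s u hs hsu (by linarith)
  have hP2 := hX.path u t (by linarith) hut ht
  have hA2 := hX.area u t (by linarith) hut ht
  have hu0 : 0 ≤ (u - s) ^ (α : ℝ) := Real.rpow_nonneg (by linarith) _
  have ht0 : 0 ≤ (t - u) ^ (α : ℝ) := Real.rpow_nonneg (by linarith) _
  set e := (t - s) ^ (α : ℝ)
  have hN1 : 1 ≤ N := by linarith [norm_nonneg x]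
  have hK0 : 0 ≤ K := by linarith
  set v := X.path u - X.path s
  have hv : ‖v‖ ≤ K * e := hP1.trans (by gcongr)
  have hW : ‖X.path t - X.path u‖ ≤ K * e := hP2.trans (by gcongr)
  have hA1' : ‖X.area s u‖ ≤ K * e ^ 2 := hA1.trans (by gcongr)
  have hA2' : ‖X.area u t‖ ≤ K * e ^ 2 := hA2.trans (by gcongr)
  have hGv : ‖G x v‖ ≤ K ^ 2 * e := by
    calc ‖G x v‖ ≤ K * (K * e) :=
          (ContinuousLinearMap.le_opNorm _ _).trans (by gcongr; exact hc.norm x)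
      _ = _ := by ring
  have hsharp : ‖y - x - G x v‖ ≤ 3 * K ^ 2 * N * e ^ 2 := by
    have : y - x - G x v = (y - x - davieIncrement B G X s u x) + (u - s) • B x
        + areaCoeff G x (X.area s u) := by
      simp only [davieIncrement]; abel
    rw [this]
    calc _ ≤ N * e ^ 2 + e ^ 2 * (K * N) + K * (K * e ^ 2) := by
          refine norm_add₃_le.trans (add_le_add_three (hxy.trans (by gcongr)) ?_ ?_)
          · rw [norm_smul, Real.norm_of_nonneg (by linarith)]
            refine mul_le_mul (by linarith) ((hc.drift x).trans (by gcongr)) (norm_nonneg _)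
              (by positivity)
          · exact (ContinuousLinearMap.le_opNorm _ _).trans (by gcongr; exact hc.area x)
      _ = (1 * N + K ^ 1 * N + K ^ 2 * 1) * e ^ 2 := by ring
      _ ≤ (K ^ 2 * N + K ^ 2 * N + K ^ 2 * N) * e ^ 2 := by
          gcongr
          · exact one_le_pow₀ hK
          · norm_num
      _ = _ := by ring
  have hdiff : ‖y - x‖ ≤ 4 * K ^ 2 * N * e := by
    calc ‖y - x‖ = ‖(y - x - G x v) + G x v‖ := by rw [sub_add_cancel]
      _ ≤ 3 * K ^ 2 * N * e ^ 2 + K ^ 2 * 1 * e :=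
        norm_add_le_of_le hsharp (by rw [mul_one]; exact hGv)
      _ ≤ 3 * K ^ 2 * N * e + K ^ 2 * N * e := by
          gcongr
          nlinarith
      _ = _ := by ring
  have hTay : ‖G y - G x - fderiv ℝ G x (G x v)‖ ≤ 4 * K ^ 5 * N * e ^ 2 := by
    -- Taylor's formula is used at `x + G x v`, whose distance from `x` does not involve `N`; the
    -- Lipschitz bound covers the rest. Expanding directly at `y` would produce `N²`.
    have h1 := hc.norm_sub (x + G x v) y
    have h2 := hc.taylor x (x + G x v)
    rw [taylorRemainder, add_sub_cancel_left] at h2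
    rw [← sub_sub] at h1
    calc _ = ‖(G y - G (x + G x v)) + (G (x + G x v) - G x - fderiv ℝ G x (G x v))‖ := by
          congr 1; abel
      _ ≤ K * (3 * K ^ 2 * N * e ^ 2) + K * (K ^ 2 * e) ^ 2 :=
          norm_add_le_of_le (h1.trans (by gcongr)) (h2.trans (by gcongr))
      _ = (3 * K ^ 3 * N + K ^ 5 * 1) * e ^ 2 := by ring
      _ ≤ (3 * K ^ 5 * N + K ^ 5 * N) * e ^ 2 := by
          gcongr ?_ * _
          gcongr; norm_num
      _ = _ := by ring
  rw [davieIncrement_add]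
  calc _ ≤ e ^ 2 * (K * (4 * K ^ 2 * N * e)) + (4 * K ^ 5 * N * e ^ 2) * (K * e)
        + (K * (4 * K ^ 2 * N * e)) * (K * e ^ 2) := by
        refine norm_add₃_le.trans (add_le_add_three ?_ ?_ ?_)
        · rw [norm_smul, Real.norm_of_nonneg (by linarith)]
          exact mul_le_mul (by linarith) ((hc.drift_sub x y).trans (by gcongr)) (norm_nonneg _)
            (by positivity)
        · exact (ContinuousLinearMap.le_opNorm _ _).trans (by gcongr)
        · exact (ContinuousLinearMap.le_opNorm _ _).trans
            (by gcongr; exact (hc.area_sub x y).trans (by gcongr))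
    _ = (4 * K ^ 3 + 4 * K ^ 6 + 4 * K ^ 4) * N * e ^ 3 := by ring
    _ ≤ (4 * K ^ 6 + 4 * K ^ 6 + 4 * K ^ 6) * N * e ^ 3 := by
        gcongr <;> first | exact hK | norm_num
    _ = _ := by ring

end Increments

/-! ### The Davie scheme -/

section Scheme

open Filter Topology

variable {α : ℝ≥0} {V : Type*} [NormedAddCommGroup V] [InnerProductSpace ℝ V]
  [FiniteDimensional ℝ V]
variable {E : Type*} [NormedAddCommGroup E] [InnerProductSpace ℝ E]
variable {B : E → E} {G : E → V →L[ℝ] E} {X : RoughPath α V} {T K : ℝ}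

/-- The constant in the local error estimate of the Davie scheme. -/
def davieConst (α K : ℝ) : ℝ := 24 * K ^ 6 / (1 - sewingFactor α)

theorem davieConst_ge {α K : ℝ} (hα : 1 / 3 < α) (hK : 1 ≤ K) : 24 * K ^ 6 ≤ davieConst α K := by
  have h1 := sewingFactor_lt_one hα
  have h2 := sewingFactor_pos α
  rw [davieConst, le_div_iff₀ (by linarith)]
  have : 0 ≤ K ^ 6 := by positivity
  nlinarith

/-- The constant is the fixed point of the sewing recursion `M = r M + 2 C` with `C = 12 K ^ 6`, the
defect constant. -/
theorem davieConst_eq {α K : ℝ} (hα : 1 / 3 < α) :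
    sewingFactor α * davieConst α K + 24 * K ^ 6 = davieConst α K := by
  have h1 := sewingFactor_lt_one hα
  rw [davieConst]
  field_simp [show 1 - sewingFactor α ≠ 0 by linarith]
  ring

/-- The linear growth of the drift makes the error depend on the size of the scheme, so both are
bounded together. Let `N` be the maximum of `1 + ‖y j‖` on the block. Sewing gives an error
proportional to `N`, and on a block with `M δ^α ≤ 1` the displacement from `y 0` is at most `N / 6`,
so `N` is at most twice `1 + ‖y 0‖`. -/
theorem davie_local_error (hα : 1 / 3 < (α : ℝ)) (hα' : (α : ℝ) ≤ 1 / 2) (hc : CoeffBounds B G K)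
    (hX : PathBounds X T K) {δ : ℝ} (hδ1 : δ ≤ 1)
    (hδ : davieConst α K * δ ^ (α : ℝ) ≤ 1) {a h : ℝ} (ha : 0 ≤ a) (hh : 0 ≤ h) {n : ℕ}
    (hn : a + n * h ≤ T) (hnδ : n * h ≤ δ) {y : ℕ → E}
    (hy : ∀ j < n, y (j + 1) = y j + davieIncrement B G X (a + j * h) (a + (j + 1 : ℕ) * h) (y j)) :
    (∀ j ≤ n, 1 + ‖y j‖ ≤ 2 * (1 + ‖y 0‖)) ∧
    ∀ k l, k ≤ l → l ≤ n →
      ‖y l - y k - davieIncrement B G X (a + k * h) (a + l * h) (y k)‖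
        ≤ 2 * davieConst α K * (1 + ‖y 0‖) * ((((l - k : ℕ) : ℝ) * h) ^ (α : ℝ)) ^ 3 := by
  have hK := hc.one_le
  have hM := davieConst_ge hα hK
  have hMeq := davieConst_eq (K := K) hα
  set M := davieConst α K
  have hK6 : 1 ≤ K ^ 6 := one_le_pow₀ hK
  have hM0 : 0 ≤ M := by linarith
  obtain ⟨j₀, hj₀, hmax⟩ := (Finset.range (n + 1)).exists_max_image (fun j => ‖y j‖) ⟨0, by simp⟩
  have hj₀n : j₀ ≤ n := Nat.lt_succ_iff.mp (Finset.mem_range.mp hj₀)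
  set N := 1 + ‖y j₀‖ with hN
  have hN0 : 0 ≤ N := by positivity
  have hNy (j : ℕ) (hj : j ≤ n) : 1 + ‖y j‖ ≤ N := by
    have := hmax j (Finset.mem_range.mpr (by omega))
    linarith
  have hgap {k l : ℕ} (hkl : k ≤ l) : (a + l * h) - (a + k * h) = ((l - k : ℕ) : ℝ) * h := by
    push_cast [hkl]; ring
  have hle {k l : ℕ} (hkl : k ≤ l) : a + k * h ≤ a + l * h := by gcongr
  have hgapδ {k l : ℕ} (hl : l ≤ n) : ((l - k : ℕ) : ℝ) * h ≤ δ := by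
    refine le_trans ?_ hnδ
    gcongr
    omega
  have hMe {k l : ℕ} (hl : l ≤ n) : M * (((l - k : ℕ) : ℝ) * h) ^ (α : ℝ) ≤ 1 := by
    refine le_trans ?_ hδ
    gcongr
    exact hgapδ hl
  have hsew := discrete_sewing (a := fun k l =>
      ‖y l - y k - davieIncrement B G X (a + k * h) (a + l * h) (y k)‖)
    (ω := fun n => (((n : ℝ) * h) ^ (α : ℝ)) ^ 3) (r := sewingFactor α) (C := 12 * K ^ 6 * N)
    (M := M * N) (L := n) (by positivity) (by positivity) (fun n => by positivity)
    (fun i j hij => by dsimp only; gcongr)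
    (fun i j hij => two_mul_rpow_cube_le α.2 (by positivity) (by
      rw [← mul_assoc]; gcongr; exact_mod_cast hij))
    (by nlinarith) (fun k => by simp [davieIncrement_self]) (fun k hk => by simp [hy k hk])
    (fun k m l hkm hml hl hind => by
      have h1 := norm_davieIncrement_defect_le hα' hc hX (s := a + k * h) (u := a + m * h)
        (t := a + l * h) (by positivity) (hle hkm) (hle hml) ((hle hl).trans hn)
        (by rw [hgap (hkm.trans hml)]; exact (hgapδ hl).trans hδ1) (hNy k (by omega))
        (y := y m) (by
          rw [hgap hkm]
          -- The inductive third-order bound, multiplied out with `M e ≤ 1`, is the second-order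
          -- closeness required of the intermediate point.
          refine hind.trans ?_
          have := hMe (k := k) (hml.trans hl)
          have h2 : 0 ≤ ((((m - k : ℕ) : ℝ) * h) ^ (α : ℝ)) ^ 2 * N := by positivity
          nlinarith)
      rw [hgap (hkm.trans hml)] at h1
      refine le_trans (le_of_eq ?_) (norm_add₃_le.trans (add_le_add_three le_rfl le_rfl h1))
      congr 1
      abel)
  have hNle : N ≤ 2 * (1 + ‖y 0‖) := by
    have h1 := hsew 0 j₀ (Nat.zero_le _) hj₀n
    have h2 := norm_davieIncrement_le hα' hc hX (s := a + (0 : ℕ) * h) (t := a + j₀ * h)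
      (by positivity) (hle (Nat.zero_le _)) ((hle hj₀n).trans hn)
      (by rw [hgap (Nat.zero_le _)]; exact (hgapδ hj₀n).trans hδ1) (y 0)
    rw [hgap (Nat.zero_le _)] at h2
    have h3 := hMe (k := 0) hj₀n
    have he0 : 0 ≤ (((j₀ - 0 : ℕ) : ℝ) * h) ^ (α : ℝ) := by positivity
    set e := (((j₀ - 0 : ℕ) : ℝ) * h) ^ (α : ℝ)
    have hy0 := hNy 0 (Nat.zero_le _)
    have hK2 : K ^ 2 ≤ K ^ 6 := pow_le_pow_right₀ hK (by norm_num)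
    have hMe1 : e ≤ 1 := by nlinarith
    have h4 : K ^ 6 * e ≤ 1 / 24 := by nlinarith
    have h4' : e ≤ 1 / 24 := by nlinarith
    have h5 : 3 * K ^ 2 * (1 + ‖y 0‖) * e ≤ 3 * (1 / 24) * N := by
      calc 3 * K ^ 2 * (1 + ‖y 0‖) * e ≤ 3 * K ^ 6 * N * e := by gcongr
        _ = 3 * (K ^ 6 * e) * N := by ring
        _ ≤ _ := by gcongr
    have h6 : M * N * e ^ 3 ≤ 1 / 24 * N := by
      calc M * N * e ^ 3 = (M * e) * (e * e) * N := by ring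
        _ ≤ 1 * (1 / 24 * 1) * N := by gcongr
        _ = _ := by ring
    have h7 : ‖y j₀‖ ≤ ‖y 0‖ + ‖davieIncrement B G X (a + (0 : ℕ) * h) (a + j₀ * h) (y 0)‖
        + ‖y j₀ - y 0 - davieIncrement B G X (a + (0 : ℕ) * h) (a + j₀ * h) (y 0)‖ := by
      refine le_trans (le_of_eq ?_) norm_add₃_le
      congr 1; abel
    linarith
  refine ⟨fun j hj => (hNy j hj).trans hNle, fun k l hkl hl => (hsew k l hkl hl).trans ?_⟩
  calc M * N * ((((l - k : ℕ) : ℝ) * h) ^ (α : ℝ)) ^ 3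
      ≤ M * (2 * (1 + ‖y 0‖)) * ((((l - k : ℕ) : ℝ) * h) ^ (α : ℝ)) ^ 3 := by gcongr
    _ = _ := by ring

/-- The Davie scheme with step size `h` started at `ξ`. -/
def davieScheme (B : E → E) (G : E → V →L[ℝ] E) (X : RoughPath α V) (h : ℝ) (ξ : E) : ℕ → E
  | 0 => ξ
  | k + 1 => davieScheme B G X h ξ k
      + davieIncrement B G X (k * h) ((k + 1 : ℕ) * h) (davieScheme B G X h ξ k)

/-- The horizon consists of `T * 2 ^ m` blocks of length `2^{-m}`, each made of exactly `2 ^ (p -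
m)` steps. On a block `1 + ‖y‖` at most doubles, whence the growth factor `2 ^ (T * 2 ^ m)`. No
constant depends on the step or on `ξ`. -/
theorem davieScheme_bound (hα : 1 / 3 < (α : ℝ)) (hα' : (α : ℝ) ≤ 1 / 2)
    (hc : CoeffBounds B G K) {T : ℕ} (hX : PathBounds X T K) :
    ∃ (m : ℕ) (C M : ℝ), 0 ≤ C ∧ 0 ≤ M ∧ ∀ (ξ : E) (p : ℕ), m ≤ p → ∀ k l : ℕ, k ≤ l →
      l ≤ T * 2 ^ p → ‖davieScheme B G X ((1 / 2) ^ p) ξ l‖ ≤ C * (1 + ‖ξ‖) ∧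
      (((l - k : ℕ) : ℝ) * (1 / 2) ^ p ≤ (1 / 2) ^ m →
        ‖davieScheme B G X ((1 / 2) ^ p) ξ l - davieScheme B G X ((1 / 2) ^ p) ξ k
          - davieIncrement B G X (k * (1 / 2) ^ p) (l * (1 / 2) ^ p)
            (davieScheme B G X ((1 / 2) ^ p) ξ k)‖
        ≤ M * (1 + ‖ξ‖) * ((((l - k : ℕ) : ℝ) * (1 / 2) ^ p) ^ (α : ℝ)) ^ 3) := by
  have hK := hc.one_le
  have hM := davieConst_ge hα hK
  have hM0 : 0 < davieConst α K := lt_of_lt_of_le (by positivity) hM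
  obtain ⟨m, hm⟩ := exists_pow_half_rpow_le (α := α) (by linarith) hM0
  have hδ1 : (1 / 2 : ℝ) ^ m ≤ 1 := pow_le_one₀ (by norm_num) (by norm_num)
  refine ⟨m, 2 ^ (T * 2 ^ m), 2 * davieConst α K * 2 ^ (T * 2 ^ m), by positivity, by positivity,
    fun ξ p hp => ?_⟩
  set h : ℝ := (1 / 2) ^ p with hh
  set y := davieScheme B G X h ξ with hy
  have h0 : 0 ≤ h := by positivity
  have hTh : ((T * 2 ^ p : ℕ) : ℝ) * h = T := by
    rw [hh]; push_cast; rw [mul_assoc, ← mul_pow]; norm_num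
  have hblock : ((2 ^ (p - m) : ℕ) : ℝ) * h = (1 / 2) ^ m := by
    rw [hh]; push_cast
    rw [show p = (p - m) + m by omega, pow_add, Nat.add_sub_cancel, ← mul_assoc, ← mul_pow]
    norm_num
  have hloc (i n : ℕ) (hin : i + n ≤ T * 2 ^ p) (hn : n * h ≤ (1 / 2 : ℝ) ^ m) :=
    davie_local_error hα hα' hc hX hδ1 hm (a := i * h) (h := h) (n := n) (by positivity) h0
      (by rw [← add_mul, ← hTh]; gcongr; exact_mod_cast hin) hn (y := fun j => y (i + j))
      (fun j _ => by
        rw [← add_assoc, hy, davieScheme]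
        congr 2 <;> (push_cast; ring))
  have hgrow : ∀ i : ℕ, i ≤ T * 2 ^ m → ∀ j ≤ i * 2 ^ (p - m), 1 + ‖y j‖ ≤ 2 ^ i * (1 + ‖ξ‖) := by
    intro i
    induction i with
    | zero =>
      intro _ j hj
      rw [Nat.zero_mul, Nat.le_zero] at hj
      simp [hj, hy, davieScheme]
    | succ i ih =>
      intro hi j hj
      have ih' := ih (by omega)
      rcases Nat.lt_or_ge (i * 2 ^ (p - m)) j with hlt | hge
      · have hs := hloc (i * 2 ^ (p - m)) (2 ^ (p - m)) (by
          calc i * 2 ^ (p - m) + 2 ^ (p - m) = (i + 1) * 2 ^ (p - m) := by ring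
            _ ≤ (T * 2 ^ m) * 2 ^ (p - m) := Nat.mul_le_mul_right _ hi
            _ = T * 2 ^ p := by rw [mul_assoc, ← pow_add]; congr 2; omega) hblock.le
        have h1 := hs.1 (j - i * 2 ^ (p - m)) (by rw [add_mul] at hj; omega)
        simp only [Nat.add_sub_cancel' hlt.le, add_zero] at h1
        have h2 := ih' _ le_rfl
        calc 1 + ‖y j‖ ≤ 2 * (2 ^ i * (1 + ‖ξ‖)) := h1.trans (by gcongr)
          _ = _ := by ring
      · refine (ih' j hge).trans ?_
        gcongr
        · norm_num
        · omega
  have hall (j : ℕ) (hj : j ≤ T * 2 ^ p) : 1 + ‖y j‖ ≤ 2 ^ (T * 2 ^ m) * (1 + ‖ξ‖) :=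
    hgrow _ le_rfl j (hj.trans (by rw [mul_assoc, ← pow_add]; gcongr <;> omega))
  intro k l hkl hl
  refine ⟨by linarith [hall l hl], fun hlk => ?_⟩
  have hs := (hloc k (l - k) (by omega) hlk).2 0 (l - k) (Nat.zero_le _) le_rfl
  have e : (k : ℝ) * h + ((l - k : ℕ) : ℝ) * h = l * h := by push_cast [hkl]; ring
  simp only [Nat.add_sub_cancel' hkl, add_zero, CharP.cast_eq_zero, zero_mul, Nat.sub_zero, e] at hs
  refine hs.trans ?_
  have := hall k (by omega)
  calc _ ≤ 2 * davieConst α K * (2 ^ (T * 2 ^ m) * (1 + ‖ξ‖))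
        * ((((l - k : ℕ) : ℝ) * h) ^ (α : ℝ)) ^ 3 := by gcongr
    _ = _ := by ring

/-! ### Davie solutions -/

/-- `U` is a Davie solution of the rough differential equation on `[0, T]`, with explicit
constants. -/
structure IsDavieOn (B : E → E) (G : E → V →L[ℝ] E) (X : RoughPath α V) (T δ R M : ℝ)
    (U : ℝ → E) : Prop where
  bdd : ∀ t, 0 ≤ t → t ≤ T → ‖U t‖ ≤ R
  error : ∀ s t, 0 ≤ s → s ≤ t → t ≤ T → t - s ≤ δ →
    ‖U t - U s - davieIncrement B G X s t (U s)‖ ≤ M * ((t - s) ^ (α : ℝ)) ^ 3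

/-- The Davie scheme with step size `2^{-p}` as a function of time. -/
def davieApprox (B : E → E) (G : E → V →L[ℝ] E) (X : RoughPath α V) (ξ : E) (p : ℕ) (t : ℝ) : E :=
  davieScheme B G X ((1 / 2) ^ p) ξ ⌊t * 2 ^ p⌋₊

theorem tendsto_floor_dyadic {t : ℝ} (ht : 0 ≤ t) :
    Tendsto (fun p : ℕ => (⌊t * 2 ^ p⌋₊ : ℝ) * (1 / 2) ^ p) atTop (𝓝 t) := by
  have h0 : Tendsto (fun p : ℕ => t - (1 / 2 : ℝ) ^ p) atTop (𝓝 t) := by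
    simpa using (tendsto_pow_atTop_nhds_zero_of_lt_one (r := (1 / 2 : ℝ)) (by norm_num)
      (by norm_num)).const_sub t
  have hpp (p : ℕ) : (2 : ℝ) ^ p * (1 / 2) ^ p = 1 := by rw [← mul_pow]; norm_num
  refine tendsto_of_tendsto_of_tendsto_of_le_of_le h0 tendsto_const_nhds (fun p => ?_) fun p => ?_
  · have := (Nat.lt_floor_add_one (t * 2 ^ p)).le
    have h2 : t * 2 ^ p * (1 / 2) ^ p ≤ (⌊t * 2 ^ p⌋₊ + 1 : ℝ) * (1 / 2) ^ p := by gcongr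
    rw [mul_assoc, hpp] at h2
    simp only
    linarith
  · have h2 : (⌊t * 2 ^ p⌋₊ : ℝ) * (1 / 2) ^ p ≤ t * 2 ^ p * (1 / 2) ^ p := by
      gcongr; exact Nat.floor_le (by positivity)
    rwa [mul_assoc, hpp, mul_one] at h2

theorem tendsto_davieIncrement (hα : 0 < α) (hB : Continuous B)
    (hG : Continuous G) (hH : Continuous (areaCoeff G)) {ι : Type*} {l : Filter ι} {s t : ℝ} {x : E}
    {f g : ι → ℝ} {y : ι → E} (hf : Tendsto f l (𝓝 s)) (hg : Tendsto g l (𝓝 t))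
    (hy : Tendsto y l (𝓝 x)) :
    Tendsto (fun i => davieIncrement B G X (f i) (g i) (y i)) l
      (𝓝 (davieIncrement B G X s t x)) := by
  have hW := X.continuous_path hα
  have hA := (X.continuous_area hα).tendsto (s, t)
  refine (((hg.sub hf).smul ((hB.tendsto x).comp hy)).add ?_).add ?_
  · exact (isBoundedBilinearMap_apply.continuous.tendsto (G x, X.path t - X.path s)).comp
      (((hG.tendsto x).comp hy).prodMk_nhds
        (((hW.tendsto t).comp hg).sub ((hW.tendsto s).comp hf)))
  · exact (isBoundedBilinearMap_apply.continuous.tendsto (areaCoeff G x, X.area s t)).comp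
      (((hH.tendsto x).comp hy).prodMk_nhds (hA.comp (hf.prodMk_nhds hg)))

end Scheme

/-! ### Limits of the Davie scheme -/

section Limits

open Filter Topology

variable {α : ℝ≥0} {V : Type*} [NormedAddCommGroup V] [InnerProductSpace ℝ V]
  [FiniteDimensional ℝ V]
variable {E : Type*} [NormedAddCommGroup E] [InnerProductSpace ℝ E]
variable {B : E → E} {G : E → V →L[ℝ] E} {X : RoughPath α V} {K : ℝ}

theorem continuous_of_norm_sub_le {F F' : Type*} [SeminormedAddCommGroup F]
    [SeminormedAddCommGroup F'] {f : F → F'} (h : ∀ x y, ‖f y - f x‖ ≤ K * ‖y - x‖) :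
    Continuous f :=
  (LipschitzWith.of_dist_le' fun x y => by
    rw [dist_eq_norm, dist_eq_norm]; exact h y x).continuous

theorem CoeffBounds.continuous_drift (hc : CoeffBounds B G K) : Continuous B :=
  continuous_of_norm_sub_le hc.drift_sub

theorem CoeffBounds.continuous (hc : CoeffBounds B G K) : Continuous G :=
  continuous_of_norm_sub_le hc.norm_sub

theorem CoeffBounds.continuous_area (hc : CoeffBounds B G K) : Continuous (areaCoeff G) :=
  continuous_of_norm_sub_le (F' := V ⊗[ℝ] V →L[ℝ] E) hc.area_sub

theorem davieApprox_zero (ξ : E) (p : ℕ) : davieApprox B G X ξ p 0 = ξ := by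
  simp [davieApprox, davieScheme]

theorem floor_dyadic_le {T : ℕ} {t : ℝ} (ht : t ≤ T) (p : ℕ) : ⌊t * 2 ^ p⌋₊ ≤ T * 2 ^ p :=
  Nat.floor_le_of_le (by push_cast; gcongr)

/-- The bounds uniform in the step survive pointwise limits. The filter is left arbitrary so that
the statement serves ultrafilters, before convergence is known, and `atTop` afterwards. -/
theorem isDavieOn_of_tendsto_davieApprox (hα : 1 / 3 < (α : ℝ)) (hα' : (α : ℝ) ≤ 1 / 2)
    (hc : CoeffBounds B G K) {T : ℕ} (hX : PathBounds X T K) :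
    ∃ δ C M : ℝ, 0 < δ ∧ ∀ (ξ : E),
      (∀ t : ℝ, t ≤ T → ∀ᶠ p in atTop, ‖davieApprox B G X ξ p t‖ ≤ C * (1 + ‖ξ‖)) ∧
      ∀ (l : Filter ℕ) (U : ℝ → E), l.NeBot → l ≤ atTop →
      (∀ t : ℝ, 0 ≤ t → t ≤ T → Tendsto (fun p => davieApprox B G X ξ p t) l (𝓝 (U t))) →
      IsDavieOn B G X T δ (C * (1 + ‖ξ‖)) (M * (1 + ‖ξ‖)) U := by
  obtain ⟨m, C, M, hC, hM, h⟩ := davieScheme_bound hα hα' hc hX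
  have hα0 : 0 < α := by rw [← NNReal.coe_pos]; linarith
  have hbdd (ξ : E) (t : ℝ) (ht : t ≤ T) :
      ∀ᶠ p in atTop, ‖davieApprox B G X ξ p t‖ ≤ C * (1 + ‖ξ‖) := by
    filter_upwards [eventually_ge_atTop m] with p hp
    exact (h ξ p hp _ _ le_rfl (floor_dyadic_le ht p)).1
  -- Half of the block length: the grid points below `s` and `t` may lie slightly further apart than
  -- `t - s`, but eventually by less than `(1 / 2) ^ m`.
  refine ⟨(1 / 2) ^ (m + 1), C, M, by positivity,
    fun ξ => ⟨hbdd ξ, fun l U hl hl' hU => ⟨fun t ht0 htT => ?_, fun s t hs hst ht hδ => ?_⟩⟩⟩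
  · exact le_of_tendsto (hU t ht0 htT).norm (hl' (hbdd ξ t htT))
  · have ts := (tendsto_floor_dyadic hs).mono_left hl'
    have tt := (tendsto_floor_dyadic (hs.trans hst)).mono_left hl'
    have us := hU s hs (hst.trans ht)
    have ut := hU t (hs.trans hst) ht
    have tg := tendsto_davieIncrement (X := X) hα0 hc.continuous_drift hc.continuous
      hc.continuous_area ts tt us
    have te := (((tt.sub ts).rpow_const (p := (α : ℝ)) (Or.inr α.2)).pow 3).const_mul
      (M * (1 + ‖ξ‖))
    have hlt : t - s < (1 / 2) ^ m := by
      have : (0 : ℝ) < (1 / 2) ^ m := by positivity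
      rw [pow_succ] at hδ; linarith
    refine le_of_tendsto_of_tendsto ((ut.sub us).sub tg).norm te ?_
    filter_upwards [hl' (eventually_ge_atTop m), (tt.sub ts).eventually_lt_const hlt] with p hp hpl
    have hkl : ⌊s * 2 ^ p⌋₊ ≤ ⌊t * 2 ^ p⌋₊ := Nat.floor_mono (by gcongr)
    have e : ((⌊t * 2 ^ p⌋₊ - ⌊s * 2 ^ p⌋₊ : ℕ) : ℝ) * (1 / 2) ^ p
        = ⌊t * 2 ^ p⌋₊ * (1 / 2) ^ p - ⌊s * 2 ^ p⌋₊ * (1 / 2) ^ p := by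
      push_cast [hkl]; ring
    have := (h ξ p hp _ _ hkl (floor_dyadic_le ht p)).2 (by rw [e]; exact hpl.le)
    rw [e] at this
    exact this

theorem IsDavieOn.mono {T δ R M δ' R' M' : ℝ} {U : ℝ → E} (h : IsDavieOn B G X T δ R M U)
    (hδ : δ' ≤ δ) (hR : R ≤ R') (hM : M ≤ M') : IsDavieOn B G X T δ' R' M' U where
  bdd t h0 ht := (h.bdd t h0 ht).trans hR
  error s t hs hst ht hts := (h.error s t hs hst ht (hts.trans hδ)).trans
    (mul_le_mul_of_nonneg_right hM (pow_nonneg (Real.rpow_nonneg (by linarith) _) _))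

theorem IsDavieOn.of_tendsto (hc : CoeffBounds B G K) {T δ R M : ℝ} {ι : Type*} {l : Filter ι}
    [l.NeBot] {u : ι → ℝ → E} {U : ℝ → E} (hu : ∀ᶠ i in l, IsDavieOn B G X T δ R M (u i))
    (hU : ∀ t, 0 ≤ t → t ≤ T → Tendsto (fun i => u i t) l (𝓝 (U t))) :
    IsDavieOn B G X T δ R M U where
  bdd t h0 ht := le_of_tendsto (hU t h0 ht).norm (hu.mono fun i hi => hi.bdd t h0 ht)
  error s t hs hst ht hts := by
    have us := hU s hs (hst.trans ht)
    have ut := hU t (hs.trans hst) ht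
    have tg : Tendsto (fun i => davieIncrement B G X s t (u i s)) l
        (𝓝 (davieIncrement B G X s t (U s))) := by
      refine (Tendsto.add ?_ ?_).add ?_
      · exact ((hc.continuous_drift.tendsto _).comp us).const_smul _
      · exact ((ContinuousLinearMap.apply ℝ E (X.path t - X.path s)).continuous.tendsto _).comp
          ((hc.continuous.tendsto _).comp us)
      · exact ((ContinuousLinearMap.apply ℝ E (X.area s t)).continuous.tendsto _).comp
          ((hc.continuous_area.tendsto _).comp us)
    exact le_of_tendsto ((ut.sub us).sub tg).norm
      (hu.mono fun i hi => hi.error s t hs hst ht hts)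

theorem IsDavieOn.shift {T δ R M τ : ℝ} {U : ℝ → E} (hτ : 0 ≤ τ)
    (hU : IsDavieOn B G X (T + τ) δ R M U) :
    IsDavieOn B G (X.shift τ) T δ R M (fun t => U (t + τ)) where
  bdd t h0 ht := hU.bdd _ (by linarith) (by linarith)
  error s t hs hst ht hts := by
    have := hU.error (s + τ) (t + τ) (by linarith) (by linarith) (by linarith) (by linarith)
    simpa [davieIncrement, RoughPath.shift] using this

/-- The solution of the rough differential equation, as the limit of the Davie scheme. -/
def davieSolution (B : E → E) (G : E → V →L[ℝ] E) (X : RoughPath α V) (ξ : E) (t : ℝ) : E :=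
  limUnder atTop (fun p => davieApprox B G X ξ p t)

theorem davieSolution_zero (ξ : E) : davieSolution B G X ξ 0 = ξ := by
  simp only [davieSolution, davieApprox_zero]
  exact tendsto_const_nhds.limUnder_eq

/-! ### Regularity of Davie solutions -/

theorem IsDavieOn.holderBounds (hα : (α : ℝ) ≤ 1 / 2) (hc : CoeffBounds B G K)
    {T δ R M : ℝ} (hX : PathBounds X T K) (hR : 0 ≤ R) (hM : 0 ≤ M) (hδ : δ ≤ 1) {U : ℝ → E}
    (hU : IsDavieOn B G X T δ R M U) :
    HolderBounds G X 0 T δ (3 * K ^ 2 * (1 + R) + M) U := by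
  have hK := hc.one_le
  constructor
  · intro s t hs hst ht hts
    have he0 : 0 ≤ (t - s) ^ (α : ℝ) := Real.rpow_nonneg (by linarith) _
    have he1 : (t - s) ^ (α : ℝ) ≤ 1 := Real.rpow_le_one (by linarith) (by linarith) α.2
    have h1 := hU.error s t hs hst ht hts
    have h2 := norm_davieIncrement_le hα hc hX hs hst ht (by linarith) (U s)
    have h3 := hU.bdd s hs (by linarith)
    set e := (t - s) ^ (α : ℝ)
    calc ‖U t - U s‖ = ‖(U t - U s - davieIncrement B G X s t (U s))
          + davieIncrement B G X s t (U s)‖ := by rw [sub_add_cancel]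
      _ ≤ M * e ^ 1 + 3 * K ^ 2 * (1 + R) * e :=
          norm_add_le_of_le (h1.trans (mul_le_mul_of_nonneg_left
            (pow_le_pow_of_le_one he0 he1 (by norm_num)) hM)) (h2.trans (by gcongr))
      _ = _ := by ring
  · intro s t hs hst ht hts
    have he0 : 0 ≤ (t - s) ^ (α : ℝ) := Real.rpow_nonneg (by linarith) _
    have he1 : (t - s) ^ (α : ℝ) ≤ 1 := Real.rpow_le_one (by linarith) (by linarith) α.2
    have he2 := le_rpow_sq hα (by linarith) (show t - s ≤ 1 by linarith)
    have h1 := hU.error s t hs hst ht hts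
    have h3 := hU.bdd s hs (by linarith)
    have h4 := hX.area s t hs hst ht
    set e := (t - s) ^ (α : ℝ)
    have : U t - U s - G (U s) (X.path t - X.path s)
        = (U t - U s - davieIncrement B G X s t (U s)) + (t - s) • B (U s)
          + areaCoeff G (U s) (X.area s t) := by
      rw [davieIncrement]; abel
    rw [this]
    calc _ ≤ M * e ^ 2 + e ^ 2 * (K * (1 + R)) + K * (K * e ^ 2) := by
          refine norm_add₃_le.trans (add_le_add_three (h1.trans ?_) ?_ ?_)
          · exact mul_le_mul_of_nonneg_left (pow_le_pow_of_le_one he0 he1 (by norm_num)) hM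
          · rw [norm_smul, Real.norm_of_nonneg (by linarith)]
            exact mul_le_mul he2 ((hc.drift _).trans (by gcongr)) (norm_nonneg _) (by positivity)
          · exact (ContinuousLinearMap.le_opNorm _ _).trans (by gcongr; exact hc.area _)
      _ = (K * (1 + R) + K ^ 2 + M) * e ^ 2 := by ring
      _ ≤ _ := by
          gcongr
          nlinarith [mul_nonneg (show 0 ≤ K by linarith) hR, mul_nonneg (sq_nonneg K) hR]

theorem continuousOn_of_local_holder {F : Type*} [NormedAddCommGroup F] {α : ℝ} (hα : 0 < α)
    {a b δ C : ℝ} (hδ : 0 < δ) {f : ℝ → F}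
    (hf : ∀ s t, a ≤ s → s ≤ t → t ≤ b → t - s ≤ δ → ‖f t - f s‖ ≤ C * (t - s) ^ α) :
    ContinuousOn f (Icc a b) := by
  intro s hs
  rw [ContinuousWithinAt, tendsto_iff_norm_sub_tendsto_zero]
  have h1 : Tendsto (fun t => |t - s|) (𝓝[Icc a b] s) (𝓝 0) := by
    have : Tendsto (fun t => |t - s|) (𝓝 s) (𝓝 |s - s|) :=
      ((continuous_id.sub continuous_const).abs).tendsto s
    simpa using this.mono_left nhdsWithin_le_nhds
  have h2 : Tendsto (fun t => C * |t - s| ^ α) (𝓝[Icc a b] s) (𝓝 0) := by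
    simpa [Real.zero_rpow hα.ne'] using (h1.rpow_const (p := α) (Or.inr hα.le)).const_mul C
  refine squeeze_zero' (Eventually.of_forall fun _ => norm_nonneg _) ?_ h2
  filter_upwards [self_mem_nhdsWithin, h1.eventually_lt_const hδ] with t ht hts
  rcases le_total s t with h | h
  · rw [abs_of_nonneg (by linarith)] at hts ⊢
    exact hf s t hs.1 h ht.2 hts.le
  · rw [abs_of_nonpos (by linarith), neg_sub] at hts ⊢
    rw [norm_sub_rev]
    exact hf t s ht.1 h hs.2 hts.le

theorem norm_smul_sub_integral_le [FiniteDimensional ℝ E] {f : ℝ → E} {s t C : ℝ} {c : E}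
    (hst : s ≤ t) (hf : ContinuousOn f (Icc s t)) (h : ∀ r ∈ Icc s t, ‖f r - c‖ ≤ C) :
    ‖(∫ r in s..t, f r) - (t - s) • c‖ ≤ C * (t - s) := by
  have hi : IntervalIntegrable f volume s t := hf.intervalIntegrable_of_Icc hst
  rw [← intervalIntegral.integral_const, ← intervalIntegral.integral_sub hi (by simp)]
  have := intervalIntegral.norm_integral_le_of_norm_le_const (a := s) (b := t) (C := C)
    (f := fun r => f r - c) fun r hr => by
      rw [uIoc_of_le hst] at hr
      exact h r ⟨hr.1.le, hr.2⟩
  rwa [abs_of_nonneg (by linarith)] at this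

/-! ### Uniqueness of Davie solutions -/

/-- The remainder in the expansion of a solution, with the drift integrated. -/
def solutionRemainder (B : E → E) (G : E → V →L[ℝ] E) (X : RoughPath α V) (U : ℝ → E)
    (s t : ℝ) : E :=
  U t - U s - (∫ r in s..t, B (U r)) - G (U s) (X.path t - X.path s)
    - areaCoeff G (U s) (X.area s t)

/-- Integrating the drift, instead of freezing it at `s`, makes it additive in time, so it drops out
of the defect. -/
theorem solutionRemainder_add {U : ℝ → E} {s u t : ℝ}
    (h1 : IntervalIntegrable (fun r => B (U r)) volume s u)
    (h2 : IntervalIntegrable (fun r => B (U r)) volume u t) :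
    solutionRemainder B G X U s t = solutionRemainder B G X U s u + solutionRemainder B G X U u t
      + (taylorRemainder G (U s) (U u) + fderiv ℝ G (U s)
          (U u - U s - G (U s) (X.path u - X.path s))) (X.path t - X.path u)
      + (areaCoeff G (U u) - areaCoeff G (U s)) (X.area u t) := by
  rw [solutionRemainder, solutionRemainder, solutionRemainder, areaCoeff_chen G X s u t,
    ← intervalIntegral.integral_add_adjacent_intervals h1 h2, taylorRemainder]
  simp only [map_sub, sub_apply, add_apply]
  abel

/-- For two paths driven by the same signal, the four-point estimates make the difference of the
defects linear in the distance `d` without losing the third order in `e`. -/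
theorem norm_defect_sub_le (hc : CoeffBounds B G K) {d e : ℝ} (hd : 0 ≤ d) (he : 0 ≤ e)
    {x y x' y' : E} {v w : V} {z : V ⊗[ℝ] V} (hx : ‖x - x'‖ ≤ d) (hy : ‖y - y'‖ ≤ d)
    (h1 : ‖y - x‖ ≤ K * e) (h1' : ‖y' - x'‖ ≤ K * e)
    (h2 : ‖(y - x) - (y' - x')‖ ≤ 4 * K ^ 2 * d * e) (h3 : ‖y - x - G x v‖ ≤ K * e ^ 2)
    (h4 : ‖(y - x - G x v) - (y' - x' - G x' v)‖ ≤ 3 * K ^ 2 * d * e ^ 2)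
    (hw : ‖w‖ ≤ K * e) (hz : ‖z‖ ≤ K * e ^ 2) :
    ‖((taylorRemainder G x y + fderiv ℝ G x (y - x - G x v)) w
        - (taylorRemainder G x' y' + fderiv ℝ G x' (y' - x' - G x' v)) w)
      + ((areaCoeff G y - areaCoeff G x) z - (areaCoeff G y' - areaCoeff G x') z)‖
      ≤ 24 * K ^ 5 * d * e ^ 3 := by
  have hK := hc.one_le
  have hK0 : 0 ≤ K := by linarith
  have hTay : ‖taylorRemainder G x y - taylorRemainder G x' y'‖ ≤ 12 * K ^ 4 * d * e ^ 2 := by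
    calc _ ≤ _ := hc.taylor_four_point _ _ _ _
      _ ≤ K * (4 * K ^ 2 * d * e + 2 * (d + d) * (K * e)) * (K * e)
          + K * (K * e) * (4 * K ^ 2 * d * e) := by gcongr
      _ = (8 * K ^ 4 + 4 * K ^ 3) * d * e ^ 2 := by ring
      _ ≤ (8 * K ^ 4 + 4 * K ^ 4) * d * e ^ 2 := by gcongr; norm_num
      _ = _ := by ring
  have hder : ‖fderiv ℝ G x (y - x - G x v) - fderiv ℝ G x' (y' - x' - G x' v)‖
      ≤ 4 * K ^ 4 * d * e ^ 2 := by
    generalize y - x - G x v = a at h3 h4 ⊢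
    generalize y' - x' - G x' v = a' at h4 ⊢
    have heq : fderiv ℝ G x a - fderiv ℝ G x' a'
        = (fderiv ℝ G x - fderiv ℝ G x') a + fderiv ℝ G x' (a - a') := by
      simp only [map_sub, sub_apply]; abel
    rw [heq]
    calc _ ≤ (K * d) * (K * e ^ 2) + K * (3 * K ^ 2 * d * e ^ 2) := by
          refine norm_add_le_of_le ((ContinuousLinearMap.le_opNorm _ _).trans ?_)
            ((ContinuousLinearMap.le_opNorm _ _).trans ?_)
          · gcongr
            exact (hc.deriv_sub _ _).trans (by gcongr)
          · gcongr
            exact hc.deriv _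
      _ = (K ^ 2 + 3 * K ^ 3) * d * e ^ 2 := by ring
      _ ≤ (K ^ 4 + 3 * K ^ 4) * d * e ^ 2 := by gcongr <;> norm_num
      _ = _ := by ring
  have hArea : ‖(areaCoeff G y - areaCoeff G x) - (areaCoeff G y' - areaCoeff G x')‖
      ≤ 6 * K ^ 3 * d * e := by
    calc _ ≤ _ := hc.area_four_point _ _ _ _
      _ ≤ K * (4 * K ^ 2 * d * e + (d + d) * (K * e)) := by gcongr
      _ = (4 * K ^ 3 + 2 * K ^ 2) * d * e := by ring
      _ ≤ (4 * K ^ 3 + 2 * K ^ 3) * d * e := by gcongr; norm_num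
      _ = _ := by ring
  rw [← sub_apply, ← sub_apply, add_sub_add_comm]
  calc _ ≤ (12 * K ^ 4 * d * e ^ 2 + 4 * K ^ 4 * d * e ^ 2) * (K * e)
        + (6 * K ^ 3 * d * e) * (K * e ^ 2) := by
        refine norm_add_le_of_le ((ContinuousLinearMap.le_opNorm _ _).trans ?_)
          ((ContinuousLinearMap.le_opNorm _ _).trans ?_)
        · gcongr
          exact norm_add_le_of_le hTay hder
        · gcongr
    _ = (16 * K ^ 5 + 6 * K ^ 4) * d * e ^ 3 := by ring
    _ ≤ (18 * K ^ 5 + 6 * K ^ 5) * d * e ^ 3 := by gcongr <;> norm_num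
    _ = _ := by ring

/-- The contraction constant `48 K⁵ / (1 - 2^{1 - 3α})` in the uniqueness argument. -/
def uniqConst (α K : ℝ) : ℝ := 48 * K ^ 5 / (1 - sewingFactor α)

theorem uniqConst_ge {α K : ℝ} (hα : 1 / 3 < α) (hK : 1 ≤ K) : 48 * K ^ 5 ≤ uniqConst α K := by
  have h1 := sewingFactor_lt_one hα
  have h2 := sewingFactor_pos α
  rw [uniqConst, le_div_iff₀ (by linarith)]
  have : 0 ≤ K ^ 5 := by positivity
  nlinarith

/-- Write `r` for the sewing factor and `Λ` for `uniqConst`. Splitting at the midpoint bounds the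
remainder difference by `(r Λ + 24 K⁵) d`, and `Λ (1 - r) = 48 K⁵` turns this into `Λ (1 + r) / 2 ·
d`. The supremum shrinks because the paths agree at `a` and the interval is short: `4 K² e ≤ 1 /
12`. -/
theorem davie_contraction [FiniteDimensional ℝ E] (hα : 1 / 3 < (α : ℝ)) (hα' : (α : ℝ) ≤ 1 / 2)
    (hc : CoeffBounds B G K) {T a b : ℝ} (hX : PathBounds X T K) (ha : 0 ≤ a) (hb : b ≤ T)
    (hab1 : b - a ≤ 1) (hΛ : uniqConst α K * (b - a) ^ (α : ℝ) ≤ 1) {U U' : ℝ → E}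
    (hU : HolderBounds G X a b 1 K U) (hU' : HolderBounds G X a b 1 K U') (h0 : U a = U' a)
    {d : ℝ} (hd : 0 ≤ d) (hD : ∀ t, a ≤ t → t ≤ b → ‖U t - U' t‖ ≤ d)
    (hQ : ∀ s t, a ≤ s → s ≤ t → t ≤ b →
      ‖solutionRemainder B G X U s t - solutionRemainder B G X U' s t‖
        ≤ uniqConst α K * d * ((t - s) ^ (α : ℝ)) ^ 3) :
    (∀ t, a ≤ t → t ≤ b → ‖U t - U' t‖ ≤ (1 + sewingFactor α) / 2 * d) ∧
    (∀ s t, a ≤ s → s ≤ t → t ≤ b →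
      ‖solutionRemainder B G X U s t - solutionRemainder B G X U' s t‖
        ≤ uniqConst α K * ((1 + sewingFactor α) / 2 * d) * ((t - s) ^ (α : ℝ)) ^ 3) := by
  have hK := hc.one_le
  have hK0 : 0 ≤ K := by linarith
  have hl0 := sewingFactor_pos α
  have hl1 := sewingFactor_lt_one hα
  have hΛ1 : 48 * K ^ 5 ≤ uniqConst α K := uniqConst_ge hα hK
  have hΛ2 : sewingFactor α * uniqConst α K + 24 * K ^ 5
      = uniqConst α K * ((1 + sewingFactor α) / 2) := by
    rw [uniqConst]
    field_simp [show 1 - sewingFactor α ≠ 0 by linarith]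
    ring
  set Λ := uniqConst α K
  have hΛ0 : 0 ≤ Λ := le_trans (by positivity) hΛ1
  have hBU {U : ℝ → E} (hU : HolderBounds G X a b 1 K U) {s t : ℝ} (hs : a ≤ s) (hst : s ≤ t)
      (ht : t ≤ b) : IntervalIntegrable (fun r => B (U r)) volume s t :=
    (hc.continuous_drift.comp_continuousOn ((continuousOn_of_local_holder (by linarith) one_pos
      hU.holder).mono (Icc_subset_Icc hs ht))).intervalIntegrable_of_Icc hst
  have hsharp (s t : ℝ) (hs : a ≤ s) (hst : s ≤ t) (ht : t ≤ b) :
      ‖(U t - U s - G (U s) (X.path t - X.path s)) - (U' t - U' s - G (U' s)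
        (X.path t - X.path s))‖ ≤ 3 * K ^ 2 * d * ((t - s) ^ (α : ℝ)) ^ 2 := by
    have he0 : 0 ≤ (t - s) ^ (α : ℝ) := Real.rpow_nonneg (by linarith) _
    have he2 := le_rpow_sq hα' (by linarith) (show t - s ≤ 1 by linarith)
    have hΛe : Λ * (t - s) ^ (α : ℝ) ≤ 1 := le_trans (by gcongr) hΛ
    have hQ' := hQ s t hs hst ht
    have hA := hX.area s t (by linarith) hst (by linarith)
    set e := (t - s) ^ (α : ℝ)
    have hb : ‖(∫ r in s..t, B (U r)) - ∫ r in s..t, B (U' r)‖ ≤ K * d * (t - s) := by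
      rw [← intervalIntegral.integral_sub (hBU hU hs hst ht) (hBU hU' hs hst ht)]
      have := intervalIntegral.norm_integral_le_of_norm_le_const (a := s) (b := t) (C := K * d)
        (f := fun r => B (U r) - B (U' r)) fun r hr => by
          rw [uIoc_of_le hst] at hr
          exact (hc.drift_sub _ _).trans
            (by gcongr; exact hD r (hs.trans hr.1.le) (hr.2.trans ht))
      rwa [abs_of_nonneg (by linarith)] at this
    have heq : (U t - U s - G (U s) (X.path t - X.path s)) - (U' t - U' s - G (U' s)
        (X.path t - X.path s)) = ((∫ r in s..t, B (U r)) - ∫ r in s..t, B (U' r))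
        + (areaCoeff G (U s) - areaCoeff G (U' s)) (X.area s t)
        + (solutionRemainder B G X U s t - solutionRemainder B G X U' s t) := by
      simp only [solutionRemainder, sub_apply]; abel
    rw [heq]
    calc _ ≤ K * d * e ^ 2 + (K * d) * (K * e ^ 2) + d * e ^ 2 := by
          refine norm_add₃_le.trans (add_le_add_three (hb.trans (by gcongr)) ?_ (hQ'.trans ?_))
          · refine (ContinuousLinearMap.le_opNorm _ _).trans ?_
            gcongr
            exact (hc.area_sub _ _).trans (by gcongr; exact hD s hs (by linarith))
          · calc Λ * d * e ^ 3 = (Λ * e) * (d * e ^ 2) := by ring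
              _ ≤ 1 * (d * e ^ 2) := by gcongr
              _ = _ := one_mul _
      _ = (K + K ^ 2 + 1) * d * e ^ 2 := by ring
      _ ≤ _ := by gcongr; nlinarith
  have hdiff (s t : ℝ) (hs : a ≤ s) (hst : s ≤ t) (ht : t ≤ b) :
      ‖(U t - U s) - (U' t - U' s)‖ ≤ 4 * K ^ 2 * d * (t - s) ^ (α : ℝ) := by
    have he0 : 0 ≤ (t - s) ^ (α : ℝ) := Real.rpow_nonneg (by linarith) _
    have he1 : (t - s) ^ (α : ℝ) ≤ 1 := Real.rpow_le_one (by linarith) (by linarith) α.2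
    have hP := hX.path s t (by linarith) hst (by linarith)
    have hs' := hsharp s t hs hst ht
    set e := (t - s) ^ (α : ℝ)
    have heq : (U t - U s) - (U' t - U' s)
        = ((U t - U s - G (U s) (X.path t - X.path s)) - (U' t - U' s - G (U' s)
          (X.path t - X.path s))) + (G (U s) - G (U' s)) (X.path t - X.path s) := by
      simp only [sub_apply]; abel
    rw [heq]
    calc _ ≤ 3 * K ^ 2 * d * e ^ 1 + (K * d) * (K * e) := by
          refine norm_add_le_of_le (hs'.trans ?_) ((ContinuousLinearMap.le_opNorm _ _).trans ?_)
          · exact mul_le_mul_of_nonneg_left (pow_le_pow_of_le_one he0 he1 (by norm_num))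
              (by positivity)
          · gcongr
            exact (hc.norm_sub _ _).trans (by gcongr; exact hD s hs (by linarith))
      _ = _ := by ring
  refine ⟨fun t hat htb => ?_, fun s t hs hst ht => ?_⟩
  · have h1 := hdiff a t le_rfl hat htb
    rw [h0, show U t - U' a - (U' t - U' a) = U t - U' t by abel] at h1
    refine h1.trans ?_
    have he0 : 0 ≤ (t - a) ^ (α : ℝ) := Real.rpow_nonneg (by linarith) _
    have hΛe : Λ * (t - a) ^ (α : ℝ) ≤ 1 := le_trans (by gcongr) hΛ
    set e := (t - a) ^ (α : ℝ)
    have hK25 : K ^ 2 ≤ K ^ 5 := pow_le_pow_right₀ hK (by norm_num)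
    have h2 : 48 * K ^ 2 * e ≤ 1 := le_trans (by gcongr; linarith) hΛe
    calc 4 * K ^ 2 * d * e = (4 * K ^ 2 * e) * d := by ring
      _ ≤ _ := by gcongr; linarith
  · set u := (s + t) / 2 with hu
    have hsu : s ≤ u := by linarith
    have hut : u ≤ t := by linarith
    have he0 : 0 ≤ (t - s) ^ (α : ℝ) := Real.rpow_nonneg (by linarith) _
    have he1 : (t - s) ^ (α : ℝ) ≤ 1 := Real.rpow_le_one (by linarith) (by linarith) α.2
    have hsue : (u - s) ^ (α : ℝ) ≤ (t - s) ^ (α : ℝ) :=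
      Real.rpow_le_rpow (by linarith) (by linarith) α.2
    have hute : (t - u) ^ (α : ℝ) ≤ (t - s) ^ (α : ℝ) :=
      Real.rpow_le_rpow (by linarith) (by linarith) α.2
    have hsu0 : 0 ≤ (u - s) ^ (α : ℝ) := Real.rpow_nonneg (by linarith) _
    have hut0 : 0 ≤ (t - u) ^ (α : ℝ) := Real.rpow_nonneg (by linarith) _
    have q1 := hQ s u hs hsu (by linarith)
    have q2 := hQ u t (by linarith) hut ht
    have hq : Λ * d * ((u - s) ^ (α : ℝ)) ^ 3 + Λ * d * ((t - u) ^ (α : ℝ)) ^ 3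
        ≤ sewingFactor α * Λ * d * ((t - s) ^ (α : ℝ)) ^ 3 := by
      have e1 : t - u = u - s := by rw [hu]; ring
      rw [e1]
      have := two_mul_rpow_cube_le (α := α) α.2 (show 0 ≤ u - s by linarith)
        (show 2 * (u - s) ≤ t - s by rw [hu]; linarith)
      calc _ = Λ * d * (2 * ((u - s) ^ (α : ℝ)) ^ 3) := by ring
        _ ≤ Λ * d * (sewingFactor α * ((t - s) ^ (α : ℝ)) ^ 3) := by gcongr
        _ = _ := by ring
    have hU1 := hU.holder s u hs hsu (by linarith) (by linarith)
    have hU1' := hU'.holder s u hs hsu (by linarith) (by linarith)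
    have hU2 := hU.remainder s u hs hsu (by linarith) (by linarith)
    have hd1 := hdiff s u hs hsu (by linarith)
    have hd2 := hsharp s u hs hsu (by linarith)
    have hP := hX.path u t (by linarith) hut (by linarith)
    have hA := hX.area u t (by linarith) hut (by linarith)
    have hDs := hD s hs (by linarith)
    have hDu := hD u (by linarith) (by linarith)
    set e := (t - s) ^ (α : ℝ)
    have hdef := norm_defect_sub_le hc hd he0 hDs hDu (hU1.trans (by gcongr)) (hU1'.trans (by gcongr))
      (hd1.trans (by gcongr)) (hU2.trans (by gcongr)) (hd2.trans (by gcongr))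
      (hP.trans (by gcongr)) (hA.trans (by gcongr))
    rw [solutionRemainder_add (hBU hU hs hsu (by linarith)) (hBU hU (by linarith) hut ht),
      solutionRemainder_add (hBU hU' hs hsu (by linarith)) (hBU hU' (by linarith) hut ht)]
    have heq (a₁ a₁' b₁ b₁' p p' q q' : E) : (a₁ + b₁ + p + q) - (a₁' + b₁' + p' + q')
        = ((a₁ - a₁') + (b₁ - b₁')) + ((p - p') + (q - q')) := by abel
    rw [heq]
    calc _ ≤ sewingFactor α * Λ * d * e ^ 3 + 24 * K ^ 5 * d * e ^ 3 :=
          norm_add_le_of_le ((norm_add_le_of_le q1 q2).trans hq) hdef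
      _ = (sewingFactor α * Λ + 24 * K ^ 5) * d * e ^ 3 := by ring
      _ = _ := by rw [hΛ2]; ring

end Limits

/-! ### Uniqueness of Davie solutions, convergence of the scheme, and the flow. -/

section Uniqueness

open Filter Topology

variable {α : ℝ≥0} {V : Type*} [NormedAddCommGroup V] [InnerProductSpace ℝ V]
  [FiniteDimensional ℝ V]
variable {E : Type*} [NormedAddCommGroup E] [InnerProductSpace ℝ E] [FiniteDimensional ℝ E]
variable {B : E → E} {G : E → V →L[ℝ] E} {X : RoughPath α V} {K : ℝ}

theorem IsDavieOn.norm_solutionRemainder_le (hα : 0 < (α : ℝ)) (hα' : (α : ℝ) ≤ 1 / 2)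
    (hc : CoeffBounds B G K) {T δ R : ℝ} (hδ0 : 0 < δ) (hδ : δ ≤ 1) {U : ℝ → E}
    (hU : IsDavieOn B G X T δ R K U) (hH : HolderBounds G X 0 T δ K U) {s t : ℝ} (hs : 0 ≤ s)
    (hst : s ≤ t) (ht : t ≤ T) (hts : t - s ≤ δ) :
    ‖solutionRemainder B G X U s t‖ ≤ 2 * K ^ 2 * ((t - s) ^ (α : ℝ)) ^ 3 := by
  have hK := hc.one_le
  have hK0 : 0 ≤ K := by linarith
  have he0 : 0 ≤ (t - s) ^ (α : ℝ) := Real.rpow_nonneg (by linarith) _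
  have he2 := le_rpow_sq hα' (by linarith) (show t - s ≤ 1 by linarith)
  have h1 := hU.error s t hs hst ht hts
  have hcont : ContinuousOn (fun r => B (U r)) (Icc s t) :=
    hc.continuous_drift.comp_continuousOn
      ((continuousOn_of_local_holder hα hδ0 hH.holder).mono (Icc_subset_Icc hs ht))
  have h2 := norm_smul_sub_integral_le (C := K * (K * (t - s) ^ (α : ℝ))) (c := B (U s)) hst hcont
    fun r hr => (hc.drift_sub _ _).trans (by
      gcongr
      refine (hH.holder s r hs hr.1 (hr.2.trans ht) (by linarith [hr.2])).trans ?_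
      gcongr
      · linarith [hr.1]
      · exact hr.2)
  set e := (t - s) ^ (α : ℝ)
  have heq : solutionRemainder B G X U s t = (U t - U s - davieIncrement B G X s t (U s))
      - ((∫ r in s..t, B (U r)) - (t - s) • B (U s)) := by
    rw [solutionRemainder, davieIncrement]; abel
  rw [heq]
  calc _ ≤ K * e ^ 3 + K * (K * e) * e ^ 2 :=
        norm_sub_le_of_le h1 (h2.trans (by gcongr))
    _ = (K + K ^ 2) * e ^ 3 := by ring
    _ ≤ _ := by gcongr; nlinarith

/-- Any finite a priori bound `d` starts the iteration of `davie_contraction`, which reduces it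
geometrically to zero. -/
theorem davie_local_unique (hα : 1 / 3 < (α : ℝ)) (hα' : (α : ℝ) ≤ 1 / 2)
    (hc : CoeffBounds B G K) {T a b : ℝ} (hX : PathBounds X T K) (ha : 0 ≤ a) (hb : b ≤ T)
    (hab1 : b - a ≤ 1) (hΛ : uniqConst α K * (b - a) ^ (α : ℝ) ≤ 1) {U U' : ℝ → E}
    (hU : HolderBounds G X a b 1 K U) (hU' : HolderBounds G X a b 1 K U') (h0 : U a = U' a)
    {d : ℝ} (hd : 0 ≤ d) (hD : ∀ t, a ≤ t → t ≤ b → ‖U t - U' t‖ ≤ d)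
    (hQ : ∀ s t, a ≤ s → s ≤ t → t ≤ b →
      ‖solutionRemainder B G X U s t - solutionRemainder B G X U' s t‖
        ≤ d * ((t - s) ^ (α : ℝ)) ^ 3) :
    ∀ t, a ≤ t → t ≤ b → U t = U' t := by
  have hl0 := sewingFactor_pos α
  have hl1 := sewingFactor_lt_one hα
  set r := (1 + sewingFactor α) / 2 with hr
  have hr0 : 0 ≤ r := by linarith
  have hr1 : r < 1 := by linarith
  have hΛ1 : 1 ≤ uniqConst α K := by
    have := one_le_pow₀ (n := 5) hc.one_le
    linarith [uniqConst_ge hα hc.one_le]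
  have key : ∀ n : ℕ, (∀ t, a ≤ t → t ≤ b → ‖U t - U' t‖ ≤ r ^ n * d) ∧
      (∀ s t, a ≤ s → s ≤ t → t ≤ b →
      ‖solutionRemainder B G X U s t - solutionRemainder B G X U' s t‖
        ≤ uniqConst α K * (r ^ n * d) * ((t - s) ^ (α : ℝ)) ^ 3) := by
    intro n
    induction n with
    | zero =>
      refine ⟨fun t h1 h2 => by simpa using hD t h1 h2, fun s t h1 h2 h3 =>
        (hQ s t h1 h2 h3).trans ?_⟩
      rw [pow_zero, one_mul]
      have : 0 ≤ ((t - s) ^ (α : ℝ)) ^ 3 := pow_nonneg (Real.rpow_nonneg (by linarith) _) _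
      gcongr
      nlinarith
    | succ n ih =>
      have := davie_contraction hα hα' hc hX ha hb hab1 hΛ hU hU' h0 (by positivity) ih.1 ih.2
      rw [← hr, ← mul_assoc, ← pow_succ'] at this
      exact this
  intro t h1 h2
  have hlim : Tendsto (fun n : ℕ => r ^ n * d) atTop (𝓝 0) := by
    simpa using (tendsto_pow_atTop_nhds_zero_of_lt_one hr0 hr1).mul_const d
  have := ge_of_tendsto hlim (Eventually.of_forall fun n => (key n).1 t h1 h2)
  exact sub_eq_zero.mp (norm_le_zero_iff.mp this)

/-- Davie solutions are unique. -/
theorem IsDavieOn.eq (hα : 1 / 3 < (α : ℝ)) (hα' : (α : ℝ) ≤ 1 / 2)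
    (hc : CoeffBounds B G K) {T δ R M δ' R' M' : ℝ} {U U' : ℝ → E} (hδ : 0 < δ) (hδ' : 0 < δ')
    (hU : IsDavieOn B G X T δ R M U) (hU' : IsDavieOn B G X T δ' R' M' U') (h0 : U 0 = U' 0) :
    ∀ t, 0 ≤ t → t ≤ T → U t = U' t := by
  obtain ⟨K', hX'⟩ := exists_pathBounds X T
  set δ₁ := min 1 (min δ δ') with hδ₁
  set R₁ := max 0 (max R R') with hR₁
  set M₁ := max 0 (max M M') with hM₁
  have hδ0 : 0 < δ₁ := lt_min one_pos (lt_min hδ hδ')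
  have hδ1 : δ₁ ≤ 1 := min_le_left _ _
  have hR0 : 0 ≤ R₁ := le_max_left _ _
  have hM0 : 0 ≤ M₁ := le_max_left _ _
  replace hU : IsDavieOn B G X T δ₁ R₁ M₁ U := hU.mono ((min_le_right _ _).trans (min_le_left _ _))
    ((le_max_left _ _).trans (le_max_right _ _)) ((le_max_left _ _).trans (le_max_right _ _))
  replace hU' : IsDavieOn B G X T δ₁ R₁ M₁ U' :=
    hU'.mono ((min_le_right _ _).trans (min_le_right _ _))
    ((le_max_right _ _).trans (le_max_right _ _)) ((le_max_right _ _).trans (le_max_right _ _))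
  set K₁ := max K K' with hK₁
  have hc₁ : CoeffBounds B G K₁ := hc.mono (le_max_left _ _)
  have hX₁ : PathBounds X T K₁ := hX'.mono (le_max_right _ _)
  have hK₁1 := hc₁.one_le
  -- One constant for the coefficients, the signal and the Hölder bounds of both paths. The length
  -- `η` on which contraction holds depends only on it and on `δ₁`, so finitely many steps reach
  -- `T`.
  set K₂ := 3 * K₁ ^ 2 * (1 + R₁) + M₁ with hK₂
  have hK₁₂ : K₁ ≤ K₂ := by
    have : K₁ ≤ K₁ ^ 2 := by nlinarith
    have : 0 ≤ K₁ ^ 2 * R₁ := by positivity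
    nlinarith
  have hM₂ : M₁ ≤ K₂ := by rw [hK₂]; linarith [show 0 ≤ 3 * K₁ ^ 2 * (1 + R₁) by positivity]
  have hH := hU.holderBounds hα' hc₁ hX₁ hR0 hM0 hδ1
  have hH' := hU'.holderBounds hα' hc₁ hX₁ hR0 hM0 hδ1
  have hc₂ := hc₁.mono hK₁₂
  have hX₂ := hX₁.mono hK₁₂
  have hq := fun s t => (hU.mono le_rfl le_rfl hM₂).norm_solutionRemainder_le (s := s) (t := t)
    (by linarith) hα' hc₂ hδ0 hδ1 hH
  have hq' := fun s t => (hU'.mono le_rfl le_rfl hM₂).norm_solutionRemainder_le (s := s) (t := t)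
    (by linarith) hα' hc₂ hδ0 hδ1 hH'
  have hΛ0 : 0 < uniqConst α K₂ := lt_of_lt_of_le (by have := hc₂.one_le; positivity)
    (uniqConst_ge hα hc₂.one_le)
  obtain ⟨m, hm⟩ := exists_pow_half_rpow_le (α := α) (by linarith) hΛ0
  set η := min δ₁ ((1 / 2) ^ m) with hη
  have hη0 : 0 < η := lt_min hδ0 (by positivity)
  have hηδ : η ≤ δ₁ := min_le_left _ _
  have hstep : ∀ i : ℕ, ∀ t, 0 ≤ t → t ≤ T → t ≤ i * η → U t = U' t := by
    intro i
    induction i with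
    | zero =>
      intro t ht _ ht'
      rw [show t = 0 by simp at ht'; linarith]
      exact h0
    | succ i ih =>
      intro t ht htT hti
      push_cast at hti
      rcases le_total t (i * η) with h | h
      · exact ih t ht htT h
      have ha : 0 ≤ i * η := by positivity
      have htη : t - i * η ≤ η := by linarith
      refine davie_local_unique hα hα' hc₂ hX₂ (d := 2 * R₁ + 4 * K₂ ^ 2) ha htT (by linarith) ?_
        (hH.mono ha htT (by linarith) le_rfl) (hH'.mono ha htT (by linarith) le_rfl)
        (ih _ ha (h.trans htT) le_rfl) (by positivity) (fun r h1 h2 => ?_)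
        (fun r s h1 h2 h3 => ?_) t h le_rfl
      · refine le_trans ?_ hm
        have : 0 ≤ t - i * η := by linarith
        gcongr
        exact htη.trans (min_le_right _ _)
      · refine (norm_sub_le_of_le (hU.bdd r (by linarith) (by linarith))
          (hU'.bdd r (by linarith) (by linarith))).trans ?_
        linarith [show 0 ≤ 4 * K₂ ^ 2 by positivity]
      · have he : 0 ≤ ((s - r) ^ (α : ℝ)) ^ 3 := pow_nonneg (Real.rpow_nonneg (by linarith) _) _
        refine (norm_sub_le_of_le
          (hq r s (by linarith) h2 (by linarith) (by linarith))
          (hq' r s (by linarith) h2 (by linarith) (by linarith))).trans ?_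
        nlinarith
  intro t ht htT
  obtain ⟨i, hi⟩ := exists_nat_ge (t / η)
  exact hstep i t ht htT (by rwa [div_le_iff₀ hη0] at hi)

/-! ### The solution map -/

/-- Closed balls are compact, so along each ultrafilter the scheme converges at every time of the
horizon, and the limit is a Davie solution from `ξ`. By uniqueness the limit is the same for all
ultrafilters, which is convergence along `atTop`; no Cauchy estimate between different steps is
needed. -/
theorem tendsto_davieApprox (hα : 1 / 3 < (α : ℝ)) (hα' : (α : ℝ) ≤ 1 / 2)
    (hc : CoeffBounds B G K) (X : RoughPath α V) (ξ : E) {t : ℝ} (ht : 0 ≤ t) :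
    Tendsto (fun p => davieApprox B G X ξ p t) atTop (𝓝 (davieSolution B G X ξ t)) := by
  obtain ⟨T, hT⟩ := exists_nat_ge t
  obtain ⟨K', hX'⟩ := exists_pathBounds X T
  have hc₁ : CoeffBounds B G (max K K') := hc.mono (le_max_left _ _)
  have hX₁ : PathBounds X T (max K K') := hX'.mono (le_max_right _ _)
  obtain ⟨δ, C, M, hδ, h⟩ := isDavieOn_of_tendsto_davieApprox hα hα' hc₁ hX₁
  obtain ⟨hb, hl⟩ := h ξ
  have hex (𝒰 : Ultrafilter ℕ) (h𝒰 : ↑𝒰 ≤ (atTop : Filter ℕ)) (s : ℝ) (hs : s ≤ T) :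
      ∃ y, Tendsto (fun p => davieApprox B G X ξ p s) 𝒰 (𝓝 y) := by
    obtain ⟨y, -, hy⟩ := (isCompact_closedBall (0 : E) (C * (1 + ‖ξ‖))).ultrafilter_le_nhds
      (𝒰.map fun p => davieApprox B G X ξ p s) (by
        rw [le_principal_iff]
        have hev : ∀ᶠ p in (𝒰 : Filter ℕ), ‖davieApprox B G X ξ p s‖ ≤ C * (1 + ‖ξ‖) :=
          h𝒰 (hb s hs)
        exact hev.mono fun p hp => by simpa using hp)
    exact ⟨y, hy⟩
  choose! u hu using hex
  have hdav (𝒰 : Ultrafilter ℕ) (h𝒰 : ↑𝒰 ≤ (atTop : Filter ℕ)) :=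
    hl 𝒰 (u 𝒰) 𝒰.neBot h𝒰 fun s _ hs => hu 𝒰 h𝒰 s hs
  have hzero (𝒰 : Ultrafilter ℕ) (h𝒰 : ↑𝒰 ≤ (atTop : Filter ℕ)) : u 𝒰 0 = ξ := by
    refine tendsto_nhds_unique (hu 𝒰 h𝒰 0 (by positivity)) ?_
    simp only [davieApprox_zero]
    exact tendsto_const_nhds
  have hlim : Tendsto (fun p => davieApprox B G X ξ p t) atTop (𝓝 (u (hyperfilter ℕ) t)) := by
    have h0 : ↑(hyperfilter ℕ) ≤ (atTop : Filter ℕ) := Nat.hyperfilter_le_atTop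
    rw [tendsto_iff_ultrafilter]
    intro 𝒰 h𝒰
    rw [(hdav _ h0).eq hα hα' hc₁ hδ hδ (hdav 𝒰 h𝒰) (by rw [hzero _ h0, hzero 𝒰 h𝒰]) t ht hT]
    exact hu 𝒰 h𝒰 t hT
  exact tendsto_nhds_limUnder ⟨_, hlim⟩

theorem davieSolution_isDavieOn (hα : 1 / 3 < (α : ℝ)) (hα' : (α : ℝ) ≤ 1 / 2)
    (hc : CoeffBounds B G K) (X : RoughPath α V) (T : ℕ) :
    ∃ δ C M : ℝ, 0 < δ ∧ ∀ ξ : E,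
      IsDavieOn B G X T δ (C * (1 + ‖ξ‖)) (M * (1 + ‖ξ‖)) (davieSolution B G X ξ) := by
  obtain ⟨K', hX'⟩ := exists_pathBounds X T
  obtain ⟨δ, C, M, hδ, h⟩ := isDavieOn_of_tendsto_davieApprox hα hα' (hc.mono (le_max_left K K'))
    (hX'.mono (le_max_right K K'))
  exact ⟨δ, C, M, hδ, fun ξ => (h ξ).2 atTop _ inferInstance le_rfl
    fun t ht _ => tendsto_davieApprox hα hα' hc X ξ ht⟩

/-- For initial values near `ξ` the Davie constants are uniform. Limits along an ultrafilter
converging to `ξ` are therefore Davie solutions from `ξ`, and uniqueness identifies them. -/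
theorem continuous_davieSolution (hα : 1 / 3 < (α : ℝ)) (hα' : (α : ℝ) ≤ 1 / 2)
    (hc : CoeffBounds B G K) (X : RoughPath α V) {t : ℝ} (ht : 0 ≤ t) :
    Continuous (fun ξ => davieSolution B G X ξ t) := by
  obtain ⟨T, hT⟩ := exists_nat_ge t
  obtain ⟨δ, C, M, hδ, h⟩ := davieSolution_isDavieOn hα hα' hc X T
  refine continuous_iff_continuousAt.mpr fun ξ => ?_
  set R := |C| * (2 + ‖ξ‖)
  set M' := |M| * (2 + ‖ξ‖)
  have hev : ∀ᶠ ζ in 𝓝 ξ, IsDavieOn B G X T δ R M' (davieSolution B G X ζ) := by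
    filter_upwards [(continuous_norm.tendsto ξ).eventually_lt_const
      (show ‖ξ‖ < 1 + ‖ξ‖ by linarith)] with ζ hζ
    refine (h ζ).mono le_rfl ?_ ?_ <;>
    exact mul_le_mul (le_abs_self _) (by linarith) (by positivity) (abs_nonneg _)
  rw [ContinuousAt, tendsto_iff_ultrafilter]
  intro 𝒰 h𝒰
  have hev' : ∀ᶠ ζ in (𝒰 : Filter E), IsDavieOn B G X T δ R M' (davieSolution B G X ζ) := h𝒰 hev
  have hex (s : ℝ) (hs : 0 ≤ s ∧ s ≤ T) :
      ∃ y, Tendsto (fun ζ => davieSolution B G X ζ s) 𝒰 (𝓝 y) := by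
    obtain ⟨y, -, hy⟩ := (isCompact_closedBall (0 : E) R).ultrafilter_le_nhds
      (𝒰.map fun ζ => davieSolution B G X ζ s) (by
        rw [le_principal_iff]
        exact hev'.mono fun ζ hζ => by simpa using hζ.bdd s hs.1 hs.2)
    exact ⟨y, hy⟩
  choose! u hu using hex
  have hdav : IsDavieOn B G X T δ R M' u := IsDavieOn.of_tendsto hc (l := (𝒰 : Filter E))
    hev' fun s h1 h2 => hu s ⟨h1, h2⟩
  have hzero : u 0 = ξ := by
    refine tendsto_nhds_unique (hu 0 ⟨le_rfl, by positivity⟩) ?_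
    simp only [davieSolution_zero]
    exact h𝒰
  rw [(h ξ).eq hα hα' hc hδ hδ hdav (by rw [davieSolution_zero, hzero]) t ht hT]
  exact hu t ⟨ht, hT⟩

theorem davieSolution_add (hα : 1 / 3 < (α : ℝ)) (hα' : (α : ℝ) ≤ 1 / 2)
    (hc : CoeffBounds B G K) (X : RoughPath α V) (ξ : E) {t τ : ℝ} (ht : 0 ≤ t) (hτ : 0 ≤ τ) :
    davieSolution B G X ξ (t + τ)
      = davieSolution B G (X.shift τ) (davieSolution B G X ξ τ) t := by
  obtain ⟨T, hT⟩ := exists_nat_ge (t + τ)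
  obtain ⟨δ, C, M, hδ, h⟩ := davieSolution_isDavieOn hα hα' hc X T
  obtain ⟨δ', C', M', hδ', h'⟩ := davieSolution_isDavieOn hα hα' hc (X.shift τ) T
  -- The horizon is cut down to `t + τ`, so that the shifted path is a Davie solution on exactly
  -- `[0, t]`.
  have h1 : IsDavieOn B G X (t + τ) δ (C * (1 + ‖ξ‖)) (M * (1 + ‖ξ‖)) (davieSolution B G X ξ) :=
    ⟨fun s hs hst => (h ξ).bdd s hs (hst.trans hT), fun r s hr hrs hs =>
      (h ξ).error r s hr hrs (hs.trans hT)⟩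
  have h2 : IsDavieOn B G (X.shift τ) t δ' _ _
      (davieSolution B G (X.shift τ) (davieSolution B G X ξ τ)) :=
    ⟨fun s hs hst => (h' _).bdd s hs (by linarith), fun r s hr hrs hs =>
      (h' _).error r s hr hrs (by linarith)⟩
  exact (h1.shift hτ).eq hα hα' hc hδ hδ' h2 (by simp [davieSolution_zero]) t ht le_rfl

end Uniqueness

/-! ### The group generated by a bounded operator -/

section Semigroup

variable {E : Type*} [NormedAddCommGroup E] [InnerProductSpace ℝ E]

theorem semigroup_zero (A : E →L[ℝ] E) : semigroup A 0 = 1 := by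
  simp [semigroup, NormedSpace.exp_zero]

theorem hasDerivAt_semigroup [FiniteDimensional ℝ E] (A : E →L[ℝ] E) (t : ℝ) :
    HasDerivAt (semigroup A) (A * semigroup A t) t :=
  hasDerivAt_exp_smul_const' A t

theorem continuous_semigroup [FiniteDimensional ℝ E] (A : E →L[ℝ] E) : Continuous (semigroup A) :=
  continuous_iff_continuousAt.mpr fun t => (hasDerivAt_semigroup A t).continuousAt

theorem semigroup_add [FiniteDimensional ℝ E] (A : E →L[ℝ] E) (s t : ℝ) :
    semigroup A (s + t) = semigroup A s * semigroup A t := by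
  let _ : NormedAlgebra ℚ (E →L[ℝ] E) := NormedAlgebra.restrictScalars ℚ ℝ _
  rw [semigroup, semigroup, semigroup, add_smul, NormedSpace.exp_add_of_commute]
  exact ((Commute.refl A).smul_left s).smul_right t

theorem semigroup_sub_apply [FiniteDimensional ℝ E] (A : E →L[ℝ] E) (s u t : ℝ) (x : E) :
    semigroup A (t - s) x = semigroup A (t - u) (semigroup A (u - s) x) := by
  rw [← mul_apply_eq_comp, ← semigroup_add]; congr 2; ring

/-- `K` bounds the group `S(t) = e^{tA}` and its Taylor remainders on `[0, T]`. -/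
structure SemigroupBounds (A : E →L[ℝ] E) (T K : ℝ) : Prop where
  norm : ∀ r, 0 ≤ r → r ≤ T → ‖semigroup A r‖ ≤ K
  norm_sub_one : ∀ r, 0 ≤ r → r ≤ T → ‖semigroup A r - 1‖ ≤ K * r
  norm_sub_sub : ∀ r, 0 ≤ r → r ≤ T → ‖semigroup A r - 1 - r • A‖ ≤ K * r ^ 2

theorem SemigroupBounds.mono {A : E →L[ℝ] E} {T K K' : ℝ} (h : SemigroupBounds A T K)
    (hK : K ≤ K') : SemigroupBounds A T K' where
  norm r h0 hT := (h.norm r h0 hT).trans hK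
  norm_sub_one r h0 hT := (h.norm_sub_one r h0 hT).trans (by gcongr)
  norm_sub_sub r h0 hT := (h.norm_sub_sub r h0 hT).trans (by gcongr)

/-- Compactness bounds `S`; the mean value inequality with `S' = A S`, used twice, gives the two
Taylor bounds. -/
theorem exists_semigroupBounds [FiniteDimensional ℝ E] (A : E →L[ℝ] E) (T : ℝ) : ∃ K, SemigroupBounds A T K := by
  obtain ⟨K, hK⟩ := isCompact_Icc.exists_bound_of_continuousOn (s := Icc 0 T)
    (continuous_semigroup A).continuousOn
  have h1 (r : ℝ) (h0 : 0 ≤ r) (hr : r ≤ T) : ‖semigroup A r - 1‖ ≤ ‖A‖ * K * r := by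
    have := (convex_Icc (0 : ℝ) r).norm_image_sub_le_of_norm_hasDerivWithin_le (C := ‖A‖ * K)
      (fun x _ => (hasDerivAt_semigroup A x).hasDerivWithinAt)
      (fun x hx => (norm_mul_le _ _).trans (by gcongr; exact hK x ⟨hx.1, hx.2.trans hr⟩))
      (left_mem_Icc.mpr h0) (right_mem_Icc.mpr h0)
    rwa [semigroup_zero, sub_zero, Real.norm_of_nonneg h0] at this
  have h2 (r : ℝ) (h0 : 0 ≤ r) (hr : r ≤ T) :
      ‖semigroup A r - 1 - r • A‖ ≤ ‖A‖ * (‖A‖ * K) * r ^ 2 := by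
    have := (convex_Icc (0 : ℝ) r).norm_image_sub_le_of_norm_hasDerivWithin_le
      (f := fun x => semigroup A x - x • A) (C := ‖A‖ * (‖A‖ * K * r))
      (fun x _ => ((hasDerivAt_semigroup A x).sub
        ((hasDerivAt_id x).smul_const A)).hasDerivWithinAt)
      (fun x hx => by
        have hK0 : 0 ≤ K := (norm_nonneg _).trans (hK x ⟨hx.1, hx.2.trans hr⟩)
        rw [one_smul, show A * semigroup A x - A = A * (semigroup A x - 1) by rw [mul_sub, mul_one]]
        exact (norm_mul_le _ _).trans (by
          gcongr
          exact (h1 x hx.1 (hx.2.trans hr)).trans (by gcongr; exact hx.2)))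
      (left_mem_Icc.mpr h0) (right_mem_Icc.mpr h0)
    rw [semigroup_zero, sub_zero, Real.norm_of_nonneg h0, zero_smul, sub_zero] at this
    rw [sub_right_comm]
    exact this.trans (by ring_nf; rfl)
  refine ⟨max K (max (‖A‖ * K) (‖A‖ * (‖A‖ * K))), fun r h0 hr => (hK r ⟨h0, hr⟩).trans
    (le_max_left _ _), fun r h0 hr => (h1 r h0 hr).trans ?_, fun r h0 hr => (h2 r h0 hr).trans ?_⟩
  · gcongr
    exact (le_max_left _ _).trans (le_max_right _ _)
  · gcongr
    exact (le_max_right _ _).trans (le_max_right _ _)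

end Semigroup

/-! ### Riemann sums -/

section RiemannSums

open Filter Topology

variable {E : Type*} [NormedAddCommGroup E]

theorem IsPartition.mem_Icc {a b δ : ℝ} {n : ℕ} {p : ℕ → ℝ} (hp : IsPartition a b δ n p) {i : ℕ}
    (hi : i ≤ n) : p i ∈ Icc a b := by
  have hmono : MonotoneOn p (Iic n) := by
    refine monotoneOn_of_le_add_one ordConnected_Iic fun i _ _ hi' => hp.mono i ?_
    exact Nat.lt_of_succ_le hi'
  rw [← hp.left, ← hp.right]
  exact ⟨hmono (Nat.zero_le n) hi (Nat.zero_le i), hmono hi (le_refl n) hi⟩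

/-- Riemann sums of a germ that is close to an additive function converge. -/
theorem sum_partition_le {α : ℝ} (hα : 1 / 3 < α) {t C δ : ℝ} (hC : 0 ≤ C) (hδ : 0 < δ)
    {J : ℝ → E} {Ξ : ℝ → ℝ → E}
    (h : ∀ u v, 0 ≤ u → u ≤ v → v ≤ t → v - u ≤ δ →
      ‖J v - J u - Ξ u v‖ ≤ C * ((v - u) ^ α) ^ 3) {ε : ℝ} (hε : 0 < ε) :
    ∃ η > 0, ∀ (n : ℕ) (p : ℕ → ℝ), IsPartition 0 t η n p →
      ‖(∑ i ∈ Finset.range n, Ξ (p i) (p (i + 1))) - (J t - J 0)‖ < ε := by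
  have hβ : 0 < 3 * α - 1 := by linarith
  have hlim : Tendsto (fun x : ℝ => C * x ^ (3 * α - 1) * t) (𝓝[>] 0) (𝓝 0) := by
    have : Tendsto (fun x : ℝ => C * x ^ (3 * α - 1) * t) (𝓝 0)
        (𝓝 (C * 0 ^ (3 * α - 1) * t)) :=
      ((tendsto_id.rpow_const (Or.inr hβ.le)).const_mul C).mul_const t
    rw [Real.zero_rpow hβ.ne', mul_zero, zero_mul] at this
    exact this.mono_left nhdsWithin_le_nhds
  obtain ⟨η, hη, hη0, hηδ⟩ := ((hlim.eventually_lt_const hε).and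
    (Ioc_mem_nhdsGT hδ)).exists
  refine ⟨η, hη0, fun n p hp => lt_of_le_of_lt ?_ hη⟩
  have hsum : J t - J 0 = ∑ i ∈ Finset.range n, (J (p (i + 1)) - J (p i)) := by
    rw [Finset.sum_range_sub (fun i => J (p i)), hp.left, hp.right]
  have hlen : t = ∑ i ∈ Finset.range n, (p (i + 1) - p i) := by
    rw [Finset.sum_range_sub, hp.left, hp.right, sub_zero]
  rw [hsum, ← Finset.sum_sub_distrib]
  calc _ ≤ ∑ i ∈ Finset.range n, C * η ^ (3 * α - 1) * (p (i + 1) - p i) := by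
        refine norm_sum_le_of_le _ fun i hi => ?_
        have hi' : i < n := Finset.mem_range.mp hi
        have h1 := hp.mono i hi'
        have h2 := hp.mesh i hi'
        rw [norm_sub_rev]
        refine (h _ _ (hp.mem_Icc hi'.le).1 h1 (hp.mem_Icc hi').2 (by linarith)).trans ?_
        rw [mul_assoc]
        refine mul_le_mul_of_nonneg_left ?_ hC
        -- Partitions may contain empty intervals, which contribute zero; on the others `(v -
        -- u)^{3α}` splits off the factor `(v - u)^{3α - 1} ≤ η^{3α - 1}`.
        rcases h1.eq_or_lt with h3 | h3
        · simp [h3, Real.zero_rpow (show α ≠ 0 by linarith)]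
        have h4 : 0 < p (i + 1) - p i := by linarith
        calc ((p (i + 1) - p i) ^ α) ^ 3
            = (p (i + 1) - p i) ^ (3 * α - 1) * (p (i + 1) - p i) := by
              rw [← Real.rpow_natCast, ← Real.rpow_mul h4.le]
              nth_rewrite 3 [← Real.rpow_one (p (i + 1) - p i)]
              rw [← Real.rpow_add h4]
              congr 1; push_cast; ring
          _ ≤ _ := by gcongr
    _ = C * η ^ (3 * α - 1) * t := by rw [← Finset.mul_sum, ← hlen]

end RiemannSums

/-! ### Mild solutions and Davie solutions -/

section Mild

open Filter Topology

variable {α : ℝ≥0} {V : Type*} [NormedAddCommGroup V] [InnerProductSpace ℝ V]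
  [FiniteDimensional ℝ V]
variable {E : Type*} [NormedAddCommGroup E] [InnerProductSpace ℝ E]
variable {A : E →L[ℝ] E} {F : E → E} {G : E → V →L[ℝ] E} {X : RoughPath α V} {T K : ℝ} {U : ℝ → E}

/-- Brings the compensated Riemann summand of the convolution to the form in which the group acts on
a Davie-type increment; linearity in `z` reduces it to pure tensors. -/
theorem mild_germ (S : E →L[ℝ] E) (G : E → V →L[ℝ] E) (x : E) (w : V) (z : V ⊗[ℝ] V) :
    (S.comp (G x)) w + tensorApply (postcomp S ((fderiv ℝ G x).comp (G x))) z
      = S (G x w + areaCoeff G x z) := by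
  rw [map_add, areaCoeff_apply]
  congr 1
  induction z using TensorProduct.induction_on with
  | zero => simp
  | tmul v w => simp [tensorApply_tmul, postcomp]
  | add x y hx hy => simp only [map_add, hx, hy]

/-- The increment of the driving signal in the Davie scheme. -/
def roughIncrement (G : E → V →L[ℝ] E) (X : RoughPath α V) (s t : ℝ) (x : E) : E :=
  G x (X.path t - X.path s) + areaCoeff G x (X.area s t)

theorem hasRoughIntegral_mild_iff {t : ℝ} {a b : ℝ} {I : E} :
    HasRoughIntegral X (fun r => (semigroup A (t - r)).comp (G (U r)))
      (fun r => postcomp (semigroup A (t - r)) (compDeriv G U (fun q => G (U q)) r)) a b I ↔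
    ∀ ε > 0, ∃ δ > 0, ∀ (n : ℕ) (p : ℕ → ℝ), IsPartition a b δ n p →
      ‖(∑ i ∈ Finset.range n, semigroup A (t - p i) (roughIncrement G X (p i) (p (i + 1)) (U (p i))))
        - I‖ < ε := by
  simp only [HasRoughIntegral, compDeriv, mild_germ, roughIncrement]

/-- The local error in the mild formulation. -/
def mildDefect (A : E →L[ℝ] E) (F : E → E) (G : E → V →L[ℝ] E) (X : RoughPath α V) (U : ℝ → E)
    (s t : ℝ) : E :=
  U t - semigroup A (t - s) (U s) - (∫ r in s..t, semigroup A (t - r) (F (U r)))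
    - semigroup A (t - s) (roughIncrement G X s t (U s))

theorem norm_roughIncrement_le {B : E → E} (hc : CoeffBounds B G K) (hX : PathBounds X T K)
    {s t : ℝ} (hs : 0 ≤ s) (hst : s ≤ t) (ht : t ≤ T) (h1 : t - s ≤ 1) (x : E) :
    ‖roughIncrement G X s t x‖ ≤ 2 * K ^ 2 * (t - s) ^ (α : ℝ) := by
  have hK : 0 ≤ K := by linarith [hc.one_le]
  have he0 : 0 ≤ (t - s) ^ (α : ℝ) := Real.rpow_nonneg (by linarith) _
  have he1 : (t - s) ^ (α : ℝ) ≤ 1 := Real.rpow_le_one (by linarith) h1 α.2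
  have hP := hX.path s t hs hst ht
  have hA := hX.area s t hs hst ht
  set e := (t - s) ^ (α : ℝ)
  have he3 : e ^ 2 ≤ e := by nlinarith
  calc _ ≤ K * (K * e) + K * (K * e) := by
        refine norm_add_le_of_le ((ContinuousLinearMap.le_opNorm _ _).trans ?_)
          ((ContinuousLinearMap.le_opNorm _ _).trans ?_)
        · gcongr
          exact hc.norm x
        · gcongr
          · exact hc.area x
          · exact hA.trans (by gcongr)
    _ = _ := by ring

/-- With `h = t - s ≤ e²`, replacing `S(h)` by `1 + hA` in front of `U s` costs `h² ≤ e⁴`, replacing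
it by `1` in front of the rough increment costs `h · e ≤ e³`, and freezing the integrand of the
drift costs `e · h ≤ e³`. -/
theorem norm_mildDefect_sub_le [FiniteDimensional ℝ E] (hα' : (α : ℝ) ≤ 1 / 2)
    (hc : CoeffBounds (fun x => A x + F x) G K) (hX : PathBounds X T K)
    (hS : SemigroupBounds A T K) (hF : ∀ x y, ‖F y - F x‖ ≤ K * ‖y - x‖) {s t : ℝ} (hs : 0 ≤ s)
    (hst : s ≤ t) (ht : t ≤ T) (h1 : t - s ≤ 1) (hcont : ContinuousOn U (Icc s t))
    (hU : ‖U s‖ ≤ K) (hFU : ∀ r ∈ Icc s t, ‖F (U r)‖ ≤ K)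
    (hH : ∀ r ∈ Icc s t, ‖U r - U s‖ ≤ K * (t - s) ^ (α : ℝ)) :
    ‖mildDefect A F G X U s t
      - (U t - U s - davieIncrement (fun x => A x + F x) G X s t (U s))‖
      ≤ 5 * K ^ 3 * ((t - s) ^ (α : ℝ)) ^ 3 := by
  have hK1 := hc.one_le
  have hK : 0 ≤ K := by linarith
  have he0 : 0 ≤ (t - s) ^ (α : ℝ) := Real.rpow_nonneg (by linarith) _
  have he1 : (t - s) ^ (α : ℝ) ≤ 1 := Real.rpow_le_one (by linarith) h1 α.2
  have he2 := le_rpow_sq hα' (by linarith) h1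
  have hR := norm_roughIncrement_le hc hX hs hst ht h1 (U s)
  set e := (t - s) ^ (α : ℝ)
  have hcF : Continuous F := continuous_of_norm_sub_le hF
  have hint : ContinuousOn (fun r => semigroup A (t - r) (F (U r))) (Icc s t) :=
    ((continuous_semigroup A).comp (continuous_const.sub continuous_id)).continuousOn.clm_apply
      (hcF.comp_continuousOn hcont)
  have hI := norm_smul_sub_integral_le (c := F (U s)) (C := 2 * K ^ 2 * e) hst hint fun r hr => by
    have h2 : semigroup A (t - r) (F (U r)) - F (U s)
        = (semigroup A (t - r) - 1) (F (U r)) + (F (U r) - F (U s)) := by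
      simp only [sub_apply, one_apply_eq_self]; abel
    rw [h2]
    calc _ ≤ (K * e) * K + K * (K * e) := by
          refine norm_add_le_of_le ((ContinuousLinearMap.le_opNorm _ _).trans ?_)
            ((hF _ _).trans (by gcongr; exact hH r hr))
          gcongr
          · refine (hS.norm_sub_one _ (by linarith [hr.2]) (by linarith [hr.1])).trans ?_
            gcongr
            nlinarith [hr.1]
          · exact hFU r hr
      _ = _ := by ring
  have heq : mildDefect A F G X U s t
      - (U t - U s - davieIncrement (fun x => A x + F x) G X s t (U s))
      = -((semigroup A (t - s) - 1 - (t - s) • A) (U s)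
        + ((∫ r in s..t, semigroup A (t - r) (F (U r))) - (t - s) • F (U s))
        + (semigroup A (t - s) - 1) (roughIncrement G X s t (U s))) := by
    simp only [mildDefect, davieIncrement, roughIncrement, sub_apply, smul_add,
      one_apply_eq_self, smul_apply]
    abel
  rw [heq, norm_neg]
  calc _ ≤ (K * (e ^ 2) ^ 2) * K + (2 * K ^ 2 * e) * e ^ 2 + (K * e ^ 2) * (2 * K ^ 2 * e) := by
        refine norm_add₃_le.trans (add_le_add_three
          ((ContinuousLinearMap.le_opNorm _ _).trans ?_) (hI.trans (by gcongr))
          ((ContinuousLinearMap.le_opNorm _ _).trans ?_))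
        · gcongr
          exact (hS.norm_sub_sub _ (by linarith) (by linarith)).trans
            (by gcongr)
        · gcongr
          exact (hS.norm_sub_one _ (by linarith) (by linarith)).trans (by gcongr)
    _ = (K ^ 2 * e + 2 * K ^ 2 + 2 * K ^ 3) * e ^ 3 := by ring
    _ ≤ (K ^ 3 * 1 + 2 * K ^ 3 + 2 * K ^ 3) * e ^ 3 := by
        gcongr <;> norm_num
    _ = _ := by ring

/-- The local mild errors are the errors of an additive function. -/
theorem semigroup_mildDefect [FiniteDimensional ℝ E] {u v t : ℝ}
    (hcont : ContinuousOn (fun r => F (U r)) (Icc 0 t)) (hu : 0 ≤ u) (huv : u ≤ v) (hvt : v ≤ t) :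
    (semigroup A (t - v) (U v) - ∫ r in (0 : ℝ)..v, semigroup A (t - r) (F (U r)))
      - (semigroup A (t - u) (U u) - ∫ r in (0 : ℝ)..u, semigroup A (t - r) (F (U r)))
      - semigroup A (t - u) (roughIncrement G X u v (U u))
      = semigroup A (t - v) (mildDefect A F G X U u v) := by
  have hint (τ : ℝ) {a b : ℝ} (ha : 0 ≤ a) (hab : a ≤ b) (hb : b ≤ t) :
      IntervalIntegrable (fun r => semigroup A (τ - r) (F (U r))) volume a b :=
    (((continuous_semigroup A).comp (continuous_const.sub continuous_id)).continuousOn.clm_apply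
      (hcont.mono (Icc_subset_Icc ha hb))).intervalIntegrable_of_Icc hab
  have h1 : semigroup A (t - v) (∫ r in u..v, semigroup A (v - r) (F (U r)))
      = ∫ r in u..v, semigroup A (t - r) (F (U r)) := by
    rw [← ContinuousLinearMap.intervalIntegral_comp_comm _ (hint v hu huv hvt)]
    exact intervalIntegral.integral_congr fun r _ => (semigroup_sub_apply A r v t _).symm
  rw [mildDefect, map_sub, map_sub, map_sub, h1, ← semigroup_sub_apply, ← semigroup_sub_apply,
    ← intervalIntegral.integral_add_adjacent_intervals (hint t le_rfl hu (huv.trans hvt))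
      (hint t hu huv hvt)]
  abel

end Mild

/-! ### Initial value and Hölder bounds read off the definition of a solution. -/

section MildSolutions

variable {α : ℝ≥0} {V : Type*} [NormedAddCommGroup V] [InnerProductSpace ℝ V]
variable {E : Type*} [NormedAddCommGroup E] [InnerProductSpace ℝ E]
variable {A : E →L[ℝ] E} {F : E → E} {G : E → V →L[ℝ] E} {X : RoughPath α V} {T : ℝ} {U : ℝ → E}
  {ξ : E}

theorem IsMildSolution.initial (hU : IsMildSolution A F G X ξ U) :
    U 0 = ξ := by
  obtain ⟨I, hI, h⟩ := hU.mild 0 le_rfl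
  have hI0 : I = 0 := by
    rw [← norm_le_zero_iff]
    refine le_of_forall_pos_lt_add fun ε hε => ?_
    obtain ⟨δ, -, hδ⟩ := hI ε hε
    -- The partition of `[0, 0]` with no intervals has an empty Riemann sum, which forces `I = 0`.
    have := hδ 0 (fun _ => 0) ⟨rfl, rfl, fun i hi => absurd hi (Nat.not_lt_zero i),
      fun i hi => absurd hi (Nat.not_lt_zero i)⟩
    simpa using this
  simpa [hI0, semigroup_zero] using h

theorem IsControlledOn.holderBounds {Y : ℝ → E}
    (h : IsControlledOn α X.path Y (fun r => G (Y r)) (Icc 0 T)) :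
    ∃ K, HolderBounds G X 0 T 1 K Y := by
  obtain ⟨C, hC⟩ := h.holder
  obtain ⟨D, hD⟩ := h.holder_remainder
  refine ⟨max C D, fun s t hs hst ht _ => ?_, fun s t hs hst ht _ => ?_⟩
  · have h1 := hC.dist_le (x := t) (y := s) ⟨hs.trans hst, ht⟩ ⟨hs, hst.trans ht⟩
    rw [dist_eq_norm, Real.dist_eq, abs_of_nonneg (by linarith)] at h1
    exact h1.trans (mul_le_mul_of_nonneg_right (le_max_left _ _)
      (Real.rpow_nonneg (by linarith) _))
  · have h1 := hD s ⟨hs, hst.trans ht⟩ t ⟨hs.trans hst, ht⟩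
    rw [abs_of_nonneg (by linarith), mul_comm 2, Real.rpow_mul (by linarith), Real.rpow_two] at h1
    exact h1.trans (mul_le_mul_of_nonneg_right (le_max_right _ _) (by positivity))

end MildSolutions

/-! ### Equivalence of the mild and Davie formulations. -/

section MildEquivalence

open Filter Topology

variable {α : ℝ≥0} {V : Type*} [NormedAddCommGroup V] [InnerProductSpace ℝ V]
  [FiniteDimensional ℝ V]
variable {E : Type*} [NormedAddCommGroup E] [InnerProductSpace ℝ E]
variable {A : E →L[ℝ] E} {F : E → E} {G : E → V →L[ℝ] E} {X : RoughPath α V} {T δ K : ℝ}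
  {U : ℝ → E} {ξ : E}

/-- `K` bounds the coefficients, the driving path, the group and the path `U` on `[0, T]`. -/
structure MildBounds (A : E →L[ℝ] E) (F : E → E) (G : E → V →L[ℝ] E) (X : RoughPath α V)
    (T δ K : ℝ) (U : ℝ → E) : Prop where
  coeff : CoeffBounds (fun x => A x + F x) G K
  path : PathBounds X T K
  group : SemigroupBounds A T K
  drift : ∀ x y, ‖F y - F x‖ ≤ K * ‖y - x‖
  bdd : ∀ r ∈ Icc 0 T, ‖U r‖ ≤ K
  drift_bdd : ∀ r ∈ Icc 0 T, ‖F (U r)‖ ≤ K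
  holder : HolderBounds G X 0 T δ K U

theorem exists_mildBounds [FiniteDimensional ℝ E] (hc : CoeffBounds (fun x => A x + F x) G K) {L : ℝ≥0}
    (hF : LipschitzWith L F) {R K' : ℝ} (hR : ∀ r ∈ Icc 0 T, ‖U r‖ ≤ R)
    (hU : HolderBounds G X 0 T δ K' U) :
    ∃ M, MildBounds A F G X T δ M U := by
  obtain ⟨c₁, h1⟩ := exists_pathBounds X T
  obtain ⟨c₂, h2⟩ := exists_semigroupBounds A T
  obtain ⟨M, hM⟩ : ∃ M : ℝ, ∀ c ∈ ({K, c₁, c₂, (L : ℝ), R, ‖F 0‖ + L * R, K'} : Set ℝ), c ≤ M :=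
    (Set.toFinite _).bddAbove
  simp only [mem_insert_iff, mem_singleton_iff, forall_eq_or_imp, forall_eq] at hM
  obtain ⟨m1, m2, m3, m4, m5, m6, m7⟩ := hM
  have hLF (x y : E) : ‖F y - F x‖ ≤ L * ‖y - x‖ := by
    simpa only [dist_eq_norm] using hF.dist_le_mul y x
  refine ⟨M, hc.mono m1, h1.mono m2, h2.mono m3, fun x y => (hLF x y).trans (by gcongr),
    fun r hr => (hR r hr).trans m5, fun r hr => le_trans ?_ m6, ?_, ?_⟩
  · have := hLF 0 (U r)
    rw [sub_zero] at this
    calc ‖F (U r)‖ ≤ ‖F 0‖ + ‖F (U r) - F 0‖ := norm_le_norm_add_norm_sub' _ _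
      _ ≤ ‖F 0‖ + L * R := by gcongr; exact this.trans (by gcongr; exact hR r hr)
  · exact fun s t hs hst ht hts => (hU.holder s t hs hst ht hts).trans
      (mul_le_mul_of_nonneg_right m7 (Real.rpow_nonneg (by linarith) _))
  · exact fun s t hs hst ht hts => (hU.remainder s t hs hst ht hts).trans (by gcongr)

theorem MildBounds.continuousOn (h : MildBounds A F G X T δ K U) (hα : 0 < (α : ℝ)) (hδ : 0 < δ) :
    ContinuousOn U (Icc 0 T) :=
  continuousOn_of_local_holder hα hδ h.holder.holder

theorem MildBounds.norm_mildDefect_sub_le [FiniteDimensional ℝ E] (h : MildBounds A F G X T δ K U)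
    (hα : 0 < (α : ℝ)) (hα' : (α : ℝ) ≤ 1 / 2) (hδ0 : 0 < δ) (hδ : δ ≤ 1) {s t : ℝ} (hs : 0 ≤ s)
    (hst : s ≤ t) (ht : t ≤ T) (hts : t - s ≤ δ) :
    ‖mildDefect A F G X U s t
      - (U t - U s - davieIncrement (fun x => A x + F x) G X s t (U s))‖
      ≤ 5 * K ^ 3 * ((t - s) ^ (α : ℝ)) ^ 3 := by
  have hK : 0 ≤ K := by linarith [h.coeff.one_le]
  refine _root_.norm_mildDefect_sub_le hα' h.coeff h.path h.group h.drift hs hst ht (hts.trans hδ)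
    ((h.continuousOn hα hδ0).mono (Icc_subset_Icc hs ht)) (h.bdd s ⟨hs, hst.trans ht⟩)
    (fun r hr => h.drift_bdd r ⟨hs.trans hr.1, hr.2.trans ht⟩) fun r hr => ?_
  refine (h.holder.holder s r hs hr.1 (hr.2.trans ht) (by linarith [hr.2])).trans ?_
  gcongr
  · linarith [hr.1]
  · exact hr.2

/-! ### Davie solutions are mild solutions -/

/-- At distances beyond `δ` the uniform bound `D` is itself a Hölder bound, with constant `D / δ ^
β`. -/
theorem exists_global_holder_bound {E : Type*} [NormedAddCommGroup E] {f : ℝ → ℝ → E}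
    {β C D δ : ℝ} {s : Set ℝ} (hβ : 0 ≤ β)
    (hδ : 0 < δ) (h1 : ∀ u ∈ s, ∀ v ∈ s, |v - u| ≤ δ → ‖f u v‖ ≤ C * |v - u| ^ β)
    (h2 : ∀ u ∈ s, ∀ v ∈ s, ‖f u v‖ ≤ D) :
    ∃ C' : ℝ, 0 ≤ C' ∧ ∀ u ∈ s, ∀ v ∈ s, ‖f u v‖ ≤ C' * |v - u| ^ β := by
  refine ⟨max (max C 0) (D / δ ^ β), (le_max_right C 0).trans (le_max_left _ _),
    fun u hu v hv => ?_⟩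
  rcases le_total (|v - u|) δ with h | h
  · refine (h1 u hu v hv h).trans ?_
    gcongr
    exact (le_max_left _ _).trans (le_max_left _ _)
  · have hD : 0 ≤ D := (norm_nonneg _).trans (h2 u hu v hv)
    calc ‖f u v‖ ≤ D / δ ^ β * δ ^ β := by
          rw [div_mul_cancel₀ _ (Real.rpow_pos_of_pos hδ _).ne']; exact h2 u hu v hv
      _ ≤ _ := by
          gcongr
          exact le_max_right _ _

theorem isHolderOn_of_norm_le {E : Type*} [NormedAddCommGroup E] {f : ℝ → E} {C : ℝ} {s : Set ℝ}
    (hC : 0 ≤ C) (h : ∀ u ∈ s, ∀ v ∈ s, ‖f v - f u‖ ≤ C * |v - u| ^ (α : ℝ)) :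
    IsHolderOn α f s := by
  refine ⟨C.toNNReal, fun u hu v hv => ?_⟩
  rw [edist_dist, edist_dist, ENNReal.ofReal_rpow_of_nonneg dist_nonneg α.coe_nonneg,
    ← ENNReal.ofReal_coe_nnreal, Real.coe_toNNReal _ hC, ← ENNReal.ofReal_mul hC, dist_eq_norm,
    Real.dist_eq]
  exact ENNReal.ofReal_le_ofReal (h v hv u hu)

theorem MildBounds.isControlledOn (h : MildBounds A F G X T δ K U) (hδ : 0 < δ) :
    IsControlledOn α X.path U (fun r => G (U r)) (Icc 0 T) := by
  have hK1 := h.coeff.one_le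
  have hK : 0 ≤ K := by linarith
  have hpath : ∀ u ∈ Icc 0 T, ∀ v ∈ Icc 0 T,
      ‖X.path v - X.path u‖ ≤ K * |v - u| ^ (α : ℝ) := by
    intro u hu v hv
    rcases le_total u v with huv | huv
    · rw [abs_of_nonneg (by linarith)]
      exact h.path.path u v hu.1 huv hv.2
    · rw [abs_of_nonpos (by linarith), neg_sub, norm_sub_rev]
      exact h.path.path v u hv.1 huv hu.2
  have hloc : ∀ u ∈ Icc 0 T, ∀ v ∈ Icc 0 T, |v - u| ≤ δ →
      ‖U v - U u‖ ≤ K * |v - u| ^ (α : ℝ) := by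
    intro u hu v hv huvδ
    rcases le_total u v with huv | huv
    · rw [abs_of_nonneg (by linarith)] at huvδ ⊢
      exact h.holder.holder u v hu.1 huv hv.2 huvδ
    · rw [abs_of_nonpos (by linarith), neg_sub] at huvδ ⊢
      rw [norm_sub_rev]
      exact h.holder.holder v u hv.1 huv hu.2 huvδ
  have hbdd : ∀ u ∈ Icc 0 T, ∀ v ∈ Icc 0 T, ‖U v - U u‖ ≤ K + K := fun u hu v hv =>
    norm_sub_le_of_le (h.bdd v hv) (h.bdd u hu)
  obtain ⟨C, hC, hhol⟩ := exists_global_holder_bound (f := fun u v => U v - U u) α.2 hδ hloc hbdd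
  have hGU (u v : ℝ) : ‖G (U v) - G (U u)‖ ≤ K * ‖U v - U u‖ := h.coeff.norm_sub _ _
  refine ⟨isHolderOn_of_norm_le hC hhol, isHolderOn_of_norm_le (C := K * C) (by positivity)
    fun u hu v hv => ?_, ?_⟩
  · rw [mul_assoc]
    exact (hGU u v).trans (by gcongr; exact hhol u hu v hv)
  · have hrem : ∀ u ∈ Icc 0 T, ∀ v ∈ Icc 0 T, |v - u| ≤ δ →
        ‖U v - U u - G (U u) (X.path v - X.path u)‖ ≤ (K + K ^ 3) * |v - u| ^ (2 * (α : ℝ)) := by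
      intro u hu v hv huvδ
      rw [mul_comm 2, Real.rpow_mul (abs_nonneg _), Real.rpow_two]
      rcases le_total u v with huv | huv
      · rw [abs_of_nonneg (by linarith)] at huvδ ⊢
        exact (h.holder.remainder u v hu.1 huv hv.2 huvδ).trans
          (by gcongr; linarith [pow_nonneg hK 3])
      -- The definition of a controlled path also covers `v ≤ u`. Moving the base point from `v` to
      -- `u` costs `(G(U v) - G(U u))` applied to the path increment, again of order `2α`.
      · have h1 := hloc u hu v hv huvδ
        have h2 := hpath u hu v hv
        rw [abs_of_nonpos (by linarith), neg_sub] at huvδ h1 h2 ⊢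
        have h3 := h.holder.remainder v u hv.1 huv hu.2 huvδ
        have he : 0 ≤ (u - v) ^ (α : ℝ) := Real.rpow_nonneg (by linarith) _
        set e := (u - v) ^ (α : ℝ)
        have heq : U v - U u - G (U u) (X.path v - X.path u)
            = -(U u - U v - G (U v) (X.path u - X.path v))
              + (G (U v) - G (U u)) (X.path v - X.path u) := by
          simp only [map_sub, sub_apply]; abel
        rw [heq]
        calc _ ≤ K * e ^ 2 + (K * (K * e)) * (K * e) := by
              refine norm_add_le_of_le (by rwa [norm_neg])
                ((ContinuousLinearMap.le_opNorm _ _).trans ?_)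
              gcongr
              exact (hGU u v).trans (by gcongr)
          _ = _ := by ring
    obtain ⟨C', -, hC'⟩ := exists_global_holder_bound
      (f := fun u v => U v - U u - G (U u) (X.path v - X.path u)) (D := (K + K) + K * (K * T ^ (α : ℝ)))
      (mul_nonneg zero_le_two α.2) hδ hrem fun u hu v hv => by
        refine norm_sub_le_of_le (hbdd u hu v hv) ((ContinuousLinearMap.le_opNorm _ _).trans ?_)
        gcongr
        · exact h.coeff.norm _
        · refine (hpath u hu v hv).trans ?_
          gcongr
          exact abs_le.mpr ⟨by linarith [hu.2, hv.1], by linarith [hu.1, hv.2]⟩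
    exact ⟨C', hC'⟩

/-- The path `J u = S(t-u) U_u - ∫_0^u S(t-r) F(U_r) dr` has increments equal to the germ of the
rough convolution up to third order. The Riemann sums therefore converge to `J t - J 0`, which is
the value demanded by the mild equation; existence of the rough integral comes out at the same time.
-/
theorem isMildSolution_of_isDavieOn [FiniteDimensional ℝ E] (hα : 1 / 3 < (α : ℝ)) (hα' : (α : ℝ) ≤ 1 / 2)
    (hc : CoeffBounds (fun x => A x + F x) G K) {L : ℝ≥0} (hF : LipschitzWith L F)
    (hU : ∀ T : ℝ, ∃ δ R M, 0 < δ ∧ IsDavieOn (fun x => A x + F x) G X T δ R M U)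
    (h0 : U 0 = ξ) : IsMildSolution A F G X ξ U := by
  have hα0 : 0 < (α : ℝ) := by linarith
  have hbounds (T : ℝ) (hT : 0 ≤ T) : ∃ δ K M : ℝ, 0 < δ ∧ δ ≤ 1 ∧ MildBounds A F G X T δ K U ∧
      0 ≤ M ∧ ∀ u v, 0 ≤ u → u ≤ v → v ≤ T → v - u ≤ δ →
        ‖U v - U u - davieIncrement (fun x => A x + F x) G X u v (U u)‖
          ≤ M * ((v - u) ^ (α : ℝ)) ^ 3 := by
    obtain ⟨δ, R, M, hδ, hD⟩ := hU T
    obtain ⟨K', hX⟩ := exists_pathBounds X T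
    have hR : 0 ≤ R := (norm_nonneg _).trans (hD.bdd 0 le_rfl hT)
    have hD' : IsDavieOn (fun x => A x + F x) G X T (min δ 1) R (max M 0) U :=
      hD.mono (min_le_left _ _) le_rfl (le_max_left _ _)
    obtain ⟨K₁, hK₁⟩ := exists_mildBounds hc hF (fun r hr => hD.bdd r hr.1 hr.2)
      (hD'.holderBounds hα' (hc.mono (le_max_left K K')) (hX.mono (le_max_right K K')) hR
        (le_max_right _ _) (min_le_right _ _))
    exact ⟨_, K₁, max M 0, lt_min hδ one_pos, min_le_right _ _, hK₁, le_max_right _ _, hD'.error⟩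
  refine ⟨fun T hT => ?_, fun t ht => ?_⟩
  · obtain ⟨δ, K, M, hδ, -, h, -⟩ := hbounds T hT.le
    exact h.isControlledOn hδ
  · obtain ⟨δ, K, M, hδ, hδ1, h, hM, herr⟩ := hbounds t ht
    have hK : 0 ≤ K := by linarith [h.coeff.one_le]
    have hcont : ContinuousOn (fun r => F (U r)) (Icc 0 t) :=
      (continuous_of_norm_sub_le h.drift).comp_continuousOn (h.continuousOn hα0 hδ)
    set J : ℝ → E := fun u => semigroup A (t - u) (U u)
      - ∫ r in (0 : ℝ)..u, semigroup A (t - r) (F (U r)) with hJ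
    refine ⟨J t - J 0, hasRoughIntegral_mild_iff.mpr fun ε hε => ?_, ?_⟩
    · refine sum_partition_le (J := J)
        (Ξ := fun u v => semigroup A (t - u) (roughIncrement G X u v (U u))) hα
        (C := K * (5 * K ^ 3 + M)) (by positivity) hδ (fun u v hu huv hv huvδ => ?_) hε
      rw [hJ]
      simp only
      rw [semigroup_mildDefect hcont hu huv hv, mul_assoc]
      refine (ContinuousLinearMap.le_opNorm _ _).trans ?_
      gcongr
      · exact h.group.norm _ (by linarith) (by linarith)
      · have h1 := h.norm_mildDefect_sub_le hα0 hα' hδ hδ1 hu huv hv huvδ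
        have h2 := herr u v hu huv hv huvδ
        rw [add_mul]
        refine le_trans (le_of_eq ?_) (norm_add_le_of_le h1 h2)
        rw [sub_add_cancel]
    · simp only [hJ, sub_self, semigroup_zero, sub_zero, intervalIntegral.integral_same, h0,
        one_apply_eq_self]
      abel

/-! ### Mild solutions are Davie solutions -/

theorem roughIncrement_self (G : E → V →L[ℝ] E) (X : RoughPath α V) (s : ℝ) (x : E) :
    roughIncrement G X s s x = 0 := by
  simp [roughIncrement, X.area_self]

/-- After `S(t-u)` is factored out, the Davie cancellation leaves a Taylor remainder and area terms
of third order; the change of the group from `t - s` to `t - u` adds `S(u-s) - 1 = O(e²)` times a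
first-order quantity. -/
theorem MildBounds.norm_germ_defect_le [FiniteDimensional ℝ E] (h : MildBounds A F G X T 1 K U)
    (hα' : (α : ℝ) ≤ 1 / 2) {s u v t : ℝ} (hs : 0 ≤ s) (hsu : s ≤ u) (huv : u ≤ v) (hvt : v ≤ t)
    (ht : t ≤ T) (hvs : v - s ≤ 1) :
    ‖semigroup A (t - s) (roughIncrement G X s u (U s))
      + semigroup A (t - u) (roughIncrement G X u v (U u))
      - semigroup A (t - s) (roughIncrement G X s v (U s))‖
      ≤ 6 * K ^ 6 * ((v - s) ^ (α : ℝ)) ^ 3 := by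
  have hK1 := h.coeff.one_le
  have hK : 0 ≤ K := by linarith
  have he0 : 0 ≤ (v - s) ^ (α : ℝ) := Real.rpow_nonneg (by linarith) _
  have he1 : (v - s) ^ (α : ℝ) ≤ 1 := Real.rpow_le_one (by linarith) hvs α.2
  have he2 := le_rpow_sq hα' (by linarith) hvs
  have hsue : (u - s) ^ (α : ℝ) ≤ (v - s) ^ (α : ℝ) :=
    Real.rpow_le_rpow (by linarith) (by linarith) α.2
  have huve : (v - u) ^ (α : ℝ) ≤ (v - s) ^ (α : ℝ) :=
    Real.rpow_le_rpow (by linarith) (by linarith) α.2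
  have hsu0 : 0 ≤ (u - s) ^ (α : ℝ) := Real.rpow_nonneg (by linarith) _
  have huv0 : 0 ≤ (v - u) ^ (α : ℝ) := Real.rpow_nonneg (by linarith) _
  have hU1 := h.holder.holder s u hs hsu (by linarith) (by linarith)
  have hU2 := h.holder.remainder s u hs hsu (by linarith) (by linarith)
  have hP1 := h.path.path s u hs hsu (by linarith)
  have hP2 := h.path.path u v (by linarith) huv (by linarith)
  have hA2 := h.path.area u v (by linarith) huv (by linarith)
  have hS1 := h.group.norm (t - u) (by linarith) (by linarith)
  have hS2 := h.group.norm_sub_one (u - s) (by linarith) (by linarith)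
  set e := (v - s) ^ (α : ℝ)
  set w := X.path u - X.path s with hw
  set w' := X.path v - X.path u with hw'
  set z := X.area u v with hz
  set x := U s
  set y := U u
  have heq : semigroup A (t - s) (roughIncrement G X s u x)
      + semigroup A (t - u) (roughIncrement G X u v y)
      - semigroup A (t - s) (roughIncrement G X s v x)
      = semigroup A (t - u) ((taylorRemainder G x y + fderiv ℝ G x (y - x - G x w)) w'
        + (areaCoeff G y - areaCoeff G x) z
        - (semigroup A (u - s) - 1) (G x w' + areaCoeff G x z + fderiv ℝ G x (G x w) w')) := by
    rw [semigroup_sub_apply A s u t, semigroup_sub_apply A s u t, ← map_add, ← map_sub]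
    congr 1
    rw [roughIncrement, roughIncrement, roughIncrement, areaCoeff_chen G X s u v,
      show X.path v - X.path s = w + w' by rw [hw, hw']; abel, ← hw, ← hw', ← hz, taylorRemainder]
    simp only [map_add, map_sub, sub_apply, add_apply, one_apply_eq_self]
    abel
  have hw1 : ‖w‖ ≤ K * e := hP1.trans (by gcongr)
  have hw1' : ‖w'‖ ≤ K * e := hP2.trans (by gcongr)
  have hz1 : ‖z‖ ≤ K * e ^ 2 := hA2.trans (by gcongr)
  have hyx : ‖y - x‖ ≤ K * e := hU1.trans (by gcongr)
  have hyx2 : ‖y - x - G x w‖ ≤ K * e ^ 2 := hU2.trans (by gcongr)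
  have hTay : ‖taylorRemainder G x y + fderiv ℝ G x (y - x - G x w)‖
      ≤ K * (K * e) ^ 2 + K * (K * e ^ 2) := by
    refine norm_add_le_of_le ((h.coeff.taylor x y).trans (by gcongr))
      ((ContinuousLinearMap.le_opNorm _ _).trans ?_)
    gcongr
    exact h.coeff.deriv x
  have hArea : ‖areaCoeff G y - areaCoeff G x‖ ≤ K * (K * e) :=
    (h.coeff.area_sub x y).trans (by gcongr)
  have hP : ‖semigroup A (u - s) - 1‖ ≤ K * e ^ 2 := hS2.trans (by gcongr; linarith)
  have hGw : ‖G x w‖ ≤ K * (K * e) :=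
    (ContinuousLinearMap.le_opNorm _ _).trans (by gcongr; exact h.coeff.norm x)
  have hDG : ‖fderiv ℝ G x (G x w)‖ ≤ K * (K * (K * e)) :=
    (ContinuousLinearMap.le_opNorm _ _).trans (by gcongr; exact h.coeff.deriv x)
  have hlast : ‖G x w' + areaCoeff G x z + fderiv ℝ G x (G x w) w'‖
      ≤ K * (K * e) + K * (K * e ^ 2) + K * (K * (K * e)) * (K * e) := by
    refine norm_add₃_le.trans (add_le_add_three ?_ ?_ ?_)
    · exact (ContinuousLinearMap.le_opNorm _ _).trans (by gcongr; exact h.coeff.norm x)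
    · exact (ContinuousLinearMap.le_opNorm _ _).trans (by gcongr; exact h.coeff.area x)
    · exact (ContinuousLinearMap.le_opNorm _ _).trans (by gcongr)
  rw [heq]
  calc _ ≤ K * ((K * (K * e) ^ 2 + K * (K * e ^ 2)) * (K * e) + (K * (K * e)) * (K * e ^ 2)
        + (K * e ^ 2) * (K * (K * e) + K * (K * e ^ 2) + K * (K * (K * e)) * (K * e))) := by
        refine (ContinuousLinearMap.le_opNorm _ _).trans ?_
        gcongr
        refine norm_sub_le_of_le (norm_add_le_of_le ?_ ?_) ?_
        · exact (ContinuousLinearMap.le_opNorm _ _).trans (by gcongr)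
        · exact (ContinuousLinearMap.le_opNorm _ _).trans (by gcongr)
        · exact (ContinuousLinearMap.le_opNorm _ _).trans (by gcongr)
    _ = (K ^ 5 + K ^ 4 + K ^ 4 + K ^ 4 + K ^ 4 * e + K ^ 6 * e) * e ^ 3 := by ring
    _ ≤ (K ^ 6 + K ^ 6 + K ^ 6 + K ^ 6 + K ^ 6 * 1 + K ^ 6 * 1) * e ^ 3 := by
        gcongr <;> norm_num
    _ = _ := by ring

/-- Sewing on the uniform grid of `[s, t]` yields a bound independent of `n`, so it passes to the
rough integral. -/
theorem MildBounds.norm_sum_germ_sub_le [FiniteDimensional ℝ E] (h : MildBounds A F G X T 1 K U)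
    (hα : 1 / 3 < (α : ℝ)) (hα' : (α : ℝ) ≤ 1 / 2) {s t : ℝ} (hs : 0 ≤ s) (hst : s ≤ t)
    (ht : t ≤ T) (hts : t - s ≤ 1) {n : ℕ} (hn : 0 < n) :
    ‖(∑ k ∈ Finset.range n, semigroup A (t - (s + k * ((t - s) / n)))
        (roughIncrement G X (s + k * ((t - s) / n)) (s + (k + 1 : ℕ) * ((t - s) / n))
          (U (s + k * ((t - s) / n)))))
      - semigroup A (t - s) (roughIncrement G X s t (U s))‖
      ≤ davieConst α K * ((t - s) ^ (α : ℝ)) ^ 3 := by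
  have hK1 := h.coeff.one_le
  have hM := davieConst_ge hα hK1
  have hMeq := davieConst_eq (K := K) hα
  set M := davieConst α K
  have hM0 : 0 ≤ M := le_trans (by positivity) hM
  set η := (t - s) / n with hη
  have hη0 : 0 ≤ η := div_nonneg (by linarith) (by positivity)
  have hnη : n * η = t - s := by rw [hη]; field_simp
  set q : ℕ → ℝ := fun k => s + k * η with hq
  have hqle {k l : ℕ} (hkl : k ≤ l) : q k ≤ q l := by simp only [hq]; gcongr
  have hq0 : q 0 = s := by simp [hq]
  have hqn : q n = t := by simp only [hq, hnη]; ring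
  have hgap {k l : ℕ} (hkl : k ≤ l) : q l - q k = ((l - k : ℕ) : ℝ) * η := by
    simp only [hq]; push_cast [hkl]; ring
  set Ξ : ℕ → ℕ → E := fun k l => semigroup A (t - q k) (roughIncrement G X (q k) (q l) (U (q k)))
    with hΞ
  have hsew := discrete_sewing (a := fun k l => ‖(∑ j ∈ Finset.Ico k l, Ξ j (j + 1)) - Ξ k l‖)
    (ω := fun m => (((m : ℝ) * η) ^ (α : ℝ)) ^ 3) (r := sewingFactor α) (C := 6 * K ^ 6)
    (M := M) (L := n) (by positivity) hM0 (fun m => by positivity)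
    (fun i j hij => by dsimp only; gcongr)
    (fun i j hij => two_mul_rpow_cube_le α.2 (by positivity) (by
      rw [← mul_assoc]; gcongr; exact_mod_cast hij))
    (by nlinarith [show 0 ≤ K ^ 6 by positivity]) (fun k => by simp [hΞ, roughIncrement_self])
    (fun k _ => by simp)
    (fun k m l hkm hml hl _ => by
      have h1 := h.norm_germ_defect_le hα' (s := q k) (u := q m) (v := q l) (t := t)
        (hs.trans (hq0 ▸ hqle (Nat.zero_le k))) (hqle hkm) (hqle hml) (hqn ▸ hqle hl) ht
        (by linarith [hqle hl, hqle (Nat.zero_le k)])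
      rw [hgap (hkm.trans hml)] at h1
      rw [← Finset.sum_Ico_consecutive _ hkm hml]
      refine le_trans (le_of_eq ?_) (norm_add₃_le.trans (add_le_add_three le_rfl le_rfl h1))
      congr 1
      simp only [hΞ]
      abel) 0 n (Nat.zero_le _) le_rfl
  simp only [Nat.sub_zero, hnη, hΞ, hqn, hq0, ← Finset.range_eq_Ico] at hsew
  exact hsew

/-- Only integrals from `0` are given, with integrands depending on the end time, so `I - S(t-s) I'`
plays the role of the integral over `[s, t]`. Concatenating uniform partitions of `[0, s]` and `[s,
t]`, fine enough for both integrals, isolates the Riemann sum over `[s, t]`. -/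
theorem exists_sum_germ_near [FiniteDimensional ℝ E] (A : E →L[ℝ] E) (G : E → V →L[ℝ] E) (X : RoughPath α V) (U : ℝ → E)
    {s t : ℝ} (hs : 0 ≤ s) (hst : s ≤ t) {I I' : E}
    (hI : HasRoughIntegral X (fun r => (semigroup A (t - r)).comp (G (U r)))
      (fun r => postcomp (semigroup A (t - r)) (compDeriv G U (fun q => G (U q)) r)) 0 t I)
    (hI' : HasRoughIntegral X (fun r => (semigroup A (s - r)).comp (G (U r)))
      (fun r => postcomp (semigroup A (s - r)) (compDeriv G U (fun q => G (U q)) r)) 0 s I')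
    {ε : ℝ} (hε : 0 < ε) :
    ∃ n : ℕ, 0 < n ∧ ‖(∑ k ∈ Finset.range n, semigroup A (t - (s + k * ((t - s) / n)))
        (roughIncrement G X (s + k * ((t - s) / n)) (s + (k + 1 : ℕ) * ((t - s) / n))
          (U (s + k * ((t - s) / n))))) - (I - semigroup A (t - s) I')‖ ≤ ε := by
  rw [hasRoughIntegral_mild_iff] at hI hI'
  -- The error for `I'` is multiplied by `S(t-s)`, so both tolerances are taken as `ε / c`.
  set c := 1 + ‖semigroup A (t - s)‖ with hc
  have hc0 : 0 < c := by positivity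
  obtain ⟨δ, hδ, h⟩ := hI (ε / c) (by positivity)
  obtain ⟨δ', hδ', h'⟩ := hI' (ε / c) (by positivity)
  obtain ⟨n, hn⟩ := exists_nat_gt (max 0 (t / min δ δ'))
  have hn0 : (0 : ℝ) < n := (le_max_left _ _).trans_lt hn
  have hnt : t / n < min δ δ' := by
    rw [div_lt_iff₀ hn0]
    have := (div_lt_iff₀ (lt_min hδ hδ')).mp ((le_max_right _ _).trans_lt hn)
    linarith
  have hs_n : s / n < min δ δ' := lt_of_le_of_lt (by gcongr) hnt
  have hts_n : (t - s) / n < min δ δ' := lt_of_le_of_lt (by gcongr; linarith) hnt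
  set p : ℕ → ℝ := fun i => if i ≤ n then i * (s / n) else s + ((i : ℝ) - n) * ((t - s) / n) with hp
  have hp1 {i : ℕ} (hi : i ≤ n) : p i = i * (s / n) := by simp [hp, hi]
  have hp2 (k : ℕ) : p (n + k) = s + k * ((t - s) / n) := by
    rcases Nat.eq_zero_or_pos k with rfl | hk
    · simp only [hp, add_zero, le_refl, if_true, Nat.cast_zero, zero_mul]
      field_simp
    · simp [hp, show ¬ n + k ≤ n by omega]
  have hstep1 {i : ℕ} (hi : i < n) : p (i + 1) - p i = s / n := by
    rw [hp1 hi.le, hp1 hi]; push_cast; ring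
  have hstep2 (k : ℕ) : p (n + k + 1) - p (n + k) = (t - s) / n := by
    rw [add_assoc, hp2, hp2]; push_cast; ring
  have hstep (i : ℕ) : 0 ≤ p (i + 1) - p i ∧ p (i + 1) - p i < min δ δ' := by
    rcases Nat.lt_or_ge i n with hi | hi
    · rw [hstep1 hi]; exact ⟨by positivity, hs_n⟩
    · obtain ⟨k, rfl⟩ := Nat.exists_eq_add_of_le hi
      rw [hstep2]; exact ⟨div_nonneg (by linarith) hn0.le, hts_n⟩
  have hp0 : p 0 = 0 := by simp [hp]
  have hpn : p n = s := by simpa using hp2 0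
  have hpnn : p (n + n) = t := by rw [hp2]; field_simp; ring
  have hpart : IsPartition 0 t δ (n + n) p := ⟨hp0, hpnn, fun i _ => sub_nonneg.mp (hstep i).1,
    fun i _ => (hstep i).2.trans_le (min_le_left _ _)⟩
  have hpart' : IsPartition 0 s δ' n p := ⟨hp0, hpn, fun i _ => sub_nonneg.mp (hstep i).1,
    fun i _ => (hstep i).2.trans_le (min_le_right _ _)⟩
  have h1 := h _ _ hpart
  have h2 := h' _ _ hpart'
  refine ⟨n, by exact_mod_cast hn0, ?_⟩
  rw [Finset.sum_range_add] at h1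
  have e2 : ∑ i ∈ Finset.range n, semigroup A (t - p i)
        (roughIncrement G X (p i) (p (i + 1)) (U (p i)))
      = semigroup A (t - s) (∑ i ∈ Finset.range n, semigroup A (s - p i)
        (roughIncrement G X (p i) (p (i + 1)) (U (p i)))) := by
    rw [map_sum]
    exact Finset.sum_congr rfl fun i _ => semigroup_sub_apply A _ _ _ _
  simp only [add_assoc, hp2] at h1
  rw [e2] at h1
  set S₁ := ∑ i ∈ Finset.range n, semigroup A (s - p i)
    (roughIncrement G X (p i) (p (i + 1)) (U (p i)))
  set S₂ := ∑ k ∈ Finset.range n, semigroup A (t - (s + k * ((t - s) / n)))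
    (roughIncrement G X (s + k * ((t - s) / n)) (s + (k + 1 : ℕ) * ((t - s) / n))
      (U (s + k * ((t - s) / n))))
  have heq : S₂ - (I - semigroup A (t - s) I')
      = (semigroup A (t - s) S₁ + S₂ - I) - semigroup A (t - s) (S₁ - I') := by
    rw [map_sub]; abel
  rw [heq]
  calc _ ≤ ε / c + ‖semigroup A (t - s)‖ * (ε / c) :=
        norm_sub_le_of_le h1.le ((ContinuousLinearMap.le_opNorm _ _).trans (by gcongr))
    _ = ε / c * c := by rw [hc]; ring
    _ = ε := div_mul_cancel₀ _ hc0.ne'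

/-- Subtracting `S(t-s)` times the mild equation at `s` from the one at `t` shows that the mild
defect is the rough integral over `[s, t]` minus its germ. Sewing makes this third order, and the
comparison of the two local errors transfers the bound. -/
theorem IsMildSolution.isDavieOn [FiniteDimensional ℝ E] (hα : 1 / 3 < (α : ℝ))
    (hα' : (α : ℝ) ≤ 1 / 2) (hc : CoeffBounds (fun x => A x + F x) G K) {L : ℝ≥0}
    (hF : LipschitzWith L F) (hU : IsMildSolution A F G X ξ U) (hT : 0 < T) :
    ∃ R M, IsDavieOn (fun x => A x + F x) G X T 1 R M U := by
  have hα0 : 0 < (α : ℝ) := by linarith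
  obtain ⟨K', hH⟩ := (hU.controlled T hT).holderBounds
  obtain ⟨R, hR⟩ := isCompact_Icc.exists_bound_of_continuousOn
    (continuousOn_of_local_holder hα0 one_pos hH.holder)
  obtain ⟨C, h⟩ := exists_mildBounds (A := A) hc hF hR hH
  refine ⟨R, davieConst α C + 5 * C ^ 3, fun t h0 ht => hR t ⟨h0, ht⟩,
    fun s t hs hst ht hts => ?_⟩
  obtain ⟨I, hI, hUt⟩ := hU.mild t (hs.trans hst)
  obtain ⟨I', hI', hUs⟩ := hU.mild s hs
  have hcont : ContinuousOn (fun r => F (U r)) (Icc 0 t) :=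
    (continuous_of_norm_sub_le h.drift).comp_continuousOn
      ((h.continuousOn hα0 one_pos).mono (Icc_subset_Icc le_rfl ht))
  have hdef : mildDefect A F G X U s t
      = (I - semigroup A (t - s) I') - semigroup A (t - s) (roughIncrement G X s t (U s)) := by
    have h1 := semigroup_mildDefect (A := A) (G := G) (X := X) hcont hs hst le_rfl
    rw [sub_self, semigroup_zero, one_apply_eq_self, one_apply_eq_self] at h1
    have hint : semigroup A (t - s) (∫ r in (0 : ℝ)..s, semigroup A (s - r) (F (U r)))
        = ∫ r in (0 : ℝ)..s, semigroup A (t - r) (F (U r)) := by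
      rw [← ContinuousLinearMap.intervalIntegral_comp_comm]
      · exact intervalIntegral.integral_congr fun r _ => (semigroup_sub_apply A r s t _).symm
      · exact (((continuous_semigroup A).comp
          (continuous_const.sub continuous_id)).continuousOn.clm_apply
          (hcont.mono (Icc_subset_Icc le_rfl hst))).intervalIntegrable_of_Icc hs
    have hξ := semigroup_sub_apply A 0 s t ξ
    rw [sub_zero, sub_zero] at hξ
    have h2 : semigroup A (t - s) (U s) = semigroup A t ξ
        + (∫ r in (0 : ℝ)..s, semigroup A (t - r) (F (U r))) + semigroup A (t - s) I' := by
      rw [hUs, map_add, map_add, hint, hξ]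
    rw [← h1, h2, hUt]
    abel
  have hgerm : ‖mildDefect A F G X U s t‖ ≤ davieConst α C * ((t - s) ^ (α : ℝ)) ^ 3 := by
    rw [hdef]
    refine le_of_forall_pos_le_add fun ε hε => ?_
    obtain ⟨n, hn, hsum⟩ := exists_sum_germ_near A G X U hs hst hI hI' hε
    have h1 := h.norm_sum_germ_sub_le hα hα' hs hst ht hts hn
    rw [norm_sub_rev] at hsum
    rw [add_comm]
    refine le_trans (le_of_eq ?_) (norm_add_le_of_le hsum h1)
    rw [sub_add_sub_cancel]
  have hcmp := h.norm_mildDefect_sub_le hα0 hα' one_pos le_rfl hs hst ht hts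
  rw [add_mul]
  refine le_trans (le_of_eq ?_) (norm_sub_le_of_le hgerm hcmp)
  rw [sub_sub_cancel]

end MildEquivalence

/-! ### The cocycle property -/

section Cocycle

variable {α : ℝ≥0} {V : Type*} [NormedAddCommGroup V] [InnerProductSpace ℝ V]

theorem RoughPath.eq_of_path_area {X Y : RoughPath α V} (h1 : X.path = Y.path)
    (h2 : X.area = Y.area) : X = Y := by
  cases X; cases Y
  simp only at h1 h2
  subst h1 h2
  rfl

theorem IsRoughPathCocycle.map_eq_shift {Ω : Type*} [MeasurableSpace Ω] [MeasurableSpace V]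
    {P : Measure Ω} {θ : ℝ → Ω → Ω} (hθ : IsMetricDynamicalSystem P θ) {W : Ω → RoughPath α V}
    (hW : IsRoughPathCocycle θ W) (τ : ℝ) (ω : Ω) : W (θ τ ω) = (W ω).shift τ := by
  have hadd (s t : ℝ) (ω : Ω) : θ s (θ t ω) = θ (s + t) ω := by rw [hθ.add]; rfl
  have hpos (s t : ℝ) (ω : Ω) (ht : 0 ≤ t) :
      (W (θ s ω)).path t = (W ω).path (s + t) - (W ω).path s := by
    rw [hW.path_cocycle ω s t ht, RoughPath.path_zero, sub_zero]
  have harea (s t : ℝ) (hst : s ≤ t) :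
      (W (θ τ ω)).area s t = (W ω).area (s + τ) (t + τ) := by
    have h1 := hW.area_cocycle (θ τ ω) s (t - s) (by linarith)
    have h2 := hW.area_cocycle ω (s + τ) (t - s) (by linarith)
    rw [hadd, ← h2] at h1
    convert h1 using 2 <;> ring
  have hpath (t : ℝ) : (W (θ τ ω)).path t = (W ω).path (t + τ) - (W ω).path τ := by
    rcases le_total 0 t with ht | ht
    · rw [hpos τ t ω ht, add_comm τ]
    -- For negative `t` the relation is read from the base point `t + τ` forward by `-t`, which ends
    -- at `τ`.
    · have h1 := hpos t (-t) (θ τ ω) (by linarith)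
      rw [hadd, hpos (t + τ) (-t) ω (by linarith), add_neg_cancel, RoughPath.path_zero,
        show t + τ + -t = τ by ring] at h1
      rw [zero_sub] at h1
      rw [← neg_inj, ← h1, neg_sub]
  refine RoughPath.eq_of_path_area (funext hpath) (funext fun s => funext fun t => ?_)
  change (W (θ τ ω)).area s t = (W ω).area (s + τ) (t + τ)
  rcases le_total s t with hst | hst
  · exact harea s t hst
  -- For reversed arguments, Chen's relation on `s, t, s` with zero diagonal area determines the
  -- area at `(s, t)` from the area at `(t, s)` and the path increments, all of which already agree.
  · have h1 := (W (θ τ ω)).chen s t s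
    have h2 := (W ω).chen (s + τ) (t + τ) (s + τ)
    rw [RoughPath.area_self, harea t s hst, hpath, hpath] at h1
    rw [RoughPath.area_self] at h2
    simp only [sub_sub_sub_cancel_right] at h1
    have h3 := h1.trans h2.symm
    rwa [sub_left_inj, sub_right_inj] at h3

end Cocycle

/-! ### Measurability of the solution map -/

section Measurability

theorem measurable_clm_apply_of_continuous {E Z Ω : Type*} [NormedAddCommGroup E]
    [NormedSpace ℝ E] [FiniteDimensional ℝ E] [MeasurableSpace E] [BorelSpace E] [MeasurableSpace Ω]
    [NormedAddCommGroup Z] [NormedSpace ℝ Z]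
    [FiniteDimensional ℝ Z] [MeasurableSpace Z] [BorelSpace Z] {H : E → Z →L[ℝ] E}
    (hH : Continuous H) {y : Ω → E} {z : Ω → Z} (hy : Measurable y) (hz : Measurable z) :
    Measurable (fun p => H (y p) (z p)) := by
  have _ : ProperSpace E := FiniteDimensional.proper ℝ E
  have _ : ProperSpace Z := FiniteDimensional.proper ℝ Z
  have hm : Continuous (fun q : E × Z => H q.1 q.2) :=
    (hH.comp continuous_fst).clm_apply continuous_snd
  exact hm.measurable.comp (hy.prodMk hz)

variable {α : ℝ≥0} {V : Type*} [NormedAddCommGroup V] [InnerProductSpace ℝ V]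
  [FiniteDimensional ℝ V] [MeasurableSpace V] [BorelSpace V]
variable {E : Type*} [NormedAddCommGroup E] [InnerProductSpace ℝ E] [FiniteDimensional ℝ E]
  [MeasurableSpace E] [BorelSpace E]
variable {Ω : Type*} [MeasurableSpace Ω] {θ : ℝ → Ω → Ω} {W : Ω → RoughPath α V}
variable {B : E → E} {G : E → V →L[ℝ] E} {K : ℝ}

theorem measurable_davieScheme (hc : CoeffBounds B G K) (hW : IsRoughPathCocycle θ W) (h : ℝ)
    (k : ℕ) : Measurable (fun p : Ω × E => davieScheme B G (W p.1) h p.2 k) := by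
  have _ : ProperSpace E := FiniteDimensional.proper ℝ E
  have _ : ProperSpace V := FiniteDimensional.proper ℝ V
  induction k with
  | zero => exact measurable_snd
  | succ k ih =>
    have hp (t : ℝ) : Measurable (fun p : Ω × E => (W p.1).path t) :=
      (hW.measurable_path t).comp measurable_fst
    have ha (s t : ℝ) : Measurable[_, borel (V ⊗[ℝ] V)] (fun p : Ω × E => (W p.1).area s t) :=
      (hW.measurable_area s t).comp measurable_fst
    simp only [davieScheme, davieIncrement]
    have h1 : Measurable (fun p : Ω × E => B (davieScheme B G (W p.1) h p.2 k)) :=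
      hc.continuous_drift.measurable.comp ih
    have h2 (s t : ℝ) : Measurable (fun p : Ω × E =>
        G (davieScheme B G (W p.1) h p.2 k) ((W p.1).path t - (W p.1).path s)) :=
      measurable_clm_apply_of_continuous hc.continuous ih ((hp t).sub (hp s))
    have h3 (s t : ℝ) : Measurable (fun p : Ω × E =>
        areaCoeff G (davieScheme B G (W p.1) h p.2 k) ((W p.1).area s t)) := by
      let _ : MeasurableSpace (V ⊗[ℝ] V) := borel _
      have _ : BorelSpace (V ⊗[ℝ] V) := ⟨rfl⟩
      exact measurable_clm_apply_of_continuous (Z := V ⊗[ℝ] V) hc.continuous_area ih (ha s t)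
    exact ih.add (((h1.const_smul _).add (h2 _ _)).add (h3 _ _))

/-- The approximations depend on time only through an index in `ℕ`. Joint measurability thus follows
from measurability at each index, and passes to the pointwise limit. -/
theorem measurable_davieSolution (hα : 1 / 3 < (α : ℝ)) (hα' : (α : ℝ) ≤ 1 / 2)
    (hc : CoeffBounds B G K) (hW : IsRoughPathCocycle θ W) :
    Measurable (fun p : ℝ≥0 × Ω × E => davieSolution B G (W p.2.1) p.2.2 p.1) := by
  refine measurable_of_tendsto_metrizable (f := fun n p => davieApprox B G (W p.2.1) p.2.2 n p.1)
    (fun n => ?_) (tendsto_pi_nhds.mpr fun p => tendsto_davieApprox hα hα' hc _ _ p.1.2)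
  have h1 : Measurable (fun q : ℕ × Ω × E =>
      davieScheme B G (W q.2.1) ((1 / 2) ^ n) q.2.2 q.1) :=
    measurable_from_prod_countable_right fun k => measurable_davieScheme hc hW _ k
  have h2 : Measurable (fun p : ℝ≥0 × Ω × E => ⌊(p.1 : ℝ) * 2 ^ n⌋₊) :=
    Nat.measurable_floor.comp ((measurable_coe_nnreal_real.comp measurable_fst).mul_const _)
  exact h1.comp (h2.prodMk measurable_snd)

end Measurability

end

/-! ### Assembly of the random dynamical system. -/

theorem mainTheorem5
    {E : Type*} [NormedAddCommGroup E] [InnerProductSpace ℝ E] [FiniteDimensional ℝ E]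
    [MeasurableSpace E] [BorelSpace E]
    {V : Type*} [NormedAddCommGroup V] [InnerProductSpace ℝ V] [FiniteDimensional ℝ V]
    [MeasurableSpace V] [BorelSpace V]
    {Ω : Type*} [MeasurableSpace Ω] (P : Measure Ω) (θ : ℝ → Ω → Ω)
    (hθ : IsMetricDynamicalSystem P θ)
    (α : ℝ≥0) (hα : (1 / 3 : ℝ) < (α : ℝ)) (hα' : (α : ℝ) ≤ 1 / 2)
    (A : E →L[ℝ] E) (F : E → E) (L : ℝ≥0) (hF : LipschitzWith L F)
    (G : E → V →L[ℝ] E) (hG : IsCb 3 G)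
    (W : Ω → RoughPath α V) (hW : IsRoughPathCocycle θ W) :
    ∃ φ : ℝ≥0 → RoughPath α V → E → E,
      (∀ (X : RoughPath α V) (ξ : E),
        IsMildSolution A F G X ξ (fun t : ℝ => φ t.toNNReal X ξ) ∧
        ∀ U : ℝ → E, IsMildSolution A F G X ξ U → ∀ t : ℝ≥0, U t = φ t X ξ) ∧
      (∀ (t τ : ℝ≥0) (X : RoughPath α V) (ξ : E),
        φ (t + τ) X ξ = φ t (X.shift τ) (φ τ X ξ)) ∧
      (∀ (τ : ℝ) (ω : Ω), W (θ τ ω) = (W ω).shift τ) ∧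
      IsRandomDynamicalSystem P θ (fun t ω ξ => φ t (W ω) ξ) := by
  obtain ⟨K, hc⟩ := exists_coeffBounds (A.lipschitz.add hF) hG
  have hshift := hW.map_eq_shift hθ
  have hadd (t τ : ℝ≥0) (X : RoughPath α V) (ξ : E) := davieSolution_add hα hα' hc X ξ t.2 τ.2
  refine ⟨fun t X ξ => davieSolution (fun x => A x + F x) G X ξ t, fun X ξ => ⟨?_, fun U hU t => ?_⟩,
    fun t τ X ξ => ?_, hshift, hθ, ?_, fun ω => ?_, fun t τ ω ξ => ?_, fun t ω => ?_⟩
  · refine isMildSolution_of_isDavieOn hα hα' hc hF (fun T => ?_) ?_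
    · obtain ⟨δ, C, M, hδ, h⟩ := davieSolution_isDavieOn hα hα' hc X ⌈T⌉₊
      -- The path is extended to negative times by its value at `0`; the Davie conditions only see
      -- nonnegative times.
      have hcoe {t : ℝ} (ht : 0 ≤ t) : ((t.toNNReal : ℝ≥0) : ℝ) = t := Real.coe_toNNReal t ht
      refine ⟨δ, C * (1 + ‖ξ‖), M * (1 + ‖ξ‖), hδ, fun t h0 hT => ?_, fun s t hs hst hT hts => ?_⟩
      · simp only [hcoe h0]
        exact (h ξ).bdd t h0 (hT.trans (Nat.le_ceil T))
      · simp only [hcoe hs, hcoe (hs.trans hst)]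
        exact (h ξ).error s t hs hst (hT.trans (Nat.le_ceil T)) hts
    · simp [davieSolution_zero]
  · obtain ⟨T, hT⟩ := exists_nat_gt (t : ℝ)
    obtain ⟨R, M, hD⟩ := hU.isDavieOn hα hα' hc hF (T := T) (t.2.trans_lt hT)
    obtain ⟨δ, C, M', hδ, h⟩ := davieSolution_isDavieOn hα hα' hc X T
    exact hD.eq hα hα' hc one_pos hδ (h ξ) (by rw [hU.initial, davieSolution_zero]) t t.2 hT.le
  · exact hadd t τ X ξ
  · exact measurable_davieSolution hα hα' hc hW
  · funext ξ
    simp [davieSolution_zero]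
  · simp only [hshift]
    exact hadd t τ (W ω) ξ
  · exact continuous_davieSolution hα hα' hc (W ω) t.2
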